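/- Consider the synchronous message-passing model on an $n$-node graph $G=(V,E)$, $n\ge 2$: $G$ is arbitrary (possibly disconnected), the edges at each node are numbered by ports in an arbitrary way, in every round each node sends one message of at most $B$ bits through each of its ports (CONGEST model with $B$-bit messages), and local computation is unrestricted. Each node initially knows only its own unique $b$-bit identifier (so necessarily $b\ge\log_2 n$, i.e. $b=\Omega(\log n)$), the number $b$, its degree, and an estimate $N$ of $n$ with $n\le N\le n^{k}$, where $k$ is a constant; the constants hidden in the $O$-notation below may depend on $k$ only. Write $\log=\log_2$, and let $\log^* b$ be the number of times $\log_2$ must be applied to $b$ until the value is at most $1$. There is a deterministic distributed algorithm that, for every such $G$, $b$, $N$, every port numbering and every assignment of unique $b$-bit identifiers, runs for $O(\log^8 n+(\log^* b)\cdot\log^5 n)$ rounds with messages of $O(b)$ bits and computes a network decomposition of $G$ with $O(\log n)$ colors and weak diameter $O(\log^3 n)$: the vertex set is partitioned into clusters, each cluster has one of $O(\log n)$ colors, clusters joined by an edge of $G$ have different colors, and any two vertices of the same cluster are at distance $O(\log^3 n)$ in $G$. At the end each node knows its color and the label of its cluster. Moreover, for each cluster $\mathcal C$ the algorithm computes a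 Steiner tree $T_{\mathcal C}$ of radius $O(\log^3 n)$, that is, a subgraph of $G$ that is a tree, contains all terminals, and has a vertex from which all its vertices are at distance $O(\log^3 n)$ in the tree; the set of terminals is $\mathcal C$, and $T_{\mathcal C}$ may contain further vertices. At the end each node knows in which of these trees it lies, and each edge of a tree is known as such, by its port, to at least one of its endpoints. For each color, each vertex of $G$ lies in $O(\log n)$ of the Steiner trees of the clusters of that color. -/

import Mathlib

/-- The iterated binary logarithm `log^* x`: how many times `log₂` has to be applied to `x`
until the value is at most `1`. -/
noncomputable def logStar (x : ℝ) : ℕ :=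
  sInf {k : ℕ | (Real.logb 2)^[k] x ≤ 1}

/-- A port numbering of `G`: the edges at `v` are numbered `0, …, deg v - 1` in an arbitrary
way, independently at every node; `nbr v i` is the neighbor of `v` behind port `i`. -/
structure PortNumbering {V : Type*} (G : SimpleGraph V) where
  deg : V → ℕ
  nbr : ∀ v : V, Fin (deg v) ≃ G.neighborSet v

namespace PortNumbering

variable {V : Type*} {G : SimpleGraph V}

/-- The port of the `i`-th neighbor of `v` that leads back to `v`. -/
def backPort (P : PortNumbering G) (v : V) (i : Fin (P.deg v)) :
    Fin (P.deg (P.nbr v i : V)) :=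
  (P.nbr (P.nbr v i : V)).symm ⟨v, G.adj_symm (P.nbr v i).2⟩

end PortNumbering

/-- What a single node outputs: its color, the label of its cluster, and its part of the Steiner
trees. An entry `(c, some i)` of `links` says that the node is in the tree of the cluster with
label `c` and that the edge behind its port `i` is a tree edge (for instance the edge to its
parent); an entry `(c, none)` only says that it is in that tree (for instance as the root). -/
structure NodeOutput where
  color : ℕ
  cluster : ℕ
  links : Finset (ℕ × Option ℕ)

/-- A deterministic synchronous message passing algorithm. Local computation is unrestricted.
At the start a node knows an estimate `N` of the number of nodes, the length `b` of the
identifiers, its own degree and its own identifier. In each round it sends a bit string through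
each of its ports and then updates its state from the list of the received bit strings
(the `i`-th entry came in through port `i`). All nodes stop after `rounds N b` rounds. -/
structure CongestAlgorithm where
  State : Type
  start : (N b deg : ℕ) → (Fin b → Bool) → State
  send : State → (port : ℕ) → List Bool
  receive : State → List (List Bool) → State
  rounds : (N b : ℕ) → ℕ
  output : State → NodeOutput

namespace CongestAlgorithm

variable {V : Type*} {G : SimpleGraph V}

/-- The state of every node after `t` rounds. -/
def stateAt (A : CongestAlgorithm) (P : PortNumbering G) (N : ℕ) {b : ℕ}
    (ident : V → Fin b → Bool) : ℕ → V → A.State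
  | 0, v => A.start N b (P.deg v) (ident v)
  | t + 1, v =>
      A.receive (A.stateAt P N ident t v)
        (List.ofFn fun i : Fin (P.deg v) =>
          A.send (A.stateAt P N ident t (P.nbr v i)) (P.backPort v i))

/-- Every message sent in the execution has at most `B` bits. -/
def MessagesAtMost (A : CongestAlgorithm) (P : PortNumbering G) (N : ℕ) {b : ℕ}
    (ident : V → Fin b → Bool) (B : ℝ) : Prop :=
  ∀ t < A.rounds N b, ∀ (v : V) (i : Fin (P.deg v)),
    ((A.send (A.stateAt P N ident t v) i).length : ℝ) ≤ B

/-- The output of every node at the end of the execution. -/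
def result (A : CongestAlgorithm) (P : PortNumbering G) (N : ℕ) {b : ℕ}
    (ident : V → Fin b → Bool) (v : V) : NodeOutput :=
  A.output (A.stateAt P N ident (A.rounds N b) v)

end CongestAlgorithm

/-- The subgraph of `G` that the outputs describe as the tree of the cluster with label `c`. -/
def outputTree {V : Type*} {G : SimpleGraph V} (P : PortNumbering G) (out : V → NodeOutput)
    (c : ℕ) : G.Subgraph where
  verts := {v | ∃ p, (c, p) ∈ (out v).links}
  Adj u v :=
    (∃ p, (c, p) ∈ (out u).links) ∧ (∃ p, (c, p) ∈ (out v).links) ∧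
      ((∃ i : Fin (P.deg u), (P.nbr u i : V) = v ∧ (c, some (i : ℕ)) ∈ (out u).links) ∨
        (∃ i : Fin (P.deg v), (P.nbr v i : V) = u ∧ (c, some (i : ℕ)) ∈ (out v).links))
  adj_sub := by
    rintro u v ⟨-, -, ⟨i, rfl, -⟩ | ⟨i, rfl, -⟩⟩
    · exact (P.nbr u i).2
    · exact G.adj_symm (P.nbr v i).2
  edge_vert := fun h => h.1
  symm := ⟨fun _ _ h => ⟨h.2.1, h.1, h.2.2.symm⟩⟩

/-- `cluster` (the label of the cluster of each node) and `color` form a network decomposition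
of `G` with at most `K` colors and weak diameter at most `D`. -/
structure IsWeakDecomposition {V : Type*} (G : SimpleGraph V) (cluster color : V → ℕ)
    (K D : ℝ) : Prop where
  /-- The color is a color of the cluster. -/
  color_eq : ∀ u v, cluster u = cluster v → color u = color v
  /-- Adjacent clusters have different colors. -/
  color_ne : ∀ u v, G.Adj u v → cluster u ≠ cluster v → color u ≠ color v
  /-- The colors are among `0, …, K - 1`. -/
  color_lt : ∀ v, (color v : ℝ) + 1 ≤ K
  /-- Two nodes of the same cluster have distance at most `D` in `G`. -/
  weak_diam : ∀ u v, cluster u = cluster v → G.Reachable u v ∧ (G.dist u v : ℝ) ≤ D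

/-- `T` is a Steiner tree in `G` with terminal set `S` and radius at most `R`. -/
structure IsSteinerTree {V : Type*} {G : SimpleGraph V} (T : G.Subgraph) (S : Set V)
    (R : ℝ) : Prop where
  isTree : T.coe.IsTree
  terminals : S ⊆ T.verts
  radius : ∃ r : T.verts, ∀ v : T.verts, (T.coe.dist r v : ℝ) ≤ R

/-! Let `x` be the bit length of `N`, so `n < 2 ^ x`. One repetition produces the clusters of one
color: at least half of the unfinished nodes survive it, and adjacent survivors lie in the same
cluster. Hence `x` repetitions finish every node (`run_rep`, `run_decomp`).

A repetition starts from singleton clusters and consists of `24 * x` phases. In a phase the clusters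
are colored red and blue, and then the blue ones grow for `48 * x * x` steps. In a step every red
node with a blue neighbor proposes to one. With `K = 48 * x`, a blue cluster accepts if its size is
at most `K` times the number of its proposals; otherwise the proposers die and the cluster has no
red neighbor ever after: it is stalled. Accepting multiplies the size by at least `1 + 1/K`, so at
the end every blue cluster is stalled (`Grows.size`). Deaths are charged to the nodes of the newly
stalled cluster, `K` nodes per death, so a phase kills at most a fraction `1/K` of the nodes and a
repetition at most half of them (`Grows.deaths`, `run_all_phases`).

After a phase no edge joins red and blue survivors, so each component of the cluster graph is
contained in one color class of an old component. If both classes hold at least 1/24 of the clusters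
of every component with several clusters, then the number of clusters in a component shrinks by
23/24 per phase, down to one (`Balanced.card_compClusters`).

The balanced coloring is what removes the dependence on the length `b` of the identifiers, up to
`log^* b`. Every cluster with a neighboring cluster chooses one. Clusters with the same choice are
numbered and colored by parity; a cluster whose choice is shared with no other compares its color
with that of its choice, in a coloring with 8 colors that Cole–Vishkin reduction yields after `log^*
b + O(1)` steps. That this is balanced is `card_le_mul_card_color`.

Clusters act through their Steiner trees. A node that joins hangs itself below the neighbor it
proposed to, so the depth grows by at most one per step, and a node joins at most once per phase, so
it is in at most `24 * x + 1` trees of a repetition. All communication inside clusters is one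
primitive, `scan`: sums towards the root, then total and prefix sums back (`Forest.run_scan`). Trees
are addressed by positions in the list of a node rather than by identifiers, so the numbers sent
along trees have `O(log n + log b)` bits. As `b ≥ log n`, a tree step takes `O(log n)` rounds, and
multiplying up gives `log^8 n` for the growth; the color reduction contributes `(log^* b) * log^5 n`
and lower order terms (`cost_mainProg_le`). -/

namespace NetDecomp

/-! ### Oblivious programs of long-message rounds -/

/-- What a node knows about its surroundings: its degree and its identifier, as a number. -/
structure Env where
  deg : ℕ
  id : ℕ

/-- A synchronous step in which a node sends a long bit string through each of its ports: bit `t`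
of the message for port `p` is `send e s p t`. The step is spread over `extra + 1` rounds. -/
structure Op (S : Type) where
  extra : ℕ
  send : Env → S → ℕ → ℕ → Bool
  recv : Env → S → (ℕ → ℕ → Bool) → S

/-- A node that executes a list of steps: `rem` lists the rounds that are still to come, and `buf`
holds the bits of the current message that have already arrived. -/
structure Machine (S : Type) where
  width : ℕ
  env : Env
  s : S
  buf : ℕ → ℕ → Bool
  rem : List (Op S × ℕ)

/-- The rounds of a step. -/
def Op.rounds {S : Type} (op : Op S) : List (Op S × ℕ) :=
  (List.range' 0 (op.extra + 1)).map fun k => (op, k)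

/-- The rounds of a program. -/
def schedule {S : Type} (prog : List (Op S)) : List (Op S × ℕ) :=
  prog.flatMap Op.rounds

/-- The message sent in the current round. -/
def Machine.send {S : Type} (m : Machine S) (p : ℕ) : List Bool :=
  match m.rem with
  | [] => []
  | (op, k) :: _ => List.ofFn fun u : Fin m.width => op.send m.env m.s p (k * m.width + u)

/-- The state after the current round. -/
def Machine.receive {S : Type} (m : Machine S) (msgs : List (List Bool)) : Machine S :=
  match m.rem with
  | [] => m
  | (op, k) :: rest =>
    let buf' : ℕ → ℕ → Bool := fun p t =>
      if t / m.width = k then (msgs.getD p []).getD (t % m.width) false else m.buf p t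
    if k = op.extra then
      { m with s := op.recv m.env m.s buf', buf := fun _ _ => false, rem := rest }
    else { m with buf := buf', rem := rest }

/-- The algorithm that executes the program `prog N b`, starting from `init`. -/
def compile {S : Type} (prog : ℕ → ℕ → List (Op S)) (init : Env → S) (out : S → NodeOutput) :
    CongestAlgorithm where
  State := Machine S
  start N b deg ident :=
    { width := b
      env := ⟨deg, Nat.ofBits ident⟩
      s := init ⟨deg, Nat.ofBits ident⟩
      buf := fun _ _ => false
      rem := schedule (prog N b) }
  send := Machine.send
  receive := Machine.receive
  rounds N b := (schedule (prog N b)).length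
  output m := out m.s

/-! ### Execution of compiled programs in the bounded-message model. -/

section Semantics

variable {V : Type*} {G : SimpleGraph V} (P : PortNumbering G) (idn : V → ℕ) (b : ℕ)

/-- The environment of a node. -/
def envOf (v : V) : Env := ⟨P.deg v, idn v⟩

/-- The effect of a step on the states of all nodes. -/
def step {S : Type} (op : Op S) (σ : V → S) (v : V) : S :=
  op.recv (envOf P idn v) (σ v) fun p t =>
    if h : p < P.deg v then
      decide (t < (op.extra + 1) * b) &&
        op.send (envOf P idn (P.nbr v ⟨p, h⟩)) (σ (P.nbr v ⟨p, h⟩)) (P.backPort v ⟨p, h⟩) t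
    else false

/-- The effect of a program on the states of all nodes. -/
def run {S : Type} (prog : List (Op S)) (σ : V → S) : V → S :=
  prog.foldl (fun τ op => step P idn b op τ) σ

@[simp] theorem run_nil {S : Type} (σ : V → S) : run P idn b [] σ = σ := rfl

@[simp] theorem run_cons {S : Type} (op : Op S) (prog : List (Op S)) (σ : V → S) :
    run P idn b (op :: prog) σ = run P idn b prog (step P idn b op σ) := rfl

theorem run_append {S : Type} (p q : List (Op S)) (σ : V → S) :
    run P idn b (p ++ q) σ = run P idn b q (run P idn b p σ) := by
  simp [run, List.foldl_append]

theorem run_replicate {S : Type} (r : ℕ) (op : Op S) (σ : V → S) :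
    run P idn b (List.replicate r op) σ = (step P idn b op)^[r] σ := by
  induction r generalizing σ with
  | zero => rfl
  | succ r ih => simp [List.replicate_succ, ih]

/-- One round of all the machines. -/
def machineRound {S : Type} (M : V → Machine S) (v : V) : Machine S :=
  (M v).receive (List.ofFn fun i : Fin (P.deg v) => (M (P.nbr v i)).send (P.backPort v i))

/-- The buffer invariant: before round `k` of a step exactly the bits below `k * b` have arrived.
Round `k` delivers the block of bits with `t / b = k`, which extends the bound to `(k + 1) * b`. -/
theorem buffer_update {S : Type} (hb : 0 < b) (op : Op S) (σ : V → S) (k : ℕ) (v : V) :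
    (fun p t : ℕ =>
      if t / b = k then ((List.ofFn fun i : Fin (P.deg v) => List.ofFn fun u : Fin b =>
          op.send (envOf P idn (P.nbr v i)) (σ (P.nbr v i)) (P.backPort v i)
            (k * b + u)).getD p []).getD (t % b) false
      else if h : p < P.deg v then decide (t < k * b) &&
          op.send (envOf P idn (P.nbr v ⟨p, h⟩)) (σ (P.nbr v ⟨p, h⟩)) (P.backPort v ⟨p, h⟩) t
        else false) =
      fun p t => if h : p < P.deg v then decide (t < (k + 1) * b) &&
          op.send (envOf P idn (P.nbr v ⟨p, h⟩)) (σ (P.nbr v ⟨p, h⟩)) (P.backPort v ⟨p, h⟩) t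
        else false := by
  funext p t
  by_cases hp : p < P.deg v
  · simp only [hp, dif_pos]
    have hdiv : ∀ m, t < m * b ↔ t / b < m := fun m => (Nat.div_lt_iff_lt_mul hb).symm
    by_cases ht : t / b = k
    · have h1 : t % b < b := Nat.mod_lt _ hb
      have h2 : t < (k + 1) * b := by rw [hdiv]; omega
      have h3 : k * b + t % b = t := by rw [← ht, Nat.div_add_mod']
      simp [ht, hp, h1, h2, h3, List.getD_eq_getElem?_getD]
    · have h2 : t < (k + 1) * b ↔ t < k * b := by rw [hdiv, hdiv]; omega
      simp [ht, h2]
  · simp [hp, List.getD_eq_getElem?_getD]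

/-- Induction on the number of rounds left. The state `σ` is frozen until the last round, so all
blocks of a message are computed from the same state. -/
theorem machineRound_iterate_rounds {S : Type} (hb : 0 < b) (op : Op S)
    (rest : List (Op S × ℕ)) (σ : V → S) (r k : ℕ) (hk : k + r = op.extra) :
    (machineRound P)^[r + 1] (fun v =>
      { width := b, env := envOf P idn v, s := σ v
        buf := fun p t => if h : p < P.deg v then decide (t < k * b) &&
          op.send (envOf P idn (P.nbr v ⟨p, h⟩)) (σ (P.nbr v ⟨p, h⟩)) (P.backPort v ⟨p, h⟩) t
          else false
        rem := ((List.range' k (r + 1)).map fun k => (op, k)) ++ rest }) =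
    fun v =>
      { width := b, env := envOf P idn v, s := step P idn b op σ v
        buf := fun _ _ => false
        rem := rest } := by
  induction r generalizing k with
  | zero =>
    simp only [zero_add, Function.iterate_one]
    funext v
    have hk' : k = op.extra := by omega
    have := buffer_update P idn b hb op σ k v
    subst hk'
    simp only [machineRound, Machine.receive, Machine.send, List.range'_one, List.map_cons,
      List.map_nil, List.cons_append, List.nil_append, step, if_true]
    simp only [this]
  | succ r ih =>
    rw [Function.iterate_succ_apply]
    have hne : k ≠ op.extra := by omega
    rw [← ih (k + 1) (by omega)]
    congr 1
    funext v
    simp only [machineRound, Machine.receive, Machine.send, List.range'_succ, List.map_cons,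
      List.cons_append, hne, if_false, buffer_update P idn b hb op σ k v]

theorem machineRound_iterate_schedule {S : Type} (hb : 0 < b) (prog : List (Op S)) (σ : V → S) :
    (machineRound P)^[(schedule prog).length] (fun v =>
      { width := b, env := envOf P idn v, s := σ v, buf := fun _ _ => false
        rem := schedule prog }) =
    fun v =>
      { width := b, env := envOf P idn v, s := run P idn b prog σ v
        buf := fun _ _ => false
        rem := [] } := by
  induction prog generalizing σ with
  | nil => rfl
  | cons op prog ih =>
    have hlen : (schedule (op :: prog)).length = (schedule prog).length + (op.extra + 1) := by
      simp [schedule, Op.rounds, Nat.add_comm]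
    rw [hlen, Function.iterate_add_apply, run_cons, ← ih]
    congr 1
    have := machineRound_iterate_rounds P idn b hb op (schedule prog) σ op.extra 0 (by simp)
    rw [← this]
    congr 1
    funext v
    simp [schedule, Op.rounds]

theorem compile_stateAt {S : Type} (prog : ℕ → ℕ → List (Op S)) (init : Env → S)
    (out : S → NodeOutput) (N : ℕ) {b : ℕ} (ident : V → Fin b → Bool) (t : ℕ) :
    (compile prog init out).stateAt P N ident t =
      (machineRound P)^[t] fun v =>
        { width := b, env := envOf P (fun v => Nat.ofBits (ident v)) v
          s := init (envOf P (fun v => Nat.ofBits (ident v)) v)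
          buf := fun _ _ => false, rem := schedule (prog N b) } := by
  induction t with
  | zero => rfl
  | succ t ih =>
    rw [Function.iterate_succ_apply', ← ih]
    rfl

theorem compile_result {S : Type} (prog : ℕ → ℕ → List (Op S)) (init : Env → S)
    (out : S → NodeOutput) (N : ℕ) {b : ℕ} (hb : 0 < b) (ident : V → Fin b → Bool) :
    (compile prog init out).result P N ident = fun v =>
      out (run P (fun v => Nat.ofBits (ident v)) b (prog N b)
        (fun v => init (envOf P (fun v => Nat.ofBits (ident v)) v)) v) := by
  funext v
  unfold CongestAlgorithm.result
  rw [compile_stateAt]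
  exact congrArg (fun m : V → Machine S => out (m v).s)
    (machineRound_iterate_schedule P (fun v => Nat.ofBits (ident v)) b hb (prog N b)
      (fun v => init (envOf P (fun v => Nat.ofBits (ident v)) v)))

theorem machineRound_width {S : Type} (M : V → Machine S) (v : V) :
    (machineRound P M v).width = (M v).width := by
  unfold machineRound Machine.receive
  split
  · rfl
  · dsimp only
    split <;> rfl

/-- A machine never sends more than `width` bits, and no round changes `width`, which starts as `b`.
-/
theorem compile_messagesAtMost {S : Type} (prog : ℕ → ℕ → List (Op S)) (init : Env → S)
    (out : S → NodeOutput) (N : ℕ) {b : ℕ} (ident : V → Fin b → Bool) (B : ℝ) (hB : (b : ℝ) ≤ B) :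
    (compile prog init out).MessagesAtMost P N ident B := by
  intro t _ v i
  have hw : ∀ t v, ((compile prog init out).stateAt P N ident t v : Machine S).width = b := by
    intro t
    rw [compile_stateAt]
    induction t with
    | zero => intro v; rfl
    | succ t ih =>
      intro v
      rw [Function.iterate_succ_apply', machineRound_width, ih]
  refine le_trans ?_ hB
  have : ∀ m : Machine S, ∀ p, (m.send p).length ≤ m.width := by
    intro m p
    unfold Machine.send
    split <;> simp
  have h := this ((compile prog init out).stateAt P N ident t v) i
  rw [hw] at h
  exact_mod_cast h

/-- A step whose messages consist of `ℓ` numbers of `w` bits each. -/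
def numOp {S : Type} (b ℓ w : ℕ) (send : Env → S → ℕ → ℕ → ℕ)
    (recv : Env → S → (ℕ → ℕ → ℕ) → S) : Op S where
  extra := ℓ * w / b
  send e s p t := (send e s p (t / w)).testBit (t % w)
  recv e s bits := recv e s fun p j =>
    if j < ℓ then Nat.ofBits fun i : Fin w => bits p (j * w + i) else 0

/-- Since `ℓ * w < (ℓ * w / b + 1) * b`, the rounds of the step carry all the bits. The only loss is
the reduction modulo `2 ^ w`, which later bounds on the numbers make harmless. -/
theorem step_numOp {S : Type} (hb : 0 < b) (ℓ w : ℕ) (send : Env → S → ℕ → ℕ → ℕ)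
    (recv : Env → S → (ℕ → ℕ → ℕ) → S) (σ : V → S) (v : V) :
    step P idn b (numOp b ℓ w send recv) σ v = recv (envOf P idn v) (σ v) fun p j =>
      if h : p < P.deg v then
        if j < ℓ then send (envOf P idn (P.nbr v ⟨p, h⟩)) (σ (P.nbr v ⟨p, h⟩))
          (P.backPort v ⟨p, h⟩) j % 2 ^ w else 0
      else 0 := by
  unfold step numOp
  dsimp only
  congr 1
  funext p j
  by_cases hp : p < P.deg v
  · by_cases hj : j < ℓ
    · simp only [hp, hj, dif_pos, if_true]
      rw [← Nat.ofBits_testBit]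
      congr 1
      funext i
      have hw : 0 < w := i.pos
      have h1 : (j * w + i) / w = j := by
        rw [mul_comm, Nat.mul_add_div hw, Nat.div_eq_of_lt i.2, add_zero]
      have h2 : (j * w + i) % w = i := by
        rw [mul_comm, Nat.mul_add_mod, Nat.mod_eq_of_lt i.2]
      have h3 : j * w + i < (ℓ * w / b + 1) * b := by
        have h4 : j * w + i < ℓ * w := by
          calc j * w + i < j * w + w := by have := i.2; omega
            _ = (j + 1) * w := by ring
            _ ≤ ℓ * w := Nat.mul_le_mul_right _ hj
        have h5 := Nat.lt_succ_iff.2 (le_refl (ℓ * w / b))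
        have h6 := (Nat.div_lt_iff_lt_mul hb).1 h5
        exact h4.trans h6
      simp [h1, h2, h3]
    · simp [hj]
  · simp only [hp, dif_neg, not_false_iff]
    split
    · apply Nat.eq_of_testBit_eq
      intro i
      simp [Nat.testBit_ofBits]
    · rfl

end Semantics

end NetDecomp

namespace NetDecomp

/-! ### Clusters and their Steiner trees -/

/-- The part of the state of a node that describes its cluster and the trees that it lies in:
`cl` is its cluster, if it is alive, `ids` lists the clusters whose trees contain it, and `par c`
is the port towards the parent in the tree of `c`, with the position of `c` in the list of the
parent. -/
structure Net where
  cl : Option ℕ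
  ids : List ℕ
  par : ℕ → Option (ℕ × ℕ)

section Forest

variable {V : Type*} {G : SimpleGraph V} (P : PortNumbering G) (idn : V → ℕ)

/-- The port of `v` that leads to `u`, if there is one. -/
noncomputable def portTo (v u : V) : ℕ :=
  open Classical in if h : G.Adj v u then ((P.nbr v).symm ⟨u, h⟩ : ℕ) else 0

theorem portTo_nbr (v : V) (i : Fin (P.deg v)) : portTo P v (P.nbr v i) = i := by
  have h : G.Adj v (P.nbr v i) := (P.nbr v i).2
  have h2 : (⟨P.nbr v i, h⟩ : G.neighborSet v) = P.nbr v i := rfl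
  rw [portTo, dif_pos h, h2, Equiv.symm_apply_apply]

theorem portTo_lt {v u : V} (h : G.Adj v u) : portTo P v u < P.deg v := by
  simp [portTo, h]

theorem nbr_portTo {v u : V} (h : G.Adj v u) (h' : portTo P v u < P.deg v) :
    (P.nbr v ⟨portTo P v u, h'⟩ : V) = u := by
  have : (⟨portTo P v u, h'⟩ : Fin (P.deg v)) = (P.nbr v).symm ⟨u, h⟩ := by
    ext; simp [portTo, h]
  rw [this]; simp

theorem backPort_eq_portTo (v : V) (i : Fin (P.deg v)) :
    (P.backPort v i : ℕ) = portTo P (P.nbr v i) v := by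
  have h : G.Adj (P.nbr v i) v := G.adj_symm (P.nbr v i).2
  simp [portTo, h, PortNumbering.backPort]

/-- The parent of `v` in the tree of `c`. -/
def parOf (ν : V → Net) (c : ℕ) (v : V) : Option V :=
  if c ∈ (ν v).ids then
    match (ν v).par c with
    | none => none
    | some (p, _) => if h : p < P.deg v then some (P.nbr v ⟨p, h⟩) else none
  else none

/-- The trees are well-formed: they have depth at most `R`, and no node is in more than `L`. -/
structure Forest (R L : ℕ) (ν : V → Net) : Prop where
  length_le : ∀ v, (ν v).ids.length ≤ L
  nodup : ∀ v, (ν v).ids.Nodup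
  root : ∀ v, ∀ c ∈ (ν v).ids, (ν v).par c = none → c = idn v
  edge : ∀ v, ∀ c ∈ (ν v).ids, ∀ p j, (ν v).par c = some (p, j) →
    ∃ h : p < P.deg v, (ν (P.nbr v ⟨p, h⟩)).ids[j]? = some c
  depth : ∃ dep : V → ℕ → ℕ, ∀ v, ∀ c ∈ (ν v).ids, dep v c ≤ R ∧
    ∀ u, parOf P ν c v = some u → dep u c < dep v c
  member : ∀ v c, (ν v).cl = some c → c ∈ (ν v).ids

variable {P idn} {R L : ℕ} {ν : V → Net}

theorem parOf_mem {c : ℕ} {v u : V} (h : parOf P ν c v = some u) : c ∈ (ν v).ids := by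
  by_contra hc
  simp [parOf, hc] at h

theorem parOf_adj {c : ℕ} {v u : V} (h : parOf P ν c v = some u) : G.Adj v u := by
  have hc := parOf_mem h
  simp only [parOf, hc, if_true] at h
  split at h
  · simp at h
  · split at h
    · simp only [Option.some.injEq] at h
      rw [← h]
      exact (P.nbr v _).2
    · simp at h

theorem Forest.parOf_mem_parent (hF : Forest P idn R L ν) {c : ℕ} {v u : V}
    (h : parOf P ν c v = some u) : c ∈ (ν u).ids := by
  have hc := parOf_mem h
  simp only [parOf, hc, if_true] at h
  split at h
  · simp at h
  · rename_i p j hpj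
    obtain ⟨hp, hj⟩ := hF.edge v c hc _ _ hpj
    simp only [hp, dif_pos, Option.some.injEq] at h
    rw [← h]
    exact List.mem_of_getElem? hj

/-- The lists have no repetitions, so the stored position can only be the index of `c` in the list
of the parent. Thus child and parent agree on how to address the tree without naming it. -/
theorem Forest.par_of_parOf (hF : Forest P idn R L ν) {c : ℕ} {v u : V}
    (h : parOf P ν c v = some u) :
    (ν v).par c = some (portTo P v u, (ν u).ids.idxOf c) := by
  have hc := parOf_mem h
  have hu := hF.parOf_mem_parent h
  simp only [parOf, hc, if_true] at h
  split at h
  · simp at h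
  · rename_i p j hpj
    obtain ⟨hp, hj⟩ := hF.edge v c hc _ _ hpj
    simp only [hp, dif_pos, Option.some.injEq] at h
    subst h
    rw [hpj, portTo_nbr]
    have hjl : j < (ν (P.nbr v ⟨p, hp⟩)).ids.length := by
      rw [List.getElem?_eq_some_iff] at hj; exact hj.1
    have : (ν (P.nbr v ⟨p, hp⟩)).ids.idxOf c = j := by
      rw [List.getElem?_eq_some_iff] at hj
      obtain ⟨h1, h2⟩ := hj
      rw [← h2]
      exact (hF.nodup _).idxOf_getElem _ _
    rw [this]

theorem Forest.par_eq_none (hF : Forest P idn R L ν) {c : ℕ} {v : V} (hc : c ∈ (ν v).ids)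
    (h : parOf P ν c v = none) : (ν v).par c = none := by
  simp only [parOf, hc, if_true] at h
  split at h
  · assumption
  · rename_i p j hpj
    obtain ⟨hp, hj⟩ := hF.edge v c hc _ _ hpj
    simp [hp] at h

theorem Forest.parOf_of_par (hF : Forest P idn R L ν) {c : ℕ} {v u : V} (hc : c ∈ (ν v).ids)
    (huv : G.Adj v u) {j : ℕ} (h : (ν v).par c = some (portTo P v u, j)) :
    parOf P ν c v = some u := by
  obtain ⟨hp, hj⟩ := hF.edge v c hc _ _ h
  simp only [parOf, hc, if_true, h, hp, dif_pos]
  rw [nbr_portTo P huv]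

/-- The vertices whose parent is `none` in a tree are its unique root. -/
theorem Forest.root_unique (hF : Forest P idn R L ν) (hid : Function.Injective idn) {c : ℕ}
    {u v : V} (hu : c ∈ (ν u).ids) (hv : c ∈ (ν v).ids) (hu' : parOf P ν c u = none)
    (hv' : parOf P ν c v = none) : u = v :=
  hid ((hF.root u c hu (hF.par_eq_none hu hu')).symm.trans
    (hF.root v c hv (hF.par_eq_none hv hv')))

theorem Forest.exists_root (hF : Forest P idn R L ν) {c : ℕ} {v : V} (hv : c ∈ (ν v).ids) :
    ∃ r, c ∈ (ν r).ids ∧ parOf P ν c r = none := by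
  obtain ⟨dep, hdep⟩ := hF.depth
  induction hn : dep v c using Nat.strong_induction_on generalizing v with
  | _ n ih =>
    cases h : parOf P ν c v with
    | none => exact ⟨v, hv, h⟩
    | some u =>
      exact ih _ (hn ▸ (hdep v c hv).2 u h) (hF.parOf_mem_parent h) rfl

variable [Fintype V]

theorem sum_ports (F : V → ℕ) (v : V) (hFv : ∀ u, ¬ G.Adj v u → F u = 0) :
    ∑ p ∈ Finset.range (P.deg v), (if h : p < P.deg v then F (P.nbr v ⟨p, h⟩) else 0) =
      ∑ u, F u := by
  rw [Finset.sum_range]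
  simp only [Fin.is_lt, dif_pos, Fin.eta]
  refine Fintype.sum_of_injective (fun i => (P.nbr v i : V)) ?_ _ _ ?_ (fun _ => rfl)
  · intro i j hij
    exact (P.nbr v).injective (Subtype.ext hij)
  · intro u hu
    apply hFv
    intro hadj
    exact hu ⟨(P.nbr v).symm ⟨u, hadj⟩, by simp⟩

/-! #### Sums and prefix sums over a tree -/

variable (P ν)

open Classical in
/-- The sums of `x` over the subtrees of height less than `t`. -/
noncomputable def subSum (c : ℕ) (x : V → ℕ) : ℕ → V → ℕ
  | 0, _ => 0
  | t + 1, v => x v + ∑ u, if parOf P ν c u = some v then subSum c x t u else 0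

open Classical in
/-- The contribution of the subtree behind port `q`. -/
noncomputable def portSum (c : ℕ) (A : V → ℕ) (v : V) (q : ℕ) : ℕ :=
  if h : q < P.deg v then
    if parOf P ν c (P.nbr v ⟨q, h⟩) = some v then A (P.nbr v ⟨q, h⟩) else 0
  else 0

/-- The offsets that have arrived after `t` downward steps. -/
noncomputable def offset (c : ℕ) (x A : V → ℕ) : ℕ → V → ℕ
  | 0, _ => 0
  | t + 1, u => match parOf P ν c u with
    | none => 0
    | some v => offset c x A t v + x v + ∑ q ∈ Finset.range (portTo P v u), portSum P ν c A v q

variable {P ν}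

theorem sum_portSum (c : ℕ) (A : V → ℕ) (v : V) :
    ∑ q ∈ Finset.range (P.deg v), portSum P ν c A v q =
      open Classical in ∑ u, if parOf P ν c u = some v then A u else 0 := by
  classical
  rw [← sum_ports (P := P) (fun u => if parOf P ν c u = some v then A u else 0) v]
  · rfl
  · intro u hu
    rw [if_neg]
    intro h
    exact hu (parOf_adj h).symm

theorem subSum_mono (c : ℕ) (x : V → ℕ) (t : ℕ) (v : V) :
    subSum P ν c x t v ≤ subSum P ν c x (t + 1) v := by
  induction t generalizing v with
  | zero => simp [subSum]
  | succ t ih =>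
    rw [subSum, subSum]
    refine Nat.add_le_add_left (Finset.sum_le_sum fun u _ => ?_) _
    split_ifs
    · exact ih u
    · exact le_rfl

/-- The subtree below a node of depth `dep` has height at most `R - dep`, so the sum is final once
`R < t + dep`. A node outside the tree has no children, and its value is constant from `t = 1` on.
-/
theorem Forest.subSum_stable (hF : Forest P idn R L ν) (c : ℕ) (x : V → ℕ) :
    ∀ t, R < t → ∀ v, subSum P ν c x (t + 1) v = subSum P ν c x t v := by
  obtain ⟨dep, hdep⟩ := hF.depth
  have key : ∀ t v, c ∈ (ν v).ids → R < t + dep v c →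
      subSum P ν c x (t + 1) v = subSum P ν c x t v := by
    intro t
    induction t with
    | zero =>
      intro v hv h
      have := (hdep v c hv).1
      omega
    | succ t ih =>
      intro v hv h
      rw [subSum, subSum]
      congr 1
      refine Finset.sum_congr rfl fun u _ => ?_
      split_ifs with hu
      · have := (hdep u c (parOf_mem hu)).2 v hu
        exact ih u (parOf_mem hu) (by omega)
      · rfl
  intro t ht v
  by_cases hv : c ∈ (ν v).ids
  · exact key t v hv (by omega)
  · have hno : ∀ u, parOf P ν c u ≠ some v := fun u hu => hv (hF.parOf_mem_parent hu)
    obtain ⟨t, rfl⟩ : ∃ s, t = s + 1 := ⟨t - 1, by omega⟩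
    simp [subSum, hno]

theorem Forest.subSum_eq (hF : Forest P idn R L ν) (c : ℕ) (x : V → ℕ) (t : ℕ) (ht : R < t) :
    subSum P ν c x t = subSum P ν c x (R + 1) := by
  induction t, ht using Nat.le_induction with
  | base => rfl
  | succ t ht ih => rw [← ih]; funext v; exact hF.subSum_stable c x t ht v

theorem Forest.subSum_le (hF : Forest P idn R L ν) (c : ℕ) (x : V → ℕ) (t : ℕ) (v : V) :
    subSum P ν c x t v ≤ subSum P ν c x (R + 1) v := by
  rcases le_or_gt t R with h | h
  · exact monotone_nat_of_le_succ (fun t => subSum_mono c x t v) (by omega)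
  · rw [hF.subSum_eq c x t h]

theorem Forest.subSum_fix (hF : Forest P idn R L ν) (c : ℕ) (x : V → ℕ) (v : V) :
    subSum P ν c x (R + 1) v = x v +
      ∑ q ∈ Finset.range (P.deg v), portSum P ν c (subSum P ν c x (R + 1)) v q := by
  rw [sum_portSum, ← hF.subSum_stable c x (R + 1) (by omega) v]
  rfl

/-- Double counting: add up the fixed point equations of all nodes. Every subtree sum except that of
the root occurs once more on the right, at the parent, and cancels. Unique identifiers enter through
the uniqueness of the root. -/
theorem Forest.subSum_root (hF : Forest P idn R L ν) (hid : Function.Injective idn) {c : ℕ}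
    {x : V → ℕ} (hx : ∀ v, c ∉ (ν v).ids → x v = 0) {r : V} (hr : c ∈ (ν r).ids)
    (hr' : parOf P ν c r = none) : subSum P ν c x (R + 1) r = ∑ v, x v := by
  classical
  set A := subSum P ν c x (R + 1) with hA
  have hfix : ∀ v, A v = x v + ∑ u, if parOf P ν c u = some v then A u else 0 := by
    intro v
    have := hF.subSum_fix c x v
    rw [sum_portSum] at this
    exact this
  have h1 : ∑ v, A v = ∑ v, x v + ∑ v, ∑ u, if parOf P ν c u = some v then A u else 0 := by
    rw [← Finset.sum_add_distrib]
    exact Finset.sum_congr rfl fun v _ => hfix v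
  rw [Finset.sum_comm] at h1
  have h2 : ∀ u, A u = (∑ v, if parOf P ν c u = some v then A u else 0) +
      if u = r then A r else 0 := by
    intro u
    cases hu : parOf P ν c u with
    | none =>
      by_cases huc : c ∈ (ν u).ids
      · have := hF.root_unique hid huc hr hu hr'
        simp [this]
      · have hne : u ≠ r := fun h => huc (h ▸ hr)
        have hno : ∀ v, parOf P ν c v ≠ some u := fun v hv => huc (hF.parOf_mem_parent hv)
        have : A u = 0 := by rw [hfix u, hx u huc]; simp [hno]
        simp [hne, this]
    | some v =>
      have hne : u ≠ r := by
        rintro rfl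
        simp [hr'] at hu
      simp [hne]
  have h3 : ∑ u, A u = (∑ u, ∑ v, if parOf P ν c u = some v then A u else 0) + A r := by
    rw [Finset.sum_congr rfl fun u _ => h2 u, Finset.sum_add_distrib]
    simp
  omega

theorem Forest.subSum_child_le (hF : Forest P idn R L ν) {c : ℕ} {x : V → ℕ} {u v : V}
    (h : parOf P ν c u = some v) :
    subSum P ν c x (R + 1) u ≤ subSum P ν c x (R + 1) v := by
  classical
  rw [hF.subSum_fix c x v, sum_portSum]
  refine le_trans ?_ (Nat.le_add_left _ _)
  refine le_trans ?_ (Finset.single_le_sum (fun _ _ => Nat.zero_le _) (Finset.mem_univ u))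
  simp [h]

/-- Subtree sums do not decrease on the way to the root. This guarantees that all intermediate
values fit into the words in which they are sent. -/
theorem Forest.subSum_le_sum (hF : Forest P idn R L ν) (hid : Function.Injective idn) {c : ℕ}
    {x : V → ℕ} (hx : ∀ v, c ∉ (ν v).ids → x v = 0) {v : V} (hv : c ∈ (ν v).ids) (t : ℕ) :
    subSum P ν c x t v ≤ ∑ v, x v := by
  refine (hF.subSum_le c x t v).trans ?_
  obtain ⟨dep, hdep⟩ := hF.depth
  induction hn : dep v c using Nat.strong_induction_on generalizing v with
  | _ n ih =>
    cases h : parOf P ν c v with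
    | none => exact (hF.subSum_root hid hx hv h).le
    | some u =>
      exact (hF.subSum_child_le h).trans
        (ih _ (hn ▸ (hdep v c hv).2 u h) (hF.parOf_mem_parent h) rfl)

theorem offset_stable {dep : V → ℕ → ℕ} (hdep : ∀ v, ∀ c ∈ (ν v).ids, dep v c ≤ R ∧
    ∀ u, parOf P ν c v = some u → dep u c < dep v c) (hF : Forest P idn R L ν) (c : ℕ)
    (x A : V → ℕ) (t : ℕ) (v : V) (hv : c ∈ (ν v).ids) (h : dep v c < t) :
    offset P ν c x A (t + 1) v = offset P ν c x A t v := by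
  induction t generalizing v with
  | zero => omega
  | succ t ih =>
    rw [offset, offset]
    cases hu : parOf P ν c v with
    | none => rfl
    | some u =>
      have := (hdep v c hv).2 u hu
      simp only
      rw [ih u (hF.parOf_mem_parent hu) (by omega)]

theorem Forest.offset_child (hF : Forest P idn R L ν) {c : ℕ} (x A : V → ℕ) {u v : V}
    (h : parOf P ν c u = some v) :
    offset P ν c x A (R + 1) u = offset P ν c x A (R + 1) v + x v +
      ∑ q ∈ Finset.range (portTo P v u), portSum P ν c A v q := by
  obtain ⟨dep, hdep⟩ := hF.depth
  have h1 := offset_stable hdep hF c x A (R + 1) u (parOf_mem h)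
    (by have := (hdep u c (parOf_mem h)).1; omega)
  rw [← h1, offset, h]

theorem offset_root {c : ℕ} (x A : V → ℕ) {v : V} (h : parOf P ν c v = none) :
    offset P ν c x A (R + 1) v = 0 := by
  rw [offset, h]

/-- The interval that starts at the offset and has the subtree sum as its length is nested in that
of the parent, so all of them lie in that of the root. In particular offsets are not truncated when
sent. -/
theorem Forest.offset_add_le (hF : Forest P idn R L ν) (hid : Function.Injective idn) {c : ℕ}
    {x : V → ℕ} (hx : ∀ v, c ∉ (ν v).ids → x v = 0) {v : V} (hv : c ∈ (ν v).ids) :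
    offset P ν c x (subSum P ν c x (R + 1)) (R + 1) v + subSum P ν c x (R + 1) v ≤
      ∑ v, x v := by
  obtain ⟨dep, hdep⟩ := hF.depth
  set A := subSum P ν c x (R + 1) with hA
  induction hn : dep v c using Nat.strong_induction_on generalizing v with
  | _ n ih =>
    cases h : parOf P ν c v with
    | none => rw [offset_root x A h, hA, hF.subSum_root hid hx hv h]; simp
    | some u =>
      have h1 := ih _ (hn ▸ (hdep v c hv).2 u h) (hF.parOf_mem_parent h) rfl
      rw [hF.offset_child x A h]
      refine le_trans ?_ h1
      have h2 := hF.subSum_fix c x u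
      rw [← hA] at h2
      have hadj := (parOf_adj h).symm
      have h3 : portSum P ν c A u (portTo P u v) = A v := by
        have h4 := portTo_lt P hadj
        simp only [portSum, h4, dif_pos]
        rw [nbr_portTo P hadj h4, if_pos h]
      have h4 : ∑ q ∈ Finset.range (portTo P u v + 1), portSum P ν c A u q ≤
          ∑ q ∈ Finset.range (P.deg u), portSum P ν c A u q :=
        Finset.sum_le_sum_of_subset (by
          intro q hq
          have := portTo_lt P hadj
          simp at hq ⊢
          omega)
      rw [Finset.sum_range_succ, h3] at h4
      omega

theorem exists_prefix_interval (B : ℕ → ℕ) (d k : ℕ) (h : k < ∑ q ∈ Finset.range d, B q) :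
    ∃ q < d, ∑ i ∈ Finset.range q, B i ≤ k ∧ k < ∑ i ∈ Finset.range q, B i + B q := by
  induction d with
  | zero => simp at h
  | succ d ih =>
    by_cases hk : k < ∑ q ∈ Finset.range d, B q
    · obtain ⟨q, hq, h1⟩ := ih hk
      exact ⟨q, by omega, h1⟩
    · rw [Finset.sum_range_succ] at h
      exact ⟨d, by omega, by omega, h⟩

/-- The interval of a subtree is tiled by that of its top node followed by those of the children in
the order of ports. Either the top node covers `k`, or one descends to the child whose interval
contains it; depth is bounded by `R`, so the descent ends. -/
theorem Forest.exists_cover (hF : Forest P idn R L ν) {c : ℕ} {x : V → ℕ} {v : V}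
    (hv : c ∈ (ν v).ids) {k : ℕ}
    (h1 : offset P ν c x (subSum P ν c x (R + 1)) (R + 1) v ≤ k)
    (h2 : k < offset P ν c x (subSum P ν c x (R + 1)) (R + 1) v + subSum P ν c x (R + 1) v) :
    ∃ y, c ∈ (ν y).ids ∧ offset P ν c x (subSum P ν c x (R + 1)) (R + 1) y ≤ k ∧
      k < offset P ν c x (subSum P ν c x (R + 1)) (R + 1) y + x y := by
  obtain ⟨dep, hdep⟩ := hF.depth
  set A := subSum P ν c x (R + 1) with hA
  induction hn : R - dep v c using Nat.strong_induction_on generalizing v with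
  | _ n ih =>
    by_cases hk : k < offset P ν c x A (R + 1) v + x v
    · exact ⟨v, hv, h1, hk⟩
    · have hfix := hF.subSum_fix c x v
      rw [← hA] at hfix
      obtain ⟨q, hq, h3, h4⟩ := exists_prefix_interval (portSum P ν c A v) (P.deg v)
        (k - (offset P ν c x A (R + 1) v + x v)) (by omega)
      have hpar : parOf P ν c (P.nbr v ⟨q, hq⟩) = some v := by
        by_contra hne
        have : portSum P ν c A v q = 0 := by simp [portSum, hq, hne]
        omega
      have hB : portSum P ν c A v q = A (P.nbr v ⟨q, hq⟩) := by simp [portSum, hq, hpar]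
      have ho := hF.offset_child x A hpar
      rw [portTo_nbr] at ho
      simp only at ho
      have hd := hdep _ c (parOf_mem hpar)
      have hd2 := hd.2 v hpar
      exact ih _ (by omega) (parOf_mem hpar) (by omega) (by omega) rfl

/-- The intervals `[off v, off v + x v)` partition `[0, ∑ x)`. -/
theorem Forest.existsUnique_offset (hF : Forest P idn R L ν) (hid : Function.Injective idn)
    {c : ℕ} {x : V → ℕ} (hx : ∀ v, c ∉ (ν v).ids → x v = 0) {k : ℕ} (hk : k < ∑ v, x v) :
    ∃! y, offset P ν c x (subSum P ν c x (R + 1)) (R + 1) y ≤ k ∧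
      k < offset P ν c x (subSum P ν c x (R + 1)) (R + 1) y + x y := by
  classical
  set O := offset P ν c x (subSum P ν c x (R + 1)) (R + 1) with hO
  obtain ⟨v, hv⟩ : ∃ v, c ∈ (ν v).ids := by
    by_contra! h
    rw [Finset.sum_eq_zero fun v _ => hx v (h v)] at hk
    omega
  obtain ⟨r, hr, hr'⟩ := hF.exists_root hv
  have hcov : ∀ k < ∑ v, x v, ∃ y, O y ≤ k ∧ k < O y + x y := by
    intro k hk
    obtain ⟨y, -, hy⟩ := hF.exists_cover (x := x) (k := k) hr
      (by rw [offset_root _ _ hr']; omega)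
      (by rw [hF.subSum_root hid hx hr hr']; omega)
    exact ⟨y, hy⟩
  set M := ∑ v, x v with hM
  let cnt : ℕ → ℕ := fun k => (Finset.univ.filter fun y => O y ≤ k ∧ k < O y + x y).card
  have hpos : ∀ k ∈ Finset.range M, 1 ≤ cnt k := by
    intro k hk
    obtain ⟨y, hy⟩ := hcov k (Finset.mem_range.1 hk)
    exact Finset.card_pos.2 ⟨y, by simpa using hy⟩
  -- The intervals have total length `M` and cover each of the `M` points at least once, so no point
  -- can be covered twice.
  have hle : ∑ k ∈ Finset.range M, cnt k ≤ M := by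
    have h1 : ∀ k, cnt k = ∑ y, if O y ≤ k ∧ k < O y + x y then 1 else 0 := by
      intro k; simp [cnt]
    rw [Finset.sum_congr rfl fun k _ => h1 k, Finset.sum_comm, hM]
    refine Finset.sum_le_sum fun y _ => ?_
    rw [← Finset.sum_filter, Finset.sum_const, smul_eq_mul, mul_one]
    calc _ ≤ (Finset.Ico (O y) (O y + x y)).card := Finset.card_le_card (by
            intro k hk; simp at hk ⊢; exact hk.2)
      _ = x y := by simp
  have heq : cnt k = 1 := by
    by_contra hne
    have h2 : 1 < cnt k := lt_of_le_of_ne (hpos k (Finset.mem_range.2 hk)) (Ne.symm hne)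
    have h3 : ∑ k ∈ Finset.range M, 1 < ∑ k ∈ Finset.range M, cnt k :=
      Finset.sum_lt_sum hpos ⟨k, Finset.mem_range.2 hk, h2⟩
    simp at h3
    omega
  obtain ⟨y, hy⟩ := Finset.card_eq_one.1 heq
  refine ⟨y, ?_, ?_⟩
  · have : y ∈ ({y} : Finset V) := by simp
    rw [← hy] at this
    simpa using this
  · intro z hz
    have : z ∈ ({y} : Finset V) := by
      rw [← hy]; simpa using hz
    simpa using this

end Forest
end NetDecomp

namespace NetDecomp

/-! ### The prefix sum primitive -/

/-- What a node is going to output. -/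
structure Out where
  fin : Bool
  color : ℕ
  label : ℕ
  links : Finset (ℕ × Option ℕ)

/-- Scratch registers. `nbr p` holds what arrived last through port `p`, `tok p` says whether the
node was marked by the neighbor behind port `p`. -/
structure Work where
  nbr : ℕ → ℕ → ℕ
  tok : ℕ → Bool
  contact : Option ℕ
  indeg : ℕ
  rank : ℕ
  sib : ℕ
  phi : ℕ
  blue : Bool
  prop : Option ℕ
  size : ℕ
  accept : Bool

/-- The state of a node between two calls of a primitive. -/
structure Loc where
  net : Net
  out : Out
  work : Work

/-- The registers of the prefix sum primitive: `acc c` and `ch p c` are the sums over the subtree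
of the node and over the part behind port `p`, in the tree of `c`; `tot` and `off` are
the total and the offset. -/
structure Regs where
  acc : ℕ → ℕ
  ch : ℕ → ℕ → ℕ
  tot : ℕ → ℕ
  off : ℕ → ℕ

/-- Cleared registers. -/
def Regs.clear : Regs := ⟨fun _ => 0, fun _ _ => 0, fun _ => 0, fun _ => 0⟩

/-- Exchange `ℓ` numbers of `w` bits with every neighbor. -/
def exch (b ℓ w : ℕ) (send : Env → Loc → ℕ → ℕ → ℕ) (recv : Env → Loc → (ℕ → ℕ → ℕ) → Loc) :
    Op (Loc × Regs) :=
  numOp b ℓ w (fun e s => send e s.1) fun e s m => (recv e s.1 m, Regs.clear)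

/-- The value of a node in the tree of `c`. -/
def own (f : Env → Loc → ℕ) (e : Env) (l : Loc) (c : ℕ) : ℕ :=
  if l.net.cl = some c then f e l else 0

/-- A step towards the roots. -/
def upOp (b L w : ℕ) (f : Env → Loc → ℕ) : Op (Loc × Regs) :=
  numOp b L w
    (fun _ s p j => ((s.1.net.ids.filter fun c => s.1.net.par c = some (p, j)).map s.2.acc).sum)
    fun e s m => (s.1, { s.2 with
      ch := fun p c => m p (s.1.net.ids.idxOf c)
      acc := fun c => own f e s.1 c + ∑ p ∈ Finset.range e.deg, m p (s.1.net.ids.idxOf c) })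

/-- A step away from the roots. -/
def downOp (b L w : ℕ) (f : Env → Loc → ℕ) : Op (Loc × Regs) :=
  numOp b (2 * L) w
    (fun e s p k =>
      let c := s.1.net.ids.getD (k / 2) 0
      if k % 2 = 0 then s.2.tot c
      else s.2.off c + own f e s.1 c + ∑ q ∈ Finset.range p, s.2.ch q c)
    fun _ s m => (s.1, { s.2 with
      tot := fun c => match s.1.net.par c with
        | none => s.2.acc c
        | some (p, j) => m p (2 * j)
      off := fun c => match s.1.net.par c with
        | none => 0
        | some (p, j) => m p (2 * j + 1) })

/-- Use the results. -/
def useOp (b : ℕ) (g : Env → Loc → ℕ → ℕ → Loc) : Op (Loc × Regs) :=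
  numOp b 0 0 (fun _ _ _ _ => 0) fun e s _ =>
    (match s.1.net.cl with
      | none => s.1
      | some c => g e s.1 (s.2.tot c) (s.2.off c), Regs.clear)

/-- Every node of a cluster learns the sum of the values `f` of all the nodes of the cluster, and
the sum of those that precede it in some order. -/
def scan (b L w R : ℕ) (f : Env → Loc → ℕ) (g : Env → Loc → ℕ → ℕ → Loc) :
    List (Op (Loc × Regs)) :=
  List.replicate (R + 2) (upOp b L w f) ++ List.replicate (R + 1) (downOp b L w f) ++
    [useOp b g]

section Scan

variable {V : Type*} {G : SimpleGraph V} (P : PortNumbering G) (idn : V → ℕ) (b : ℕ)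

/-- States with cleared registers. -/
def clearRegs (β : V → Loc) (v : V) : Loc × Regs := (β v, Regs.clear)

/-- What a node receives in an exchange. -/
def fetch (ℓ w : ℕ) (send : Env → Loc → ℕ → ℕ → ℕ) (β : V → Loc) (v : V) (p j : ℕ) : ℕ :=
  if h : p < P.deg v then
    if j < ℓ then send (envOf P idn (P.nbr v ⟨p, h⟩)) (β (P.nbr v ⟨p, h⟩))
      (P.backPort v ⟨p, h⟩) j % 2 ^ w else 0
  else 0

theorem step_exch (hb : 0 < b) (ℓ w : ℕ) (send : Env → Loc → ℕ → ℕ → ℕ)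
    (recv : Env → Loc → (ℕ → ℕ → ℕ) → Loc) (β : V → Loc) :
    step P idn b (exch b ℓ w send recv) (clearRegs β) =
      clearRegs fun v => recv (envOf P idn v) (β v) (fetch P idn ℓ w send β v) := by
  funext v
  rw [exch, step_numOp P idn b hb]
  rfl

variable [Fintype V] {P idn} {R L : ℕ}

/-- The total of a cluster. -/
noncomputable def clusterSum (P : PortNumbering G) (idn : V → ℕ) (f : Env → Loc → ℕ)
    (β : V → Loc) (c : ℕ) : ℕ :=
  ∑ v, own f (envOf P idn v) (β v) c

/-- What a node sends for position `j` collects the trees in which its parent pointer names that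
port and that position. A position in the list of the parent determines the tree, so at most one
tree contributes. -/
theorem Forest.sum_filter_par {β : V → Loc} (hF : Forest P idn R L fun v => (β v).net)
    (F : ℕ → ℕ) {c : ℕ} {v : V} (hc : c ∈ (β v).net.ids) (p : Fin (P.deg v)) :
    (((β (P.nbr v p)).net.ids.filter fun c' => (β (P.nbr v p)).net.par c' =
        some ((P.backPort v p : ℕ), (β v).net.ids.idxOf c)).map F).sum =
      open Classical in
      if parOf P (fun v => (β v).net) c (P.nbr v p) = some v then F c else 0 := by
  have hadj : G.Adj (P.nbr v p) v := (P.nbr v p).2.symm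
  rw [backPort_eq_portTo P v p]
  generalize (P.nbr v p : V) = u at hadj ⊢
  have key : ∀ c' ∈ (β u).net.ids, (β u).net.par c' = some (portTo P u v, (β v).net.ids.idxOf c) →
      c' = c := by
    intro c' hc' h
    obtain ⟨h1, h2⟩ := hF.edge u c' hc' _ _ h
    rw [nbr_portTo P hadj] at h2
    rw [List.getElem?_idxOf hc] at h2
    simpa using h2.symm
  split_ifs with h
  · have hpar := hF.par_of_parOf h
    have hmem : c ∈ (β u).net.ids := parOf_mem (ν := fun v => (β v).net) h
    have : (β u).net.ids.filter (fun c' => (β u).net.par c' =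
        some (portTo P u v, (β v).net.ids.idxOf c)) = [c] := by
      have hnd : ((β u).net.ids.filter (fun c' => (β u).net.par c' =
        some (portTo P u v, (β v).net.ids.idxOf c))).Nodup := (hF.nodup u).filter _
      rw [← List.perm_singleton]
      rw [List.perm_ext_iff_of_nodup hnd (by simp)]
      intro a
      simp only [List.mem_filter, decide_eq_true_eq, List.mem_singleton]
      constructor
      · rintro ⟨h1, h2⟩
        exact key a h1 h2
      · rintro rfl
        exact ⟨hmem, hpar⟩
    rw [this]
    simp
  · have : (β u).net.ids.filter (fun c' => (β u).net.par c' =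
        some (portTo P u v, (β v).net.ids.idxOf c)) = [] := by
      rw [List.filter_eq_nil_iff]
      intro a ha
      simp only [decide_eq_true_eq]
      intro h2
      obtain rfl := key a ha h2
      exact h (hF.parOf_of_par ha hadj h2)
    rw [this]
    simp

/-- After `t` steps a node knows the sum over the levels below it up to height `t`; nothing is lost
modulo `2 ^ w`, because every partial sum is at most the total. The per-port values `ch` lag one
step behind `acc`. -/
theorem Forest.upOp_iterate (hb : 0 < b) (hid : Function.Injective idn) {β : V → Loc}
    (hF : Forest P idn R L fun v => (β v).net) {w : ℕ} {f : Env → Loc → ℕ}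
    (hw : ∀ c, clusterSum P idn f β c < 2 ^ w) (t : ℕ) :
    ∃ ρ : V → Regs, (step P idn b (upOp b L w f))^[t] (clearRegs β) = (fun v => (β v, ρ v)) ∧
      (∀ v, (ρ v).tot = (fun _ => 0) ∧ (ρ v).off = fun _ => 0) ∧
      (∀ v, ∀ c ∈ (β v).net.ids, (ρ v).acc c =
        subSum P (fun v => (β v).net) c (fun v => own f (envOf P idn v) (β v) c) t v) ∧
      ∀ s, t = s + 1 → ∀ v, ∀ c ∈ (β v).net.ids, ∀ q, (ρ v).ch q c =
        portSum P (fun v => (β v).net) c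
          (subSum P (fun v => (β v).net) c (fun v => own f (envOf P idn v) (β v) c) s) v q := by
  classical
  induction t with
  | zero =>
    refine ⟨fun _ => Regs.clear, rfl, fun v => ⟨rfl, rfl⟩, fun v c _ => ?_, by simp⟩
    simp [Regs.clear, subSum]
  | succ t ih =>
    obtain ⟨ρ, h1, h2, h3, -⟩ := ih
    rw [Function.iterate_succ_apply', h1]
    have hmsg : ∀ v, ∀ c ∈ (β v).net.ids, ∀ q,
        (if h : q < P.deg v then
          if (β v).net.ids.idxOf c < L then
            (((β (P.nbr v ⟨q, h⟩)).net.ids.filter fun c' => (β (P.nbr v ⟨q, h⟩)).net.par c' =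
              some ((P.backPort v ⟨q, h⟩ : ℕ), (β v).net.ids.idxOf c)).map
                (ρ (P.nbr v ⟨q, h⟩)).acc).sum % 2 ^ w
          else 0
        else 0) = portSum P (fun v => (β v).net) c
          (subSum P (fun v => (β v).net) c (fun v => own f (envOf P idn v) (β v) c) t) v q := by
      intro v c hc q
      have hL : (β v).net.ids.idxOf c < L :=
        lt_of_lt_of_le (List.idxOf_lt_length_of_mem hc) (hF.length_le v)
      by_cases hq : q < P.deg v
      · simp only [hq, hL, dif_pos, if_true, portSum]
        rw [hF.sum_filter_par _ hc]
        split_ifs with hpar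
        · have hmem := parOf_mem (ν := fun v => (β v).net) hpar
          rw [h3 _ c hmem, Nat.mod_eq_of_lt]
          refine lt_of_le_of_lt (hF.subSum_le_sum hid ?_ hmem t) (hw c)
          intro z hz
          simp only [own]
          rw [if_neg]
          exact fun hz' => hz (hF.member z c hz')
        · simp
      · simp [hq, portSum]
    refine ⟨fun v => (step P idn b (upOp b L w f) (fun v => (β v, ρ v)) v).2,
      funext fun v => ?_, ?_, ?_, ?_⟩ <;> simp only [upOp, step_numOp P idn b hb]
    · intro v
      exact h2 v
    · intro v c hc
      rw [subSum, ← sum_portSum]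
      congr 1
      exact Finset.sum_congr rfl fun q _ => hmsg v c hc q
    · intro s hs v c hc q
      obtain rfl : t = s := by omega
      exact hmsg v c hc q

theorem Forest.downOp_iterate (hb : 0 < b) (hid : Function.Injective idn) {β : V → Loc}
    (hF : Forest P idn R L fun v => (β v).net) {w : ℕ} {f : Env → Loc → ℕ}
    (hw : ∀ c, clusterSum P idn f β c < 2 ^ w) {dep : V → ℕ → ℕ}
    (hdep : ∀ v, ∀ c ∈ (β v).net.ids, dep v c ≤ R ∧
      ∀ u, parOf P (fun v => (β v).net) c v = some u → dep u c < dep v c) (t : ℕ) :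
    ∃ ρ : V → Regs, (step P idn b (downOp b L w f))^[t]
        ((step P idn b (upOp b L w f))^[R + 2] (clearRegs β)) = (fun v => (β v, ρ v)) ∧
      (∀ v, ∀ c ∈ (β v).net.ids, (ρ v).acc c =
        subSum P (fun v => (β v).net) c (fun v => own f (envOf P idn v) (β v) c) (R + 1) v) ∧
      (∀ v, ∀ c ∈ (β v).net.ids, ∀ q, (ρ v).ch q c =
        portSum P (fun v => (β v).net) c
          (subSum P (fun v => (β v).net) c
            (fun v => own f (envOf P idn v) (β v) c) (R + 1)) v q) ∧
      (∀ v, ∀ c ∈ (β v).net.ids, dep v c < t →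
        (ρ v).tot c = clusterSum P idn f β c ∧
        (ρ v).off c = offset P (fun v => (β v).net) c (fun v => own f (envOf P idn v) (β v) c)
          (subSum P (fun v => (β v).net) c
            (fun v => own f (envOf P idn v) (β v) c) (R + 1)) (R + 1) v) := by
  classical
  have hx : ∀ c v, c ∉ (β v).net.ids → own f (envOf P idn v) (β v) c = 0 := by
    intro c z hz
    simp only [own]
    rw [if_neg]
    exact fun hz' => hz (hF.member z c hz')
  induction t with
  | zero =>
    -- The sums are final after `R + 1` steps; one more is needed because `ch` stores the sums of
    -- the step before.
    obtain ⟨ρ, h1, h2, h3, h4⟩ := hF.upOp_iterate b hb hid hw (R + 2)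
    refine ⟨ρ, h1, ?_, h4 (R + 1) rfl, by simp⟩
    intro v c hc
    rw [h3 v c hc, hF.subSum_eq c _ (R + 2) (by omega)]
  | succ t ih =>
    obtain ⟨ρ, h1, h2, h3, h4⟩ := ih
    rw [Function.iterate_succ_apply', h1]
    refine ⟨fun v => (step P idn b (downOp b L w f) (fun v => (β v, ρ v)) v).2,
      funext fun v => ?_, ?_, ?_, ?_⟩ <;> simp only [downOp, step_numOp P idn b hb]
    · exact h2
    · exact h3
    · intro v c hc hd
      cases hpar : parOf P (fun v => (β v).net) c v with
      | none =>
        have hnone := hF.par_eq_none hc hpar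
        simp only [hnone]
        rw [offset_root _ _ hpar, h2 v c hc, hF.subSum_root hid (hx c) hc hpar]
        exact ⟨rfl, rfl⟩
      | some u =>
        have hsome := hF.par_of_parOf hpar
        have hadj := parOf_adj hpar
        have hu : c ∈ (β u).net.ids := hF.parOf_mem_parent hpar
        have hdu := (hdep v c hc).2 u hpar
        obtain ⟨h5, h6⟩ := h4 u c hu (by omega)
        have hlt := portTo_lt P hadj
        have hL : (β u).net.ids.idxOf c < L :=
          lt_of_lt_of_le (List.idxOf_lt_length_of_mem hu) (hF.length_le u)
        have hbp : (P.backPort v ⟨portTo P v u, hlt⟩ : ℕ) = portTo P u v := by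
          rw [backPort_eq_portTo, nbr_portTo P hadj]
        have hget : (β u).net.ids.getD ((β u).net.ids.idxOf c) 0 = c := by
          rw [List.getD_eq_getElem?_getD, List.getElem?_idxOf hu]; rfl
        have e1 : 2 * (β u).net.ids.idxOf c / 2 = (β u).net.ids.idxOf c := by omega
        have e2 : (2 * (β u).net.ids.idxOf c + 1) / 2 = (β u).net.ids.idxOf c := by omega
        have e3 : 2 * (β u).net.ids.idxOf c % 2 = 0 := by omega
        have e4 : (2 * (β u).net.ids.idxOf c + 1) % 2 ≠ 0 := by omega
        have e5 : 2 * (β u).net.ids.idxOf c < 2 * L := by omega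
        have e6 : 2 * (β u).net.ids.idxOf c + 1 < 2 * L := by omega
        simp only [hsome, hlt, dif_pos, nbr_portTo P hadj hlt, e1, e2, e3, e4, e5, e6, if_true,
          if_false, hget, hbp]
        rw [h5, h6, Nat.mod_eq_of_lt (hw c)]
        refine ⟨rfl, ?_⟩
        have hoff := hF.offset_child (fun v => own f (envOf P idn v) (β v) c)
          (subSum P (fun v => (β v).net) c (fun v => own f (envOf P idn v) (β v) c) (R + 1)) hpar
        have hle := hF.offset_add_le hid (hx c) hc
        rw [hoff] at hle ⊢
        rw [Finset.sum_congr rfl fun q _ => h3 u c hu q]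
        apply Nat.mod_eq_of_lt
        refine lt_of_le_of_lt ?_ (hw c)
        refine le_trans (Nat.le_add_right _ _) hle

/-- The effect of the prefix sum primitive. -/
theorem Forest.run_scan (hb : 0 < b) (hid : Function.Injective idn) {β : V → Loc}
    (hF : Forest P idn R L fun v => (β v).net) {w : ℕ} {f : Env → Loc → ℕ}
    (hw : ∀ c, clusterSum P idn f β c < 2 ^ w) (g : Env → Loc → ℕ → ℕ → Loc) :
    ∃ (β' : V → Loc) (off : V → ℕ),
      run P idn b (scan b L w R f g) (clearRegs β) = clearRegs β' ∧
      (∀ v, (β v).net.cl = none → β' v = β v) ∧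
      (∀ v c, (β v).net.cl = some c →
        β' v = g (envOf P idn v) (β v) (clusterSum P idn f β c) (off v)) ∧
      (∀ v c, (β v).net.cl = some c →
        off v + f (envOf P idn v) (β v) ≤ clusterSum P idn f β c) ∧
      ∀ c, ∀ k < clusterSum P idn f β c, ∃! v, (β v).net.cl = some c ∧ off v ≤ k ∧
        k < off v + f (envOf P idn v) (β v) := by
  obtain ⟨dep, hdep⟩ := hF.depth
  obtain ⟨ρ, h1, -, -, h4⟩ := hF.downOp_iterate b hb hid hw hdep (R + 1)
  have hx : ∀ c v, c ∉ (β v).net.ids → own f (envOf P idn v) (β v) c = 0 := by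
    intro c z hz
    simp only [own]
    rw [if_neg]
    exact fun hz' => hz (hF.member z c hz')
  let O : ℕ → V → ℕ := fun c => offset P (fun v => (β v).net) c
    (fun v => own f (envOf P idn v) (β v) c) (subSum P (fun v => (β v).net) c
      (fun v => own f (envOf P idn v) (β v) c) (R + 1)) (R + 1)
  let off : V → ℕ := fun v => match (β v).net.cl with | none => 0 | some c => O c v
  refine ⟨fun v => match (β v).net.cl with
    | none => β v
    | some c => g (envOf P idn v) (β v) (clusterSum P idn f β c) (off v), off, ?_, ?_, ?_, ?_, ?_⟩
  · rw [scan, run_append, run_append, run_replicate, run_replicate, h1, run_cons, run_nil]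
    funext v
    rw [useOp, step_numOp P idn b hb]
    simp only [clearRegs]
    cases hcl : (β v).net.cl with
    | none => rfl
    | some c =>
      have hc := hF.member v c hcl
      obtain ⟨h5, h6⟩ := h4 v c hc (by have := (hdep v c hc).1; omega)
      simp only [off, hcl]
      rw [h5, h6]
  · intro v hv
    simp [hv]
  · intro v c hv
    simp [hv]
  · intro v c hv
    simp only [off, hv]
    have h5 := hF.offset_add_le hid (hx c) (hF.member v c hv)
    have h6 := hF.subSum_fix c (fun v => own f (envOf P idn v) (β v) c) v
    have h7 : own f (envOf P idn v) (β v) c = f (envOf P idn v) (β v) := by simp [own, hv]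
    rw [h7] at h6
    refine le_trans ?_ h5
    refine Nat.add_le_add_left ?_ _
    rw [h6]
    exact Nat.le_add_right _ _
  · intro c k hk
    obtain ⟨y, ⟨hy1, hy2⟩, hy3⟩ := hF.existsUnique_offset hid (hx c) hk
    have hycl : (β y).net.cl = some c := by
      by_contra hne
      have h0 : own f (envOf P idn y) (β y) c = 0 := by simp [own, hne]
      rw [h0] at hy2
      omega
    refine ⟨y, ⟨hycl, ?_, ?_⟩, ?_⟩
    · simp only [off, hycl]; exact hy1
    · simp only [off, hycl]
      have h0 : own f (envOf P idn y) (β y) c = f (envOf P idn y) (β y) := by simp [own, hycl]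
      rw [h0] at hy2
      exact hy2
    · rintro z ⟨hz1, hz2, hz3⟩
      simp only [off, hz1] at hz2 hz3
      refine hy3 z ⟨hz2, ?_⟩
      simp only [own, hz1, if_true]
      exact hz3

end Scan

end NetDecomp

namespace NetDecomp

/-! ### Cole–Vishkin color reduction -/

open Classical in
/-- The lowest position where the binary expansions of `x` and `y` differ, together with the bit
of `x` there. -/
noncomputable def coleVishkin (x y : ℕ) : ℕ :=
  if h : ∃ i, x.testBit i ≠ y.testBit i then
    2 * Nat.find h + (x.testBit (Nat.find h)).toNat
  else 0

/-- Equal values mean the same position and the same bit of `x` and of `y` there, although that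
position was chosen because `x` and `y` differ in it. -/
theorem coleVishkin_ne {x y z : ℕ} (hxy : x ≠ y) (hyz : y ≠ z) :
    coleVishkin x y ≠ coleVishkin y z := by
  classical
  have h1 : ∃ i, x.testBit i ≠ y.testBit i := by
    by_contra! h
    exact hxy (Nat.eq_of_testBit_eq h)
  have h2 : ∃ i, y.testBit i ≠ z.testBit i := by
    by_contra! h
    exact hyz (Nat.eq_of_testBit_eq h)
  rw [coleVishkin, coleVishkin, dif_pos h1, dif_pos h2]
  intro h
  have hs1 := Nat.find_spec h1
  have b1 := Bool.toNat_lt (x.testBit (Nat.find h1))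
  have b2 := Bool.toNat_lt (y.testBit (Nat.find h2))
  have h3 : Nat.find h1 = Nat.find h2 := by omega
  have h4 : (x.testBit (Nat.find h1)).toNat = (y.testBit (Nat.find h2)).toNat := by omega
  rw [← h3] at h4
  apply hs1
  revert h4
  cases x.testBit (Nat.find h1) <;> cases y.testBit (Nat.find h1) <;> simp

theorem coleVishkin_lt {x y ℓ : ℕ} (hℓ : 0 < ℓ) (hx : x < 2 ^ ℓ) (hy : y < 2 ^ ℓ) :
    coleVishkin x y < 2 * ℓ := by
  classical
  rw [coleVishkin]
  split_ifs with h
  · have h1 : Nat.find h < ℓ := by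
      by_contra! hle
      apply Nat.find_spec h
      rw [Nat.testBit_lt_two_pow (lt_of_lt_of_le hx (Nat.pow_le_pow_right (by norm_num) hle)),
        Nat.testBit_lt_two_pow (lt_of_lt_of_le hy (Nat.pow_le_pow_right (by norm_num) hle))]
    have := Bool.toNat_lt (x.testBit (Nat.find h))
    omega
  · omega

/-- The number of bits of a color after a step, in terms of the number before. -/
def nextBits (ℓ : ℕ) : ℕ := Nat.clog 2 ℓ + 1

theorem coleVishkin_lt_nextBits {x y ℓ : ℕ} (hℓ : 0 < ℓ) (hx : x < 2 ^ ℓ) (hy : y < 2 ^ ℓ) :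
    coleVishkin x y < 2 ^ nextBits ℓ := by
  refine lt_of_lt_of_le (coleVishkin_lt hℓ hx hy) ?_
  rw [nextBits, pow_succ, mul_comm]
  exact Nat.mul_le_mul_right 2 (Nat.le_pow_clog (by norm_num) ℓ)

theorem nextBits_pos (ℓ : ℕ) : 0 < nextBits ℓ := Nat.succ_pos _

theorem nextBits_mono {a b : ℕ} (h : a ≤ b) : nextBits a ≤ nextBits b :=
  Nat.add_le_add_right (Nat.clog_mono_right 2 h) 1

theorem nextBits_le_three {a : ℕ} (h : a ≤ 4) : nextBits a ≤ 3 :=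
  (nextBits_mono h).trans (by decide +kernel)

theorem nextBits_le_self_add {a : ℕ} (h : a ≤ 5) : nextBits a ≤ 4 :=
  (nextBits_mono h).trans (by decide +kernel)

/-- The number of color reduction steps. -/
noncomputable def cvSteps (b : ℕ) : ℕ := logStar b + 2

/-- As `m + 2 ≤ 2 ^ (m + 1)`, each logarithm lowers the integer bound by one. This makes the set in
`logStar` nonempty, so its infimum is attained and is not the default value 0. -/
theorem logb_iterate_le (m : ℕ) (x : ℝ) (hx : x ≤ m + 1) : ∃ k ≤ m, (Real.logb 2)^[k] x ≤ 1 := by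
  induction m generalizing x with
  | zero => exact ⟨0, le_rfl, by simpa using hx⟩
  | succ m ih =>
    by_cases h1 : x ≤ 1
    · exact ⟨0, by omega, by simpa using h1⟩
    · push Not at h1
      have hlog : Real.logb 2 x ≤ m + 1 := by
        rw [Real.logb_le_iff_le_rpow (by norm_num) (by linarith)]
        have h2 : ((m + 2 : ℕ) : ℝ) ≤ (2 : ℝ) ^ (m + 1) := by
          have : m + 2 ≤ 2 ^ (m + 1) := Nat.lt_two_pow_self (n := m + 1)
          exact_mod_cast this
        have h3 : (2 : ℝ) ^ ((m : ℝ) + 1) = (2 : ℝ) ^ (m + 1) := by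
          rw [← Real.rpow_natCast]; push_cast; rfl
        rw [h3]
        push_cast at hx h2
        linarith
      obtain ⟨k, hk, hk'⟩ := ih _ hlog
      exact ⟨k + 1, by omega, by rwa [Function.iterate_succ_apply]⟩

theorem logb_iterate_logStar_le (b : ℕ) : (Real.logb 2)^[logStar b] (b : ℝ) ≤ 1 := by
  have hne : {k : ℕ | (Real.logb 2)^[k] (b : ℝ) ≤ 1}.Nonempty := by
    obtain ⟨k, -, hk⟩ := logb_iterate_le b b (by linarith)
    exact ⟨k, hk⟩
  exact Nat.sInf_mem hne

/-- A crude bound, but enough to absorb the factor `log^* b` into `b` when counting rounds. -/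
theorem logStar_le_size (b : ℕ) : logStar b ≤ Nat.size b + 1 := by
  have h1 : Real.logb 2 (b : ℝ) ≤ (Nat.size b : ℝ) + 1 := by
    rcases Nat.eq_zero_or_pos b with rfl | hb
    · simp
    · have h2 : (b : ℝ) < 2 ^ (Nat.size b) := by exact_mod_cast Nat.lt_size_self b
      have h3 : Real.logb 2 (b : ℝ) ≤ Real.logb 2 ((2 : ℝ) ^ (Nat.size b)) :=
        Real.logb_le_logb_of_le (by norm_num) (by exact_mod_cast hb) h2.le
      rw [Real.logb_pow, Real.logb_self_eq_one (by norm_num)] at h3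
      linarith
  obtain ⟨k, hk, hk'⟩ := logb_iterate_le _ _ h1
  refine (Nat.sInf_le (m := k + 1) ?_).trans (by omega)
  simpa [Function.iterate_succ_apply] using hk'

/-- The slack 3 reproduces itself: `x + 3 ≤ 2 * x` costs 1 in the logarithm, rounding up costs 1,
and the bit value appended by Cole–Vishkin costs 1. -/
theorem nextBits_real_le {ℓ : ℕ} {x : ℝ} (hℓ : 0 < ℓ) (hx : 3 ≤ x) (h : (ℓ : ℝ) ≤ x + 3) :
    (nextBits ℓ : ℝ) ≤ Real.logb 2 x + 3 := by
  have h1 : (Nat.clog 2 ℓ : ℝ) < Real.logb 2 ℓ + 1 := by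
    have := Real.natCeil_logb_natCast 2 ℓ
    rw [← this]
    have h0 : 0 ≤ Real.logb ((2 : ℕ) : ℝ) ℓ :=
      Real.logb_nonneg (by norm_num) (by exact_mod_cast hℓ)
    exact Nat.ceil_lt_add_one h0
  have h2 : Real.logb 2 (ℓ : ℝ) ≤ Real.logb 2 x + 1 := by
    have h3 : Real.logb 2 (ℓ : ℝ) ≤ Real.logb 2 (x * 2) :=
      Real.logb_le_logb_of_le (by norm_num) (by exact_mod_cast hℓ) (by linarith)
    rwa [Real.logb_mul (by linarith) (by norm_num), Real.logb_self_eq_one (by norm_num)] at h3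
  rw [nextBits]
  push_cast
  linarith

/-- The bound `ℓ ≤ x + 3` is maintained while `x` runs through the iterated logarithms of `b`. Once
`x < 3` it gives `ℓ ≤ 5`; two more steps lead to at most 4 and then 3, and lengths up to 3 stay
there. -/
theorem nextBits_iterate_cvSteps {b : ℕ} (hb : 0 < b) : nextBits^[cvSteps b] b ≤ 3 := by
  have hstay : ∀ m ℓ, ℓ ≤ 3 → nextBits^[m] ℓ ≤ 3 := by
    intro m
    induction m with
    | zero => intro ℓ h; simpa using h
    | succ m ih =>
      intro ℓ h
      rw [Function.iterate_succ_apply]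
      exact ih _ (nextBits_le_three (by omega))
  have key : ∀ k (ℓ : ℕ) (x : ℝ), 0 < ℓ → (ℓ : ℝ) ≤ x + 3 → (Real.logb 2)^[k] x ≤ 1 →
      nextBits^[k + 2] ℓ ≤ 3 := by
    intro k
    induction k with
    | zero =>
      intro ℓ x h0 h1 h2
      have h3 : ℓ ≤ 5 := by
        have : (ℓ : ℝ) < 6 := by
          have h2' : x ≤ 1 := by simpa using h2
          linarith
        have : ℓ < 6 := by exact_mod_cast this
        omega
      exact nextBits_le_three (nextBits_le_self_add h3)
    | succ k ih =>
      intro ℓ x h0 h1 h2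
      rw [show k + 1 + 2 = (k + 2) + 1 from rfl, Function.iterate_succ_apply]
      by_cases hx : 3 ≤ x
      · exact ih _ _ (nextBits_pos ℓ) (nextBits_real_le h0 hx h1)
          (by rwa [Function.iterate_succ_apply] at h2)
      · push Not at hx
        have h3 : ℓ ≤ 5 := by
          have : (ℓ : ℝ) < 6 := by linarith
          have : ℓ < 6 := by exact_mod_cast this
          omega
        have h4 : nextBits ℓ ≤ 4 := nextBits_le_self_add h3
        rw [Function.iterate_succ_apply]
        exact hstay _ _ (nextBits_le_three h4)
  exact key (logStar b) b b hb (by linarith) (logb_iterate_logStar_le b)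

/-! ### Balanced two-colorings of functional graphs -/

/-- As long as one meets neither a sibling nor the color `t`, the values of `φ` along `D` move
strictly in one direction: up if `t` is true, down if `t` is false. Only 8 values are available. The
last clause records that no sibling was passed, so that the path can be traced back. -/
theorem exists_iterate_target {K : Finset ℕ} {D φ : ℕ → ℕ} {κ : ℕ → Bool} {sib : ℕ → Prop}
    (hD : ∀ c ∈ K, D c ∈ K) (hφ : ∀ c ∈ K, φ c < 8) (hφD : ∀ c ∈ K, φ c ≠ φ (D c))
    (hκ : ∀ c ∈ K, ¬ sib c → κ c = decide (φ (D c) < φ c)) (t : Bool) {c : ℕ} (hc : c ∈ K) :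
    ∃ i < 8, (D^[i] c ∈ K) ∧ (sib (D^[i] c) ∨ κ (D^[i] c) = t) ∧ ∀ j < i, ¬ sib (D^[j] c) := by
  have key : ∀ m c, c ∈ K → (if t then 7 - φ c else φ c) ≤ m →
      ∃ i ≤ m, (D^[i] c ∈ K) ∧ (sib (D^[i] c) ∨ κ (D^[i] c) = t) ∧
        ∀ j < i, ¬ sib (D^[j] c) := by
    intro m
    induction m with
    | zero =>
      intro c hc hm
      refine ⟨0, le_rfl, hc, ?_, by simp⟩
      by_contra! hno
      have h1 := hκ c hc hno.1
      have h2 := hφ _ (hD c hc)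
      have h3 := hφ c hc
      have h4 := hφD c hc
      have h5 := hno.2
      simp only [Function.iterate_zero, id] at h5
      rw [h1] at h5
      cases t <;> simp at hm h5 <;> omega
    | succ m ih =>
      intro c hc hm
      by_cases hno : sib c ∨ κ c = t
      · exact ⟨0, by omega, hc, hno, by simp⟩
      · push Not at hno
        have h1 := hκ c hc hno.1
        have h2 := hφ _ (hD c hc)
        have h3 := hφ c hc
        have h4 := hφD c hc
        have h5 := hno.2
        rw [h1] at h5
        obtain ⟨i, hi, h6, h7, h8⟩ := ih (D c) (hD c hc) (by
          cases t <;> simp at hm h5 ⊢ <;> omega)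
        refine ⟨i + 1, by omega, ?_, ?_, ?_⟩
        · rwa [Function.iterate_succ_apply]
        · rwa [Function.iterate_succ_apply]
        · intro j hj
          cases j with
          | zero => exact hno.1
          | succ j =>
            rw [Function.iterate_succ_apply]
            exact h8 j (by omega)
  obtain ⟨i, hi, h⟩ := key 7 c hc (by
    have := hφ c hc
    split <;> omega)
  exact ⟨i, by omega, h⟩

/-- If siblings are colored by the parity of their rank and all others by comparing with their
successor, then both colors are frequent. -/
theorem card_le_mul_card_color {K : Finset ℕ} {D φ rank : ℕ → ℕ} {κ : ℕ → Bool}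
    (hD : ∀ c ∈ K, D c ∈ K) (hφ : ∀ c ∈ K, φ c < 8) (hφD : ∀ c ∈ K, φ c ≠ φ (D c))
    (hinj : ∀ c ∈ K, ∀ c' ∈ K, D c = D c' → rank c = rank c' → c = c')
    (hdown : ∀ c ∈ K, ∀ r < rank c, ∃ c' ∈ K, D c' = D c ∧ rank c' = r)
    (hκ₁ : ∀ c ∈ K, (∃ c' ∈ K, c' ≠ c ∧ D c' = D c) → κ c = decide (rank c % 2 = 1))
    (hκ₂ : ∀ c ∈ K, ¬ (∃ c' ∈ K, c' ≠ c ∧ D c' = D c) → κ c = decide (φ (D c) < φ c))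
    (t : Bool) : K.card ≤ 24 * (K.filter fun c => κ c = t).card := by
  classical
  let sib : ℕ → Prop := fun c => ∃ c' ∈ K, c' ≠ c ∧ D c' = D c
  -- A sibling of the wrong color has one of the right color next to it in rank: the predecessor, or
  -- rank 1 if its own rank is 0. The shift in rank is `δ - 1`, which lies in `{-1, 0, 1}`.
  have hpartner : ∀ E ∈ K, (sib E ∨ κ E = t) →
      ∃ F ∈ K, κ F = t ∧ D F = D E ∧ ∃ δ < 3, rank F + 1 = rank E + δ := by
    intro E hE h
    by_cases hEt : κ E = t
    · exact ⟨E, hE, hEt, rfl, 1, by omega, rfl⟩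
    · have hs : sib E := by tauto
      have hsibF : ∀ F ∈ K, D F = D E → rank F ≠ rank E → κ F = decide (rank F % 2 = 1) := by
        intro F hF hDF hr
        exact hκ₁ F hF ⟨E, hE, fun h => hr (by rw [h]), hDF.symm⟩
      have hκE := hκ₁ E hE hs
      rcases Nat.eq_zero_or_pos (rank E) with h0 | hpos
      · obtain ⟨c', hc', hne, hDc'⟩ := hs
        have hr : rank c' ≠ 0 := fun h' => hne (hinj c' hc' E hE hDc' (by omega))
        obtain ⟨F, hF, hDF, hrF⟩ : ∃ F ∈ K, D F = D E ∧ rank F = 1 := by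
          by_cases h1 : rank c' = 1
          · exact ⟨c', hc', hDc', h1⟩
          · obtain ⟨F, hF, h2, h3⟩ := hdown c' hc' 1 (by omega)
            exact ⟨F, hF, h2.trans hDc', h3⟩
        refine ⟨F, hF, ?_, hDF, 2, by omega, by omega⟩
        rw [hsibF F hF hDF (by omega), hrF]
        rw [hκE, h0] at hEt
        cases t <;> simp at hEt ⊢
      · obtain ⟨F, hF, hDF, hrF⟩ := hdown E hE (rank E - 1) (by omega)
        refine ⟨F, hF, ?_, hDF, 0, by omega, by omega⟩
        rw [hsibF F hF hDF (by omega), hrF]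
        rw [hκE] at hEt
        cases t <;> simp at hEt ⊢ <;> omega
  -- Encode `c` by an element of color `t`, the number of steps along `D` and the shift in rank. The
  -- encoding will be injective, and the constant is `24 = 8 * 3`.
  have hex : ∀ c ∈ K, ∃ x : ℕ × ℕ × ℕ, x.1 ∈ K ∧ κ x.1 = t ∧ x.2.1 < 8 ∧ x.2.2 < 3 ∧
      D^[x.2.1] c ∈ K ∧ D x.1 = D (D^[x.2.1] c) ∧ rank x.1 + 1 = rank (D^[x.2.1] c) + x.2.2 ∧
      ∀ j < x.2.1, ¬ sib (D^[j] c) := by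
    intro c hc
    obtain ⟨i, hi, h1, h2, h3⟩ := exists_iterate_target (sib := sib) hD hφ hφD hκ₂ t hc
    obtain ⟨F, hF, h4, h5, δ, hδ, h6⟩ := hpartner _ h1 h2
    exact ⟨(F, i, δ), hF, h4, hi, hδ, h1, h5, h6, h3⟩
  choose! f hf using hex
  have hmaps : ∀ c ∈ K, f c ∈ (K.filter fun c => κ c = t) ×ˢ (Finset.range 8 ×ˢ Finset.range 3) := by
    intro c hc
    obtain ⟨h1, h2, h3, h4, -⟩ := hf c hc
    simp [h1, h2, h3, h4]
  have hDj : ∀ j, ∀ c ∈ K, D^[j] c ∈ K := by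
    intro j
    induction j with
    | zero => intro c hc; exact hc
    | succ j ih => intro c hc; rw [Function.iterate_succ_apply]; exact ih _ (hD c hc)
  -- An element without siblings is the only preimage of its image under `D`, so a sibling-free path
  -- is determined by its endpoint and length.
  have hback : ∀ i, ∀ c ∈ K, ∀ c' ∈ K, (∀ j < i, ¬ sib (D^[j] c)) → D^[i] c = D^[i] c' →
      c = c' := by
    intro i
    induction i with
    | zero => intro c _ c' _ _ h; exact h
    | succ i ih =>
      intro c hc c' hc' hs h
      refine ih c hc c' hc' (fun j hj => hs j (by omega)) ?_
      rw [Function.iterate_succ_apply', Function.iterate_succ_apply'] at h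
      by_contra hne
      exact hs i (by omega) ⟨D^[i] c', hDj i c' hc', fun h' => hne h'.symm, h.symm⟩
  have hinjf : Set.InjOn f K := by
    intro c hc c' hc' h
    obtain ⟨-, -, -, -, h1, h2, h3, h4⟩ := hf c hc
    obtain ⟨-, -, -, -, h1', h2', h3', -⟩ := hf c' hc'
    rw [← h] at h1' h2' h3'
    exact hback _ c hc c' hc' h4 (hinj _ h1 _ h1' (h2.symm.trans h2') (by omega))
  calc K.card ≤ ((K.filter fun c => κ c = t) ×ˢ (Finset.range 8 ×ˢ Finset.range 3)).card :=
        Finset.card_le_card_of_injOn f hmaps hinjf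
    _ = 24 * (K.filter fun c => κ c = t).card := by
        rw [Finset.card_product, Finset.card_product]; simp; ring

end NetDecomp

namespace NetDecomp

/-! ### Coloring the clusters red and blue -/

/-- The cluster of a node as a number, `0` for dead nodes. -/
def clCode (l : Loc) : ℕ :=
  match l.net.cl with
  | none => 0
  | some c => c + 1

/-- Empty scratch registers. -/
def Work.init : Work where
  nbr _ _ := 0
  tok _ := false
  contact := none
  indeg := 0
  rank := 0
  sib := 0
  phi := 0
  blue := false
  prop := none
  size := 0
  accept := false

/-- The clusters of the neighbors are exchanged. -/
def exchCluster (b w : ℕ) : Op (Loc × Regs) :=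
  exch b 1 (b + w) (fun _ l _ _ => clCode l) fun _ l m =>
    { l with work := { Work.init with nbr := m, phi := l.net.cl.getD 0 } }

/-- Port `p` leads to another cluster. -/
def foreign (e : Env) (l : Loc) (p : ℕ) : Prop :=
  p < e.deg ∧ l.work.nbr p 0 ≠ 0 ∧ l.work.nbr p 0 ≠ clCode l

open Classical in
/-- The first node of each cluster with a neighbor in another cluster becomes its contact. -/
noncomputable def scanContact (b L w R : ℕ) : List (Op (Loc × Regs)) :=
  scan b L w R (fun e l => if ∃ p, foreign e l p then 1 else 0) fun e l _ off =>
    { l with work := { l.work with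
      contact := if h : (∃ p, foreign e l p) ∧ off = 0 then some (Nat.find h.1) else none } }

/-- Contacts mark the neighbor they have chosen. -/
def exchToken (b : ℕ) : Op (Loc × Regs) :=
  exch b 1 1 (fun _ l p _ => if l.work.contact = some p then 1 else 0) fun _ l m =>
    { l with work := { l.work with tok := fun p => decide (m p 0 = 1) } }

/-- The marks in a cluster are numbered. -/
def scanToken (b L w R : ℕ) : List (Op (Loc × Regs)) :=
  scan b L w R (fun e l => Nat.count (fun p => l.work.tok p = true) e.deg) fun _ l tot off =>
    { l with work := { l.work with indeg := tot, rank := off } }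

/-- A contact learns whether its mark is the only one in the cluster, and otherwise the parity of
the number of its mark. -/
def exchSibling (b : ℕ) : Op (Loc × Regs) :=
  exch b 1 2 (fun _ l p _ =>
      if l.work.tok p = true then
        if l.work.indeg ≤ 1 then 0
        else 1 + (l.work.rank + Nat.count (fun q => l.work.tok q = true) p) % 2
      else 0) fun _ l m =>
    { l with work := { l.work with sib := match l.work.contact with
      | none => 0
      | some p => m p 0 } }

/-- Neighbors exchange the current colors of their clusters. -/
def exchPhi (b we : ℕ) : Op (Loc × Regs) :=
  exch b 1 we (fun _ l _ _ => l.work.phi) fun _ l m => { l with work := { l.work with nbr := m } }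

/-- A value computed by the contact. -/
def contactValue (F : Loc → ℕ → ℕ) (l : Loc) : ℕ :=
  match l.work.contact with
  | none => 0
  | some p => F l (l.work.nbr p 0)

/-- A color reduction step on clusters. -/
noncomputable def cvIter (b L w R we : ℕ) : List (Op (Loc × Regs)) :=
  exchPhi b we :: scan b L w R (fun _ => contactValue fun l y => coleVishkin l.work.phi y)
    fun _ l tot _ => { l with work := { l.work with phi := tot } }

/-- The final color of the clusters. -/
def splitColor (l : Loc) (y : ℕ) : ℕ :=
  if l.work.sib = 0 then if y < l.work.phi then 1 else 0 else l.work.sib - 1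

/-- The clusters take their final color. -/
def finalColor (b L w R : ℕ) : List (Op (Loc × Regs)) :=
  exchPhi b w :: scan b L w R (fun _ => contactValue splitColor)
    fun _ l tot _ => { l with work := { l.work with blue := decide (tot = 1) } }

/-- The program that colors the clusters. -/
noncomputable def splitProg (b L w R T : ℕ) : List (Op (Loc × Regs)) :=
  (exchCluster b w :: scanContact b L w R) ++
  (exchToken b :: scanToken b L w R ++ [exchSibling b]) ++
  (cvIter b L w R (b + w) ++ (List.replicate T (cvIter b L w R w)).flatten) ++
  finalColor b L w R

section Split

variable {V : Type*} {G : SimpleGraph V} (P : PortNumbering G) (idn : V → ℕ) (b : ℕ)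

/-- The neighbor behind port `p`. -/
def atPort (v : V) (p : ℕ) : Option V :=
  if h : p < P.deg v then some (P.nbr v ⟨p, h⟩) else none

variable {P}

theorem atPort_adj {v u : V} {p : ℕ} (h : atPort P v p = some u) : G.Adj v u := by
  unfold atPort at h
  split_ifs at h with hp
  simp only [Option.some.injEq] at h
  rw [← h]
  exact (P.nbr v ⟨p, hp⟩).2

theorem atPort_eq {v u : V} {p : ℕ} (h : atPort P v p = some u) : p = portTo P v u := by
  unfold atPort at h
  split_ifs at h with hp
  simp only [Option.some.injEq] at h
  rw [← h, portTo_nbr]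

theorem atPort_portTo {v u : V} (h : G.Adj v u) : atPort P v (portTo P v u) = some u := by
  have := portTo_lt P h
  rw [atPort, dif_pos this, nbr_portTo P h]

theorem atPort_lt {v u : V} {p : ℕ} (h : atPort P v p = some u) : p < P.deg v := by
  unfold atPort at h
  split_ifs at h with hp
  exact hp

theorem exists_atPort {v : V} {p : ℕ} (h : p < P.deg v) : ∃ u, atPort P v p = some u :=
  ⟨_, dif_pos h⟩

theorem fetch_of_atPort {ℓ w : ℕ} {send : Env → Loc → ℕ → ℕ → ℕ} {β : V → Loc} {v u : V} {p j : ℕ}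
    (h : atPort P v p = some u) (hj : j < ℓ)
    (hw : send (envOf P idn u) (β u) (portTo P u v) j < 2 ^ w) :
    fetch P idn ℓ w send β v p j = send (envOf P idn u) (β u) (portTo P u v) j := by
  have hp := atPort_lt h
  simp only [atPort, hp, dif_pos, Option.some.injEq] at h
  simp only [fetch, hp, hj, dif_pos, if_true]
  rw [backPort_eq_portTo, h, Nat.mod_eq_of_lt hw]

theorem fetch_eq_zero {ℓ w : ℕ} {send : Env → Loc → ℕ → ℕ → ℕ} {β : V → Loc} {v : V} {p j : ℕ}
    (h : ¬ p < P.deg v) : fetch P idn ℓ w send β v p j = 0 := by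
  simp [fetch, h]

/-- The neighbor that a node has chosen. -/
def target (P : PortNumbering G) (mk : V → Option ℕ) (v : V) : Option V :=
  (mk v).bind (atPort P v)

theorem target_adj {mk : V → Option ℕ} {v u : V} (h : target P mk v = some u) : G.Adj v u := by
  obtain ⟨p, -, hp⟩ := Option.bind_eq_some_iff.1 h
  exact atPort_adj hp

theorem target_eq_iff {mk : V → Option ℕ} {v u : V} (h : G.Adj v u) :
    target P mk v = some u ↔ mk v = some (portTo P v u) := by
  constructor
  · intro h'
    obtain ⟨p, hp, hp'⟩ := Option.bind_eq_some_iff.1 h'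
    rw [hp, atPort_eq hp']
  · intro h'
    rw [target, h', Option.bind_some, atPort_portTo h]

variable [Fintype V]

open Classical in
theorem count_marks {mk : V → Option ℕ} {tok : ℕ → Bool} {y : V}
    (htok : ∀ p, tok p = true ↔ ∃ u, atPort P y p = some u ∧ target P mk u = some y) :
    Nat.count (fun p => tok p = true) (P.deg y) =
      (Finset.univ.filter fun u => target P mk u = some y).card := by
  rw [Nat.count_eq_card_filter_range, Finset.card_filter, Finset.card_filter]
  rw [← sum_ports (P := P) (fun u => if target P mk u = some y then 1 else 0) y]
  · refine Finset.sum_congr rfl fun p hp => ?_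
    have hp' : p < P.deg y := by simpa using hp
    rw [dif_pos hp']
    have : tok p = true ↔ target P mk (P.nbr y ⟨p, hp'⟩) = some y := by
      rw [htok, atPort, dif_pos hp']
      simp
    simp only [this]
  · intro u hu
    rw [if_neg]
    intro h
    exact hu (target_adj h).symm

open Classical in
/-- The marks that arrive in a cluster come from different nodes. -/
theorem clusterSum_marks {mk : V → Option ℕ} {β : V → Loc} (f : Env → Loc → ℕ)
    (hf : ∀ y, f (envOf P idn y) (β y) = Nat.count (fun p => (β y).work.tok p = true) (P.deg y))
    (htok : ∀ y p, (β y).work.tok p = true ↔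
      ∃ u, atPort P y p = some u ∧ target P mk u = some y) (c : ℕ) :
    clusterSum P idn f β c =
      (Finset.univ.filter fun u => ∃ y, target P mk u = some y ∧ (β y).net.cl = some c).card := by
  have h1 : clusterSum P idn f β c = ∑ y, ∑ u,
      if target P mk u = some y ∧ (β y).net.cl = some c then 1 else 0 := by
    refine Finset.sum_congr rfl fun y _ => ?_
    by_cases hy : (β y).net.cl = some c
    · simp only [own, hy, if_true, hf, and_true]
      rw [count_marks (htok y), Finset.card_filter]
    · simp [own, hy]
  rw [h1, Finset.sum_comm, Finset.card_filter]
  refine Finset.sum_congr rfl fun u _ => ?_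
  by_cases hu : ∃ y, target P mk u = some y ∧ (β y).net.cl = some c
  · obtain ⟨y, hy1, hy2⟩ := hu
    rw [if_pos ⟨y, hy1, hy2⟩, Finset.sum_eq_single y]
    · simp [hy1, hy2]
    · intro z _ hz
      rw [if_neg]
      rintro ⟨h, -⟩
      rw [hy1] at h
      exact hz (by simpa using h.symm)
    · simp
  · rw [if_neg hu]
    refine Finset.sum_eq_zero fun y _ => ?_
    rw [if_neg]
    exact fun h => hu ⟨y, h⟩

end Split

end NetDecomp

/-! ### Contacts: one node per cluster that chooses a neighboring cluster. -/

namespace NetDecomp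

section Split

variable {V : Type*} {G : SimpleGraph V} {P : PortNumbering G} {idn : V → ℕ} {b : ℕ}

/-- The cluster of each node. -/
def clusterOf (β : V → Loc) (v : V) : Option ℕ := (β v).net.cl

/-- The two states agree except for the scratch registers. -/
def SameNet (β β' : V → Loc) : Prop := ∀ v, (β' v).net = (β v).net ∧ (β' v).out = (β v).out

theorem SameNet.trans {β β' β'' : V → Loc} (h : SameNet β β') (h' : SameNet β' β'') :
    SameNet β β'' := fun v => ⟨(h' v).1.trans (h v).1, (h' v).2.trans (h v).2⟩

theorem SameNet.forest {R L : ℕ} {β β' : V → Loc} (h : SameNet β β')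
    (hF : Forest P idn R L fun v => (β v).net) : Forest P idn R L fun v => (β' v).net := by
  have : (fun v => (β' v).net) = fun v => (β v).net := funext fun v => (h v).1
  rwa [this]

theorem SameNet.clusterOf {β β' : V → Loc} (h : SameNet β β') :
    clusterOf β' = clusterOf β := funext fun v => by
  rw [NetDecomp.clusterOf, NetDecomp.clusterOf, (h v).1]

/-- `v` is in cluster `c` and `u` in another cluster `d`, and they are adjacent. -/
def Touch (G : SimpleGraph V) (cl : V → Option ℕ) (v u : V) (c d : ℕ) : Prop :=
  G.Adj v u ∧ cl v = some c ∧ cl u = some d ∧ c ≠ d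

theorem Touch.symm {cl : V → Option ℕ} {v u : V} {c d : ℕ} (h : Touch G cl v u c d) :
    Touch G cl u v d c := ⟨h.1.symm, h.2.2.1, h.2.1, h.2.2.2.symm⟩

/-- Every cluster that has a neighboring cluster has exactly one contact, which has chosen a
neighbor in another cluster. -/
structure Contacts (P : PortNumbering G) (cl : V → Option ℕ) (ct : V → Option ℕ) : Prop where
  touch : ∀ v p, ct v = some p → ∃ u c d, atPort P v p = some u ∧ Touch G cl v u c d
  unique : ∀ v v' c, cl v = some c → cl v' = some c → ct v ≠ none → ct v' ≠ none → v = v'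
  exist : ∀ v u c d, Touch G cl v u c d → ∃ x, cl x = some c ∧ ct x ≠ none

/-- The contacts of a configuration. -/
def contactOf (β : V → Loc) (v : V) : Option ℕ := (β v).work.contact

variable [Fintype V] {R L w : ℕ}

theorem Forest.cl_lt {ν : V → Net} (hF : Forest P idn R L ν) (hlt : ∀ v, idn v < 2 ^ b) {v : V}
    {c : ℕ} (hc : (ν v).cl = some c) : c < 2 ^ b := by
  obtain ⟨r, hr, hr'⟩ := hF.exists_root (hF.member v c hc)
  rw [hF.root r c hr (hF.par_eq_none hr hr')]
  exact hlt r

theorem clusterSum_le_card {f : Env → Loc → ℕ} {β : V → Loc}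
    (hf : ∀ v, f (envOf P idn v) (β v) ≤ 1) (c : ℕ) :
    clusterSum P idn f β c ≤ Fintype.card V := by
  calc clusterSum P idn f β c ≤ ∑ _v : V, 1 := by
        refine Finset.sum_le_sum fun v _ => ?_
        unfold own
        split_ifs
        · exact hf v
        · omega
    _ = Fintype.card V := by simp

/-- The choice of the contacts. -/
theorem run_contact (hb : 0 < b) (hid : Function.Injective idn) (hlt : ∀ v, idn v < 2 ^ b)
    (hw : Fintype.card V < 2 ^ w) (hw1 : 1 ≤ w) {β : V → Loc}
    (hF : Forest P idn R L fun v => (β v).net) :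
    ∃ β', run P idn b (exchCluster b w :: scanContact b L w R) (clearRegs β) = clearRegs β' ∧
      SameNet β β' ∧ Contacts P (clusterOf β) (contactOf β') ∧
      ∀ v c, clusterOf β v = some c → (β' v).work.phi = c := by
  classical
  rw [run_cons, exchCluster, step_exch P idn b hb]
  set β₁ : V → Loc := fun v => { β v with work := { Work.init with
    nbr := fetch P idn 1 (b + w) (fun _ l _ _ => clCode l) β v
    phi := (β v).net.cl.getD 0 } } with hβ₁
  have hnbr : ∀ v p u, atPort P v p = some u → (β₁ v).work.nbr p 0 = clCode (β u) := by
    intro v p u h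
    refine fetch_of_atPort (w := b + w) (send := fun _ l _ _ => clCode l) (β := β) idn h
      Nat.one_pos ?_
    unfold clCode
    split
    · positivity
    · rename_i c hc
      have h1 := hF.cl_lt hlt hc
      calc c + 1 ≤ 2 ^ b := h1
        _ < 2 ^ (b + w) := Nat.pow_lt_pow_right (by norm_num) (by omega)
  have hforeign : ∀ v c p, clusterOf β v = some c → (foreign (envOf P idn v) (β₁ v) p ↔
      ∃ u d, atPort P v p = some u ∧ Touch G (clusterOf β) v u c d) := by
    intro v c p hc
    have hc' : clCode (β₁ v) = c + 1 := by
      have : (β₁ v).net.cl = some c := hc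
      simp [clCode, this]
    constructor
    · rintro ⟨h1, h2, h3⟩
      obtain ⟨u, hu⟩ := exists_atPort (P := P) h1
      rw [hnbr v p u hu] at h2 h3
      rw [hc'] at h3
      cases hcu : (β u).net.cl with
      | none => simp [clCode, hcu] at h2
      | some d =>
        refine ⟨u, d, hu, atPort_adj hu, hc, hcu, ?_⟩
        rintro rfl
        simp [clCode, hcu] at h3
    · rintro ⟨u, d, hu, -, -, hd, hne⟩
      have hd' : (β u).net.cl = some d := hd
      refine ⟨atPort_lt hu, ?_, ?_⟩
      · rw [hnbr v p u hu]
        simp [clCode, hd']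
      · rw [hnbr v p u hu, hc']
        simp [clCode, hd', hne.symm]
  have hF₁ : Forest P idn R L fun v => (β₁ v).net := hF
  obtain ⟨β', off, h1, hd, ha, -, h2⟩ := hF₁.run_scan b hb hid (w := w)
    (f := fun e l => if ∃ p, foreign e l p then 1 else 0)
    (fun c => lt_of_le_of_lt (clusterSum_le_card (fun v => by split_ifs <;> omega) c) hw)
    (fun e l _ off => { l with work := { l.work with
      contact := if h : (∃ p, foreign e l p) ∧ off = 0 then some (Nat.find h.1) else none } })
  refine ⟨β', h1, ?_, ?_, ?_⟩
  · intro v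
    cases hc : (β₁ v).net.cl with
    | none => rw [hd v hc]; exact ⟨rfl, rfl⟩
    | some c => rw [ha v c hc]; exact ⟨rfl, rfl⟩
  · have hct : ∀ v c, clusterOf β v = some c → contactOf β' v =
        if h : (∃ p, foreign (envOf P idn v) (β₁ v) p) ∧ off v = 0 then
            some (Nat.find h.1) else none := by
      intro v c hc
      rw [contactOf, ha v c hc]
    have hct0 : ∀ v, clusterOf β v = none → contactOf β' v = none := by
      intro v hc
      rw [contactOf, hd v hc]
      rfl
    constructor
    · intro v p hp
      cases hc : clusterOf β v with
      | none => rw [hct0 v hc] at hp; simp at hp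
      | some c =>
        rw [hct v c hc] at hp
        split_ifs at hp with h
        obtain ⟨u, d, hu⟩ := (hforeign v c _ hc).1 (Nat.find_spec h.1)
        simp only [Option.some.injEq] at hp
        rw [hp] at hu
        exact ⟨u, c, d, hu⟩
    · intro v v' c hc hc' hv hv'
      rw [hct v c hc] at hv
      rw [hct v' c hc'] at hv'
      have h3 : (∃ p, foreign (envOf P idn v) (β₁ v) p) ∧ off v = 0 := by
        by_contra h; simp [dif_neg h] at hv
      have h4 : (∃ p, foreign (envOf P idn v') (β₁ v') p) ∧ off v' = 0 := by
        by_contra h; simp [dif_neg h] at hv'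
      have hpos : 0 < clusterSum P idn (fun e l => if ∃ p, foreign e l p then 1 else 0) β₁ c := by
        refine Finset.sum_pos' (fun _ _ => Nat.zero_le _) ⟨v, Finset.mem_univ v, ?_⟩
        have hcv : (β₁ v).net.cl = some c := hc
        simp only [own, hcv, if_true, h3.1]
        norm_num
      -- Both nodes have weight 1 and offset 0, so both their intervals contain the point 0, which
      -- belongs to only one interval.
      refine (h2 c 0 hpos).unique ⟨hc, by omega, ?_⟩ ⟨hc', by omega, ?_⟩
      · simp [h3.1]
      · simp [h4.1]
    · intro v u c d h
      have hcv : (β₁ v).net.cl = some c := h.2.1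
      have hfv : ∃ p, foreign (envOf P idn v) (β₁ v) p :=
        ⟨portTo P v u, (hforeign v c _ h.2.1).2 ⟨u, d, atPort_portTo h.1, h⟩⟩
      have hpos : 0 < clusterSum P idn (fun e l => if ∃ p, foreign e l p then 1 else 0) β₁ c := by
        refine Finset.sum_pos' (fun _ _ => Nat.zero_le _) ⟨v, Finset.mem_univ v, ?_⟩
        simp only [own, hcv, if_true, hfv]
        norm_num
      obtain ⟨x, ⟨hx1, hx2, hx3⟩, -⟩ := h2 c 0 hpos
      refine ⟨x, hx1, ?_⟩
      rw [hct x c hx1, dif_pos]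
      · simp
      · constructor
        · by_contra hno
          simp only [hno, if_false] at hx3
          omega
        · omega
  · intro v c hc
    have : (β v).net.cl = some c := hc
    rw [ha v c hc]
    simp [hβ₁, this]

end Split
end NetDecomp

/-! ### Numbering the clusters that have chosen the same cluster. -/

namespace NetDecomp

section Split

variable {V : Type*} {G : SimpleGraph V} {P : PortNumbering G} {idn : V → ℕ} {b : ℕ}

theorem exists_count_eq {p : ℕ → Prop} [DecidablePred p] {n k : ℕ} (h : k < Nat.count p n) :
    ∃ q < n, p q ∧ Nat.count p q = k := by
  induction n with
  | zero => simp at h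
  | succ n ih =>
    by_cases hk : k < Nat.count p n
    · obtain ⟨q, hq, h1⟩ := ih hk
      exact ⟨q, by omega, h1⟩
    · rw [Nat.count_succ] at h
      by_cases hp : p n
      · rw [if_pos hp] at h
        exact ⟨n, by omega, hp, by omega⟩
      · rw [if_neg hp] at h
        omega

/-- The effect of sending a mark to the chosen neighbor. -/
theorem marks_of_fetch {mk : V → Option ℕ} {send : Env → Loc → ℕ → ℕ → ℕ} {β : V → Loc}
    (hsend : ∀ u p, send (envOf P idn u) (β u) p 0 = if mk u = some p then 1 else 0) (y : V)
    (p : ℕ) : fetch P idn 1 1 send β y p 0 = 1 ↔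
      ∃ u, atPort P y p = some u ∧ target P mk u = some y := by
  by_cases hp : p < P.deg y
  · obtain ⟨u, hu⟩ := exists_atPort (P := P) hp
    have h1 : fetch P idn 1 1 send β y p 0 = send (envOf P idn u) (β u) (portTo P u y) 0 := by
      refine fetch_of_atPort idn hu Nat.one_pos ?_
      rw [hsend]
      split_ifs <;> norm_num
    rw [h1, hsend]
    have hadj := (atPort_adj hu).symm
    constructor
    · intro h
      refine ⟨u, hu, (target_eq_iff hadj).2 ?_⟩
      by_contra hne
      simp [hne] at h
    · rintro ⟨u', hu', ht⟩
      rw [hu] at hu'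
      obtain rfl : u = u' := by simpa using hu'
      rw [if_pos ((target_eq_iff hadj).1 ht)]
  · rw [fetch_eq_zero idn hp]
    constructor
    · intro h; omega
    · rintro ⟨u, hu, -⟩
      exact absurd (atPort_lt hu) hp

/-- Numbers for the nodes that have chosen a neighbor: those with chosen neighbors in the same
cluster get different numbers, without gaps, and `sib` tells whether there is more than one, and
the parity. -/
structure Ranked (P : PortNumbering G) (cl : V → Option ℕ) (ct : V → Option ℕ) (sib : V → ℕ)
    (rk : V → ℕ) : Prop where
  inj : ∀ v v' y y' d, target P ct v = some y → target P ct v' = some y' → cl y = some d →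
    cl y' = some d → rk v = rk v' → v = v'
  down : ∀ v y d, target P ct v = some y → cl y = some d → ∀ r < rk v,
    ∃ v' y', target P ct v' = some y' ∧ cl y' = some d ∧ rk v' = r
  sib_none : ∀ v y d, target P ct v = some y → cl y = some d →
    (∀ v' y', target P ct v' = some y' → cl y' = some d → v' = v) → sib v = 0
  sib_some : ∀ v y d, target P ct v = some y → cl y = some d →
    ∀ v' y', target P ct v' = some y' → cl y' = some d → v' ≠ v → sib v = 1 + rk v % 2

variable [Fintype V] {R L w : ℕ}

/-- A mark is numbered by the offset of the node that received it plus the number of marks at lower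
ports of that node. The intervals of a `scan` tile the range, so the marks of a cluster are numbered
bijectively by `0, …, Tot - 1`. A contact only needs to hear whether its mark is alone and its
parity, hence two bits. -/
theorem run_sibling (hb : 0 < b) (hid : Function.Injective idn)
    (hw : Fintype.card V < 2 ^ w) {β : V → Loc}
    (hF : Forest P idn R L fun v => (β v).net) :
    ∃ β', run P idn b (exchToken b :: scanToken b L w R ++ [exchSibling b]) (clearRegs β) =
        clearRegs β' ∧ SameNet β β' ∧ contactOf β' = contactOf β ∧
      (∀ v, (β' v).work.phi = (β v).work.phi) ∧
      ∃ rk : V → ℕ, Ranked P (clusterOf β) (contactOf β) (fun v => (β' v).work.sib) rk := by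
  classical
  rw [List.cons_append, run_cons, exchToken, step_exch P idn b hb, run_append]
  set β₁ : V → Loc := fun v => { β v with work := { (β v).work with
    tok := fun p => decide (fetch P idn 1 1
      (fun _ l p _ => if l.work.contact = some p then 1 else 0) β v p 0 = 1) } } with hβ₁
  have htok : ∀ y p, (β₁ y).work.tok p = true ↔
      ∃ u, atPort P y p = some u ∧ target P (contactOf β) u = some y := by
    intro y p
    rw [← marks_of_fetch (idn := idn) (β := β) (mk := contactOf β)
      (send := fun _ l p _ => if l.work.contact = some p then 1 else 0) (fun u p => rfl) y p]
    simp [hβ₁]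
  have hF₁ : Forest P idn R L fun v => (β₁ v).net := hF
  have hsum : ∀ c, clusterSum P idn (fun e l => Nat.count (fun p => l.work.tok p = true) e.deg)
      β₁ c = (Finset.univ.filter fun u => ∃ y, target P (contactOf β) u = some y ∧
        (β₁ y).net.cl = some c).card :=
    fun c => clusterSum_marks idn _ (fun y => rfl) htok c
  obtain ⟨β₂, off, h1, hd, ha, hle, h2⟩ := hF₁.run_scan b hb hid (w := w)
    (f := fun e l => Nat.count (fun p => l.work.tok p = true) e.deg)
    (fun c => by
      rw [hsum c]
      exact lt_of_le_of_lt (Finset.card_le_univ _) hw)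
    (fun _ l tot off => { l with work := { l.work with indeg := tot, rank := off } })
  rw [scanToken, h1, run_cons, run_nil, exchSibling, step_exch P idn b hb]
  have hβ₂ : ∀ v, (β₂ v).net = (β v).net ∧ (β₂ v).out = (β v).out ∧
      (β₂ v).work.contact = (β v).work.contact ∧ (β₂ v).work.phi = (β v).work.phi ∧
      (β₂ v).work.tok = (β₁ v).work.tok := by
    intro v
    cases hc : (β₁ v).net.cl with
    | none => rw [hd v hc]; exact ⟨rfl, rfl, rfl, rfl, rfl⟩
    | some c => rw [ha v c hc]; exact ⟨rfl, rfl, rfl, rfl, rfl⟩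
  refine ⟨_, rfl, fun v => ⟨(hβ₂ v).1, (hβ₂ v).2.1⟩, funext fun v => (hβ₂ v).2.2.1,
    fun v => (hβ₂ v).2.2.2.1, ?_⟩
  let num : V → V → ℕ := fun y v =>
    off y + Nat.count (fun q => (β₁ y).work.tok q = true) (portTo P y v)
  let Tot : ℕ → ℕ := fun d =>
    clusterSum P idn (fun e l => Nat.count (fun p => l.work.tok p = true) e.deg) β₁ d
  refine ⟨fun v => match target P (contactOf β) v with | none => 0 | some y => num y v, ?_⟩
  have htokv : ∀ v y, target P (contactOf β) v = some y →
      (β₁ y).work.tok (portTo P y v) = true := by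
    intro v y h
    rw [htok]
    exact ⟨v, atPort_portTo (target_adj h).symm, h⟩
  have hin : ∀ v y, target P (contactOf β) v = some y →
      Nat.count (fun q => (β₁ y).work.tok q = true) (portTo P y v) <
        Nat.count (fun q => (β₁ y).work.tok q = true) (P.deg y) := by
    intro v y h
    exact Nat.count_strict_mono (htokv v y h) (portTo_lt P (target_adj h).symm)
  have hnumlt : ∀ v y d, target P (contactOf β) v = some y → clusterOf β y = some d →
      num y v < Tot d := by
    intro v y d h hy
    have e1 := hin v y h
    have e2 : off y + Nat.count (fun q => (β₁ y).work.tok q = true) (P.deg y) ≤ Tot d := hle y d hy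
    simp only [num]
    omega
  have hnuminj : ∀ v v' y y' d, target P (contactOf β) v = some y →
      target P (contactOf β) v' = some y' → clusterOf β y = some d → clusterOf β y' = some d →
      num y v = num y' v' → v = v' := by
    intro v v' y y' d h h' hy hy' heq
    have hlt := hnumlt v y d h hy
    have e1 := hin v y h
    have e2 := hin v' y' h'
    obtain rfl : y = y' := (h2 d _ hlt).unique ⟨hy, Nat.le_add_right _ _, by
      simp only [num, envOf]; omega⟩ ⟨hy', heq ▸ Nat.le_add_right _ _, by
      rw [heq]; simp only [num, envOf]; omega⟩
    have e3 : Nat.count (fun q => (β₁ y).work.tok q = true) (portTo P y v) =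
        Nat.count (fun q => (β₁ y).work.tok q = true) (portTo P y v') := by
      simp only [num] at heq; omega
    have e4 := Nat.count_injective (htokv v y h) (htokv v' y h') e3
    have e5 := atPort_portTo (P := P) (target_adj h).symm
    have e6 := atPort_portTo (P := P) (target_adj h').symm
    rw [e4, e6] at e5
    simpa using e5.symm
  have hnumex : ∀ d, ∀ r < Tot d, ∃ v y, target P (contactOf β) v = some y ∧
      clusterOf β y = some d ∧ num y v = r := by
    intro d r hr
    obtain ⟨y, ⟨hy, h3, h4⟩, -⟩ := h2 d r hr
    simp only [envOf] at h4
    have h5 : r - off y < Nat.count (fun q => (β₁ y).work.tok q = true) (P.deg y) := by omega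
    obtain ⟨q, hq, htq, hcq⟩ := exists_count_eq h5
    obtain ⟨v, hv, ht⟩ := (htok y q).1 htq
    refine ⟨v, y, ht, hy, ?_⟩
    simp only [num]
    rw [← atPort_eq hv, hcq]
    omega
  have hsib : ∀ v y d, target P (contactOf β) v = some y → clusterOf β y = some d →
      fetch P idn 1 2 (fun _ l p _ =>
      if l.work.tok p = true then
        if l.work.indeg ≤ 1 then 0
        else 1 + (l.work.rank + Nat.count (fun q => l.work.tok q = true) p) % 2
      else 0) β₂ v (portTo P v y) 0 = if Tot d ≤ 1 then 0 else 1 + num y v % 2 := by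
    intro v y d h hy
    have hadj := target_adj h
    have e1 : (β₂ y).work.tok (portTo P y v) = true := by
      rw [(hβ₂ y).2.2.2.2]; exact htokv v y h
    have e2 : (β₂ y).work.indeg = Tot d ∧ (β₂ y).work.rank = off y := by
      rw [ha y d hy]; exact ⟨rfl, rfl⟩
    rw [fetch_of_atPort idn (atPort_portTo hadj) Nat.one_pos]
    · rw [if_pos e1, e2.1, e2.2, (hβ₂ y).2.2.2.2]
    · rw [if_pos e1]
      split_ifs <;> omega
  have hsib' : ∀ v y d, target P (contactOf β) v = some y → clusterOf β y = some d →
      (match (β₂ v).work.contact with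
        | none => 0
        | some p => fetch P idn 1 2 (fun _ l p _ =>
          if l.work.tok p = true then
            if l.work.indeg ≤ 1 then 0
            else 1 + (l.work.rank + Nat.count (fun q => l.work.tok q = true) p) % 2
          else 0) β₂ v p 0) = if Tot d ≤ 1 then 0 else 1 + num y v % 2 := by
    intro v y d h hy
    have e1 : (β₂ v).work.contact = some (portTo P v y) := by
      rw [(hβ₂ v).2.2.1]; exact (target_eq_iff (target_adj h)).1 h
    simp only [e1]
    exact hsib v y d h hy
  constructor
  · intro v v' y y' d h h' hy hy' heq
    simp only [h, h'] at heq
    exact hnuminj v v' y y' d h h' hy hy' heq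
  · intro v y d h hy r hr
    simp only [h] at hr
    obtain ⟨v', y', h3, h4, h5⟩ := hnumex d r (hr.trans (hnumlt v y d h hy))
    exact ⟨v', y', h3, h4, by simp only [h3, h5]⟩
  · intro v y d h hy hall
    refine (hsib' v y d h hy).trans (if_pos ?_)
    by_contra hgt
    obtain ⟨v0, y0, h3, h4, h5⟩ := hnumex d 0 (by omega)
    obtain ⟨v1, y1, h6, h7, h8⟩ := hnumex d 1 (by omega)
    obtain rfl := hall v0 y0 h3 h4
    obtain rfl := hall v1 y1 h6 h7
    rw [h3] at h6
    obtain rfl : y0 = y1 := by simpa using h6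
    omega
  · intro v y d h hy v' y' h' hy' hne
    refine (hsib' v y d h hy).trans ?_
    rw [if_neg]
    · simp only [h]
    · intro hle1
      have e1 := hnumlt v y d h hy
      have e2 := hnumlt v' y' d h' hy'
      exact hne (hnuminj v' v y' y d h' h hy' hy (by omega))

end Split
end NetDecomp

/-! ### Color reduction on clusters and the balanced red-blue coloring. -/

namespace NetDecomp

theorem nextBits_le_self {ℓ : ℕ} (h : 0 < ℓ) : nextBits ℓ ≤ ℓ := by
  have h1 : Nat.clog 2 ℓ ≤ ℓ - 1 := by
    apply Nat.clog_le_of_le_pow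
    have := Nat.lt_two_pow_self (n := ℓ - 1)
    omega
  rw [nextBits]
  omega

section Split

variable {V : Type*} {G : SimpleGraph V} {P : PortNumbering G} {idn : V → ℕ} {b : ℕ}

theorem Contacts.exists_target {cl ct : V → Option ℕ} (hC : Contacts P cl ct) {v : V}
    (h : ct v ≠ none) : ∃ y c d, target P ct v = some y ∧ Touch G cl v y c d := by
  obtain ⟨p, hp⟩ := Option.ne_none_iff_exists'.1 h
  obtain ⟨u, c, d, hu, ht⟩ := hC.touch v p hp
  exact ⟨u, c, d, by rw [target, hp, Option.bind_some, hu], ht⟩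

theorem ne_none_of_target {ct : V → Option ℕ} {v y : V} (h : target P ct v = some y) :
    ct v ≠ none := by
  intro h'
  rw [target, h'] at h
  simp at h

/-- The cluster colors are proper along the choices of the contacts. -/
def ProperOn (P : PortNumbering G) (cl ct : V → Option ℕ) (φ : ℕ → ℕ) : Prop :=
  ∀ v y c d, target P ct v = some y → cl v = some c → cl y = some d → φ c ≠ φ d

variable [Fintype V] {R L w : ℕ}

/-- All nodes except the unique contact contribute 0, so summation acts as a broadcast from the
contact to its cluster. -/
theorem clusterSum_contact {β : V → Loc} (hC : Contacts P (clusterOf β) (contactOf β))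
    (F : Loc → ℕ → ℕ) {x y : V} {c : ℕ} (hx : clusterOf β x = some c)
    (ht : target P (contactOf β) x = some y) :
    clusterSum P idn (fun _ => contactValue F) β c =
      F (β x) ((β x).work.nbr (portTo P x y) 0) := by
  classical
  have hct : (β x).work.contact = some (portTo P x y) := (target_eq_iff (target_adj ht)).1 ht
  have hcl : (β x).net.cl = some c := hx
  rw [clusterSum, Finset.sum_eq_single x]
  · simp [own, hcl, contactValue, hct]
  · intro z _ hz
    unfold own
    split_ifs with hzc
    · cases hcz : (β z).work.contact with
      | none => simp [contactValue, hcz]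
      | some p =>
        exact absurd (hC.unique z x c hzc hx (by rw [contactOf, hcz]; simp)
          (ne_none_of_target ht)) hz
    · rfl
  · simp

theorem clusterSum_no_contact {β : V → Loc} (F : Loc → ℕ → ℕ) {c : ℕ}
    (h : ∀ x, clusterOf β x = some c → contactOf β x = none) :
    clusterSum P idn (fun _ => contactValue F) β c = 0 := by
  refine Finset.sum_eq_zero fun x _ => ?_
  unfold own
  split_ifs with hx
  · have := h x hx
    simp only [contactOf] at this
    simp [contactValue, this]
  · rfl

theorem clusterSum_contact_lt {β : V → Loc} (hC : Contacts P (clusterOf β) (contactOf β))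
    (F : Loc → ℕ → ℕ) {B : ℕ} (hB : 0 < B) (hF : ∀ x y, target P (contactOf β) x = some y →
      F (β x) ((β x).work.nbr (portTo P x y) 0) < B) (c : ℕ) :
    clusterSum P idn (fun _ => contactValue F) β c < B := by
  by_cases h : ∀ x, clusterOf β x = some c → contactOf β x = none
  · rw [clusterSum_no_contact F h]; exact hB
  · push Not at h
    obtain ⟨x, hx, hct⟩ := h
    obtain ⟨y, c', d, ht, -⟩ := hC.exists_target hct
    rw [clusterSum_contact hC F hx ht]
    exact hF x y ht

/-- The effect of the exchange of colors. -/
theorem step_exchPhi (hb : 0 < b) {we : ℕ} {β : V → Loc} {φ : ℕ → ℕ}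
    (hphi : ∀ v c, clusterOf β v = some c → (β v).work.phi = φ c)
    (hφ : ∀ v c, clusterOf β v = some c → φ c < 2 ^ we) :
    ∃ β', step P idn b (exchPhi b we) (clearRegs β) = clearRegs β' ∧ SameNet β β' ∧
      (∀ v, (β' v).work.contact = (β v).work.contact ∧ (β' v).work.sib = (β v).work.sib ∧
        (β' v).work.phi = (β v).work.phi) ∧
      ∀ v u d, G.Adj v u → clusterOf β u = some d →
        (β' v).work.nbr (portTo P v u) 0 = φ d := by
  rw [exchPhi, step_exch P idn b hb]
  refine ⟨_, rfl, fun v => ⟨rfl, rfl⟩, fun v => ⟨rfl, rfl, rfl⟩, ?_⟩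
  intro v u d hadj hd
  dsimp only
  rw [fetch_of_atPort idn (atPort_portTo hadj) Nat.one_pos, hphi u d hd]
  rw [hphi u d hd]
  exact hφ u d hd

/-- Two widths occur: the old colors, exchanged between neighbors with width `we`, may be as long as
identifiers, while the new colors, sent through the trees, have only `nextBits ℓ ≤ w` bits. -/
theorem run_cvIter (hb : 0 < b) (hid : Function.Injective idn) {we ℓ : ℕ} {β : V → Loc}
    {φ : ℕ → ℕ} (hF : Forest P idn R L fun v => (β v).net)
    (hC : Contacts P (clusterOf β) (contactOf β))
    (hphi : ∀ v c, clusterOf β v = some c → (β v).work.phi = φ c)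
    (hφ : ∀ v c, clusterOf β v = some c → φ c < 2 ^ ℓ) (hℓ : 0 < ℓ) (hℓe : ℓ ≤ we)
    (hℓw : nextBits ℓ ≤ w) (hprop : ProperOn P (clusterOf β) (contactOf β) φ) :
    ∃ β' φ', run P idn b (cvIter b L w R we) (clearRegs β) = clearRegs β' ∧ SameNet β β' ∧
      contactOf β' = contactOf β ∧ (∀ v, (β' v).work.sib = (β v).work.sib) ∧
      (∀ v c, clusterOf β v = some c → (β' v).work.phi = φ' c) ∧
      (∀ c, φ' c < 2 ^ nextBits ℓ) ∧
      ProperOn P (clusterOf β) (contactOf β) φ' := by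
  obtain ⟨β₁, h1, hs₁, hw₁, hn₁⟩ := step_exchPhi (P := P) (idn := idn) hb hphi
    (fun v c hc => (hφ v c hc).trans_le (Nat.pow_le_pow_right (by norm_num) hℓe))
  have hcl₁ : clusterOf β₁ = clusterOf β := hs₁.clusterOf
  have hct₁ : contactOf β₁ = contactOf β := funext fun v => (hw₁ v).1
  have hC₁ : Contacts P (clusterOf β₁) (contactOf β₁) := by rw [hcl₁, hct₁]; exact hC
  have hval : ∀ x y c d, target P (contactOf β) x = some y → clusterOf β x = some c →
      clusterOf β y = some d →
      coleVishkin (β₁ x).work.phi ((β₁ x).work.nbr (portTo P x y) 0) =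
        coleVishkin (φ c) (φ d) := by
    intro x y c d ht hc hd
    rw [(hw₁ x).2.2, hphi x c hc, hn₁ x y d (target_adj ht) hd]
  have hlt : ∀ c, clusterSum P idn (fun _ => contactValue fun l y => coleVishkin l.work.phi y)
      β₁ c < 2 ^ nextBits ℓ := by
    refine clusterSum_contact_lt hC₁ _ (by positivity) ?_
    intro x y ht
    rw [hct₁] at ht
    obtain ⟨y', c, d, ht', h2⟩ := hC.exists_target (ne_none_of_target ht)
    rw [ht] at ht'
    obtain rfl : y = y' := by simpa using ht'
    rw [hval x y c d ht h2.2.1 h2.2.2.1]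
    exact coleVishkin_lt_nextBits hℓ (hφ x c h2.2.1) (hφ y d h2.2.2.1)
  obtain ⟨β₂, off, h2, hd, ha, -, -⟩ := (hs₁.forest hF).run_scan b hb hid (w := w)
    (f := fun _ => contactValue fun l y => coleVishkin l.work.phi y)
    (fun c => (hlt c).trans_le (Nat.pow_le_pow_right (by norm_num) hℓw))
    (fun _ l tot _ => { l with work := { l.work with phi := tot } })
  have hs₂ : SameNet β₁ β₂ := by
    intro v
    cases hc : (β₁ v).net.cl with
    | none => rw [hd v hc]; exact ⟨rfl, rfl⟩
    | some c => rw [ha v c hc]; exact ⟨rfl, rfl⟩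
  have hw₂ : ∀ v, (β₂ v).work.contact = (β₁ v).work.contact ∧
      (β₂ v).work.sib = (β₁ v).work.sib := by
    intro v
    cases hc : (β₁ v).net.cl with
    | none => rw [hd v hc]; exact ⟨rfl, rfl⟩
    | some c => rw [ha v c hc]; exact ⟨rfl, rfl⟩
  refine ⟨β₂, _, ?_, hs₁.trans hs₂, ?_, ?_, ?_, hlt, ?_⟩
  · rw [cvIter, run_cons, h1, h2]
  · exact funext fun v => (hw₂ v).1.trans (hw₁ v).1
  · exact fun v => (hw₂ v).2.trans (hw₁ v).2.1
  · intro v c hc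
    have : (β₁ v).net.cl = some c := by rw [← hcl₁] at hc; exact hc
    rw [ha v c this]
  · intro v y c d ht hc hd'
    have hne := hprop v y c d ht hc hd'
    have hcd : Touch G (clusterOf β) v y c d := by
      refine ⟨target_adj ht, hc, hd', ?_⟩
      rintro rfl
      exact hne rfl
    -- The chosen cluster has a neighbor, namely the one that chose it, so it has a contact and made
    -- a choice too. Thus both new colors are genuine Cole–Vishkin values.
    obtain ⟨x, hx, hctx⟩ := hC.exist _ _ _ _ hcd.symm
    obtain ⟨z, d', e, htz, hz⟩ := hC.exists_target hctx
    obtain rfl : d = d' := by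
      have := hx.symm.trans hz.2.1
      simpa using this
    have e1 := clusterSum_contact (idn := idn) hC₁ (fun l y => coleVishkin l.work.phi y)
      (by rw [hcl₁]; exact hc) (by rw [hct₁]; exact ht)
    have e2 := clusterSum_contact (idn := idn) hC₁ (fun l y => coleVishkin l.work.phi y)
      (by rw [hcl₁]; exact hx) (by rw [hct₁]; exact htz)
    rw [e1, e2, hval v y c d ht hc hd', hval x z d e htz hx hz.2.2.1]
    exact coleVishkin_ne hne (hprop x z d e htz hx hz.2.2.1)

theorem run_cvIters (hb : 0 < b) (hid : Function.Injective idn) (T : ℕ) :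
    ∀ {ℓ : ℕ} {β : V → Loc} {φ : ℕ → ℕ}, Forest P idn R L (fun v => (β v).net) →
    Contacts P (clusterOf β) (contactOf β) →
    (∀ v c, clusterOf β v = some c → (β v).work.phi = φ c) →
    (∀ c, φ c < 2 ^ ℓ) → 0 < ℓ → ℓ ≤ w →
    ProperOn P (clusterOf β) (contactOf β) φ →
    ∃ β' φ', run P idn b (List.replicate T (cvIter b L w R w)).flatten (clearRegs β) =
        clearRegs β' ∧ SameNet β β' ∧
      contactOf β' = contactOf β ∧ (∀ v, (β' v).work.sib = (β v).work.sib) ∧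
      (∀ v c, clusterOf β v = some c → (β' v).work.phi = φ' c) ∧
      (∀ c, φ' c < 2 ^ nextBits^[T] ℓ) ∧
      ProperOn P (clusterOf β) (contactOf β) φ' := by
  induction T with
  | zero =>
    intro ℓ β φ hF hC hphi hφ hℓ hℓw hprop
    exact ⟨β, φ, rfl, fun v => ⟨rfl, rfl⟩, rfl, fun v => rfl, hphi, hφ, hprop⟩
  | succ T ih =>
    intro ℓ β φ hF hC hphi hφ hℓ hℓw hprop
    obtain ⟨β₁, φ₁, h1, hs, hct, hsib, hphi₁, hφ₁, hprop₁⟩ := run_cvIter (w := w) (we := w) hb hid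
      hF hC hphi (fun _ c _ => hφ c) hℓ hℓw ((nextBits_le_self hℓ).trans hℓw) hprop
    have hcl : clusterOf β₁ = clusterOf β := hs.clusterOf
    obtain ⟨β₂, φ₂, h2, hs₂, hct₂, hsib₂, hphi₂, hφ₂, hprop₂⟩ := ih (hs.forest hF)
      (by rw [hcl, hct]; exact hC) (by rw [hcl]; exact hphi₁) hφ₁ (nextBits_pos ℓ)
      ((nextBits_le_self hℓ).trans hℓw) (by rw [hcl, hct]; exact hprop₁)
    refine ⟨β₂, φ₂, ?_, hs.trans hs₂, hct₂.trans hct, fun v => (hsib₂ v).trans (hsib v), ?_, hφ₂, ?_⟩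
    · rw [List.replicate_succ, List.flatten_cons, run_append, h1, h2]
    · rw [hcl] at hphi₂; exact hphi₂
    · rw [hcl, hct] at hprop₂; exact hprop₂

/-- The clusters that have a neighboring cluster. -/
def HasNeighbor (G : SimpleGraph V) (cl : V → Option ℕ) (c : ℕ) : Prop :=
  ∃ v u d, Touch G cl v u c d

/-- A coloring `κ` of the clusters that is balanced: it satisfies the hypotheses of
`card_le_mul_card_color`, with `D` choosing a neighboring cluster. -/
structure Balanced (G : SimpleGraph V) (cl : V → Option ℕ) (κ : ℕ → Bool) (D φ rank : ℕ → ℕ) :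
    Prop where
  touch : ∀ c, HasNeighbor G cl c → ∃ v u, Touch G cl v u c (D c)
  lt : ∀ c, HasNeighbor G cl c → φ c < 8
  ne : ∀ c, HasNeighbor G cl c → φ c ≠ φ (D c)
  inj : ∀ c c', HasNeighbor G cl c → HasNeighbor G cl c' → D c = D c' → rank c = rank c' → c = c'
  down : ∀ c, HasNeighbor G cl c → ∀ r < rank c,
    ∃ c', HasNeighbor G cl c' ∧ D c' = D c ∧ rank c' = r
  color_sibling : ∀ c c', HasNeighbor G cl c → HasNeighbor G cl c' → c' ≠ c → D c' = D c →
    κ c = decide (rank c % 2 = 1)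
  color_single : ∀ c, HasNeighbor G cl c → (∀ c', HasNeighbor G cl c' → D c' = D c → c' = c) →
    κ c = decide (φ (D c) < φ c)

/-- The facts about contacts are translated into facts about clusters. The initial coloring is the
cluster label itself, which is proper along choices because a contact chooses a different cluster.
-/
theorem run_split [Nonempty V] (hb : 0 < b) (hid : Function.Injective idn) (hlt : ∀ v, idn v < 2 ^ b)
    (hw : Fintype.card V < 2 ^ w) (hwb : nextBits b ≤ w) (hw3 : 3 ≤ w) {T : ℕ}
    (hT : nextBits^[T] (nextBits b) ≤ 3) {β : V → Loc}
    (hF : Forest P idn R L fun v => (β v).net) :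
    ∃ β' κ, run P idn b (splitProg b L w R T) (clearRegs β) = clearRegs β' ∧ SameNet β β' ∧
      (∀ v c, clusterOf β v = some c → (β' v).work.blue = κ c) ∧
      ∃ D φ rank, Balanced G (clusterOf β) κ D φ rank := by
  classical
  obtain ⟨β₁, r1, hs₁, hC, hphi₁⟩ := run_contact (w := w) hb hid hlt hw (by omega) hF
  have hcl₁ := hs₁.clusterOf
  obtain ⟨β₂, r2, hs₂, hct₂, hphi₂, rk, hrk⟩ := run_sibling (P := P) (w := w) hb hid hw
    (hs₁.forest hF)
  have hcl₂ := hs₂.clusterOf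
  rw [hcl₁] at hcl₂ hrk
  have hC₂ : Contacts P (clusterOf β₂) (contactOf β₂) := by rw [hcl₂, hct₂]; exact hC
  obtain ⟨β₃, φ₃, r3, hs₃, hct₃, hsib₃, hphi₃, hφ₃, hprop₃⟩ := run_cvIter (w := w) (we := b + w)
    (φ := fun c => c) (ℓ := b) hb hid (hs₂.forest (hs₁.forest hF)) hC₂
    (by
      intro v c hc
      rw [hphi₂ v]
      rw [hcl₂] at hc
      exact hphi₁ v c hc)
    (by
      intro v c hc
      rw [hcl₂] at hc
      exact hF.cl_lt hlt hc) hb (by omega) hwb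
    (by
      intro v y c d ht hc hd
      obtain ⟨y', c', d', ht', h⟩ := hC₂.exists_target (ne_none_of_target ht)
      rw [ht] at ht'
      obtain rfl : y = y' := by simpa using ht'
      obtain rfl : c = c' := by have := hc.symm.trans h.2.1; simpa using this
      obtain rfl : d = d' := by have := hd.symm.trans h.2.2.1; simpa using this
      exact h.2.2.2)
  have hcl₃ := hs₃.clusterOf
  rw [hcl₂] at hcl₃ hphi₃ hprop₃
  rw [hct₂] at hct₃ hprop₃
  obtain ⟨β₄, φ, r4, hs₄, hct₄, hsib₄, hphi₄, hφ₄, hprop₄⟩ := run_cvIters (P := P) (w := w) hb hid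
    T (hs₃.forest (hs₂.forest (hs₁.forest hF)))
    (by rw [hcl₃, hct₃]; exact hC) (by rw [hcl₃]; exact hphi₃) hφ₃ (nextBits_pos b) hwb
    (by rw [hcl₃, hct₃]; exact hprop₃)
  have hcl₄ := hs₄.clusterOf
  rw [hcl₃] at hcl₄ hphi₄ hprop₄
  rw [hct₃] at hct₄ hprop₄
  have hφ8 : ∀ c, φ c < 8 := fun c =>
    (hφ₄ c).trans_le (Nat.pow_le_pow_right (by norm_num) hT)
  obtain ⟨β₅, r5, hs₅, hw₅, hn₅⟩ := step_exchPhi (P := P) (idn := idn) hb (we := w)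
    (β := β₄) (φ := φ) (by rw [hcl₄]; exact hphi₄)
    (fun v c _ => (hφ8 c).trans_le (Nat.pow_le_pow_right (by norm_num) hw3 (n := 2)))
  have hcl₅ := hs₅.clusterOf
  rw [hcl₄] at hcl₅ hn₅
  have hct₅ : contactOf β₅ = contactOf β₁ := by
    rw [← hct₄]; exact funext fun v => (hw₅ v).1
  have hC₅ : Contacts P (clusterOf β₅) (contactOf β₅) := by rw [hcl₅, hct₅]; exact hC
  have hsib₅ : ∀ v, (β₅ v).work.sib = (β₂ v).work.sib := fun v => by
    rw [(hw₅ v).2.1, hsib₄, hsib₃]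
  have hval : ∀ x y c d, target P (contactOf β₁) x = some y → clusterOf β x = some c →
      clusterOf β y = some d →
      splitColor (β₅ x) ((β₅ x).work.nbr (portTo P x y) 0) =
        if (β₂ x).work.sib = 0 then if φ d < φ c then 1 else 0 else (β₂ x).work.sib - 1 := by
    intro x y c d ht hc hd
    rw [splitColor, hsib₅ x, (hw₅ x).2.2, hphi₄ x c hc, hn₅ x y d (target_adj ht) hd]
  have hsibcases : ∀ x y c d, target P (contactOf β₁) x = some y → clusterOf β x = some c →
      clusterOf β y = some d → (β₂ x).work.sib ≤ 2 := by
    intro x y c d ht hc hd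
    by_cases h : ∀ v' y', target P (contactOf β₁) v' = some y' → clusterOf β y' = some d → v' = x
    · have := hrk.sib_none x y d ht hd h
      omega
    · push Not at h
      obtain ⟨v', y', h1, h2, h3⟩ := h
      have := hrk.sib_some x y d ht hd v' y' h1 h2 h3
      omega
  have hTouch : ∀ x y, target P (contactOf β₁) x = some y →
      ∃ c d, Touch G (clusterOf β) x y c d := by
    intro x y ht
    obtain ⟨y', c, d, ht', h⟩ := hC.exists_target (ne_none_of_target ht)
    rw [ht] at ht'
    obtain rfl : y = y' := by simpa using ht'
    exact ⟨c, d, h⟩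
  have hlt5 : ∀ c, clusterSum P idn (fun _ => contactValue splitColor) β₅ c < 2 ^ w := by
    refine clusterSum_contact_lt hC₅ _ (by positivity) ?_
    intro x y ht
    rw [hct₅] at ht
    obtain ⟨c, d, h⟩ := hTouch x y ht
    rw [hval x y c d ht h.2.1 h.2.2.1]
    have h2 := hsibcases x y c d ht h.2.1 h.2.2.1
    have h3 : 2 < 2 ^ w := lt_of_lt_of_le (by norm_num) (Nat.pow_le_pow_right (n := 2) (by norm_num) hw3)
    split_ifs <;> omega
  obtain ⟨β₆, off, r6, hd6, ha6, -, -⟩ :=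
    (hs₅.forest (hs₄.forest (hs₃.forest (hs₂.forest (hs₁.forest hF))))).run_scan b hb hid (w := w)
    (f := fun _ => contactValue splitColor) hlt5
    (fun _ l tot _ => { l with work := { l.work with blue := decide (tot = 1) } })
  have hs₆ : SameNet β₅ β₆ := by
    intro v
    cases hc : (β₅ v).net.cl with
    | none => rw [hd6 v hc]; exact ⟨rfl, rfl⟩
    | some c => rw [ha6 v c hc]; exact ⟨rfl, rfl⟩
  have hex : ∀ c, HasNeighbor G (clusterOf β) c → ∃ x y d,
      target P (contactOf β₁) x = some y ∧ Touch G (clusterOf β) x y c d := by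
    rintro c ⟨v, u, d, h⟩
    obtain ⟨x, hx, hct⟩ := hC.exist _ _ _ _ h
    obtain ⟨y, c', d', ht, h'⟩ := hC.exists_target hct
    obtain rfl : c = c' := by have := hx.symm.trans h'.2.1; simpa using this
    exact ⟨x, y, d', ht, h'⟩
  -- `X c` is the contact of `c`, `Y c` the neighbor it has chosen, and `D c` the cluster of that
  -- neighbor.
  choose! X Y D hXY using hex
  have hXuniq : ∀ x y c d, target P (contactOf β₁) x = some y → Touch G (clusterOf β) x y c d →
      X c = x ∧ D c = d := by
    intro x y c d ht h
    obtain ⟨h1, h2⟩ := hXY c ⟨x, y, d, h⟩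
    have h3 : X c = x := hC.unique _ _ c h2.2.1 h.2.1 (ne_none_of_target h1) (ne_none_of_target ht)
    rw [h3, ht] at h1
    have h4 : y = Y c := by simpa using h1
    have h5 := h.2.2.1.symm.trans (h4 ▸ h2.2.2.1)
    exact ⟨h3, by simpa using h5.symm⟩
  refine ⟨β₆, fun c => decide (clusterSum P idn (fun _ => contactValue splitColor) β₅ c = 1), ?_,
    ((((hs₁.trans hs₂).trans hs₃).trans hs₄).trans hs₅).trans hs₆, ?_, D, φ, fun c => rk (X c), ?_⟩
  · rw [splitProg, run_append, run_append, run_append, run_append, r1, r2, r3, r4, finalColor,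
      run_cons, r5, r6]
  · intro v c hc
    have : (β₅ v).net.cl = some c := by rw [← hcl₅] at hc; exact hc
    rw [ha6 v c this]
  have hκ : ∀ c, HasNeighbor G (clusterOf β) c →
      clusterSum P idn (fun _ => contactValue splitColor) β₅ c =
        if (β₂ (X c)).work.sib = 0 then if φ (D c) < φ c then 1 else 0
        else (β₂ (X c)).work.sib - 1 := by
    intro c hc
    obtain ⟨h1, h2⟩ := hXY c hc
    rw [clusterSum_contact hC₅ splitColor (by rw [hcl₅]; exact h2.2.1) (by rw [hct₅]; exact h1),
      hval _ _ c (D c) h1 h2.2.1 h2.2.2.1]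
  constructor
  · intro c hc
    exact ⟨_, _, (hXY c hc).2⟩
  · intro c _
    exact hφ8 c
  · intro c hc
    obtain ⟨h1, h2⟩ := hXY c hc
    exact hprop₄ _ _ _ _ h1 h2.2.1 h2.2.2.1
  · intro c c' hc hc' hD hr
    obtain ⟨h1, h2⟩ := hXY c hc
    obtain ⟨h1', h2'⟩ := hXY c' hc'
    have h3 := hrk.inj _ _ _ _ (D c) h1 h1' h2.2.2.1 (hD ▸ h2'.2.2.1) hr
    have h4 := h2.2.1.symm.trans (h3 ▸ h2'.2.1)
    simpa using h4
  · intro c hc r hr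
    obtain ⟨h1, h2⟩ := hXY c hc
    obtain ⟨v', y', h3, h4, h5⟩ := hrk.down _ _ _ h1 h2.2.2.1 r hr
    obtain ⟨c', d', h6⟩ := hTouch v' y' h3
    obtain ⟨h7, h8⟩ := hXuniq v' y' c' d' h3 h6
    refine ⟨c', ⟨v', y', d', h6⟩, ?_, by rw [h7, h5]⟩
    have h9 := h6.2.2.1.symm.trans h4
    rw [h8]
    simpa using h9
  · intro c c' hc hc' hne hD
    obtain ⟨h1, h2⟩ := hXY c hc
    obtain ⟨h1', h2'⟩ := hXY c' hc'
    have h3 := hrk.sib_some _ _ _ h1 h2.2.2.1 (X c') (Y c') h1' (hD ▸ h2'.2.2.1) (by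
      intro h
      have h4 := h2'.2.1.symm.trans (h ▸ h2.2.1)
      exact hne (by simpa using h4))
    rw [hκ c hc]
    simp only [h3]
    congr 1
    rw [if_neg (by omega)]
    simp
  · intro c hc hall
    obtain ⟨h1, h2⟩ := hXY c hc
    have h3 := hrk.sib_none _ _ _ h1 h2.2.2.1 (by
      intro v' y' h4 h5
      obtain ⟨c', d', h6⟩ := hTouch v' y' h4
      obtain ⟨h7, h8⟩ := hXuniq v' y' c' d' h4 h6
      have h9 := h6.2.2.1.symm.trans h5
      have h10 := hall c' ⟨v', y', d', h6⟩ (by rw [h8]; simpa using h9)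
      rw [← h7, h10])
    rw [hκ c hc]
    simp only [h3, if_true]
    split_ifs with h <;> simp [h]

end Split

end NetDecomp

namespace NetDecomp

/-! ### Growing the blue clusters -/

/-- The cluster, color and tree position are exchanged, and red nodes choose a blue neighbor. -/
def mayJoin (e : Env) (m : ℕ → ℕ → ℕ) (p : ℕ) : Prop := p < e.deg ∧ m p 0 ≠ 0 ∧ m p 1 = 1

/-- What a node tells its neighbors about its cluster. -/
def growMessage (l : Loc) (j : ℕ) : ℕ :=
  if j = 0 then clCode l
  else if j = 1 then if l.work.blue then 1 else 0
  else l.net.ids.idxOf (l.net.cl.getD 0)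

open Classical in
/-- Red nodes with a blue neighbor choose one. -/
noncomputable def exchGrow (b w : ℕ) : Op (Loc × Regs) :=
  exch b 3 (b + w) (fun _ l _ j => growMessage l j) fun e l m =>
    { l with work := { l.work with
      nbr := m
      prop := if h : (l.net.cl ≠ none ∧ l.work.blue = false) ∧ ∃ p, mayJoin e m p then
        some (Nat.find h.2) else none } }

/-- Red nodes propose to join. -/
def exchProposal (b : ℕ) : Op (Loc × Regs) :=
  exch b 1 1 (fun _ l p _ => if l.work.prop = some p then 1 else 0) fun _ l m =>
    { l with work := { l.work with tok := fun p => decide (m p 0 = 1) } }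

/-- The size of a cluster. -/
def scanSize (b L w R : ℕ) : List (Op (Loc × Regs)) :=
  scan b L w R (fun _ _ => 1) fun _ l tot _ => { l with work := { l.work with size := tot } }

/-- A cluster accepts the proposals if there are sufficiently many of them. -/
def scanProposals (b L w R K : ℕ) : List (Op (Loc × Regs)) :=
  scan b L w R (fun e l => Nat.count (fun p => l.work.tok p = true) e.deg) fun _ l tot _ =>
    { l with work := { l.work with accept := decide (l.work.size ≤ K * tot) } }

/-- Joining cluster `d` through port `p`, where `j` is the position of `d` in the list of the
neighbor there. -/
def joinNet (ν : Net) (d p j : ℕ) : Net :=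
  if d ∈ ν.ids then { ν with cl := some d }
  else ⟨some d, ν.ids ++ [d], Function.update ν.par d (some (p, j))⟩

/-- A proposing node joins or dies. -/
def exchDecision (b : ℕ) : Op (Loc × Regs) :=
  exch b 1 1 (fun _ l _ _ => if l.work.accept then 1 else 0) fun _ l m =>
    match l.work.prop with
    | none => l
    | some p =>
      if m p 0 = 1 then
        { l with
          net := joinNet l.net (l.work.nbr p 0 - 1) p (l.work.nbr p 2)
          work := { l.work with blue := true } }
      else { l with net := { l.net with cl := none } }

/-- One step of growth. -/
noncomputable def growProg (b L w R K : ℕ) : List (Op (Loc × Regs)) :=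
  exchGrow b w :: exchProposal b ::
    (scanSize b L w R ++ (scanProposals b L w R K ++ [exchDecision b]))

section Grow

variable {V : Type*} {G : SimpleGraph V} {P : PortNumbering G} {idn : V → ℕ} {b : ℕ}

theorem Forest.mono {R R' L L' : ℕ} {ν : V → Net} (hF : Forest P idn R L ν) (hR : R ≤ R')
    (hL : L ≤ L') : Forest P idn R' L' ν where
  length_le v := (hF.length_le v).trans hL
  nodup := hF.nodup
  root := hF.root
  edge := hF.edge
  depth := by
    obtain ⟨dep, h⟩ := hF.depth
    exact ⟨dep, fun v c hc => ⟨(h v c hc).1.trans hR, (h v c hc).2⟩⟩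
  member := hF.member

theorem parOf_congr {ν ν' : V → Net} {c : ℕ} {v : V} (h1 : c ∈ (ν v).ids) (h2 : c ∈ (ν' v).ids)
    (h : (ν' v).par c = (ν v).par c) : parOf P ν' c v = parOf P ν c v := by
  simp only [parOf, h1, h2, if_true, h]

/-- Growing keeps the trees well-formed. -/
theorem Forest.grow {D M : ℕ} {ν ν' : V → Net} (hF : Forest P idn D M ν)
    (h : ∀ v, ν' v = ν v ∨ ν' v = { ν v with cl := none } ∨
      ∃ u d, G.Adj v u ∧ (ν u).cl = some d ∧ (ν v).ids.length < M ∧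
        ν' v = joinNet (ν v) d (portTo P v u) ((ν u).ids.idxOf d)) :
    Forest P idn (D + 1) M ν' := by
  classical
  -- Lists are only extended at the end, so positions stored by children in earlier steps remain
  -- valid.
  have hpre : ∀ v, (ν v).ids <+: (ν' v).ids := by
    intro v
    rcases h v with h | h | ⟨u, d, -, -, -, h⟩ <;> rw [h]
    unfold joinNet
    split_ifs
    · exact List.prefix_refl _
    · exact List.prefix_append _ _
  have hmem : ∀ v c, c ∈ (ν v).ids → c ∈ (ν' v).ids := fun v c hc => (hpre v).subset hc
  have hpar : ∀ v c, c ∈ (ν v).ids → (ν' v).par c = (ν v).par c := by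
    intro v c hc
    rcases h v with h | h | ⟨u, d, -, -, -, h⟩ <;> rw [h]
    unfold joinNet
    split_ifs with hd
    · rfl
    · have : c ≠ d := fun h' => hd (h' ▸ hc)
      simp [Function.update_of_ne this]
  have hget : ∀ (v : V) (j c : ℕ), (ν v).ids[j]? = some c → (ν' v).ids[j]? = some c := by
    intro v j c hj
    obtain ⟨t, ht⟩ := hpre v
    rw [← ht]
    rw [List.getElem?_append_left]
    · exact hj
    · exact (List.getElem?_eq_some_iff.1 hj).1
  have hnew : ∀ v c, c ∈ (ν' v).ids → c ∉ (ν v).ids → ∃ u, G.Adj v u ∧ c ∈ (ν u).ids ∧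
      (ν' v).par c = some (portTo P v u, (ν u).ids.idxOf c) := by
    intro v c hc hc'
    rcases h v with h | h | ⟨u, d, hadj, hu, -, h⟩
    · rw [h] at hc; exact absurd hc hc'
    · rw [h] at hc; exact absurd hc hc'
    · rw [h] at hc ⊢
      unfold joinNet at hc ⊢
      split_ifs at hc ⊢ with hd
      · exact absurd hc hc'
      · have : c = d := by
          simp only [List.mem_append, List.mem_singleton] at hc
          tauto
        subst this
        exact ⟨u, hadj, hF.member u c hu, by simp⟩
  refine ⟨?_, ?_, ?_, ?_, ?_, ?_⟩
  · intro v
    rcases h v with h | h | ⟨u, d, -, -, hlen, h⟩ <;> rw [h]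
    · exact hF.length_le v
    · exact hF.length_le v
    · unfold joinNet
      split_ifs
      · exact hF.length_le v
      · simp only [List.length_append, List.length_singleton]
        omega
  · intro v
    rcases h v with h | h | ⟨u, d, -, -, -, h⟩ <;> rw [h]
    · exact hF.nodup v
    · exact hF.nodup v
    · unfold joinNet
      split_ifs with hd
      · exact hF.nodup v
      · exact List.nodup_append.2 ⟨hF.nodup v, by simp, by
          intro a ha b' hb'
          simp only [List.mem_singleton] at hb'
          rintro rfl
          exact hd (hb' ▸ ha)⟩
  · intro v c hc hnone
    by_cases hcv : c ∈ (ν v).ids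
    · rw [hpar v c hcv] at hnone
      exact hF.root v c hcv hnone
    · obtain ⟨u, -, -, hu⟩ := hnew v c hc hcv
      rw [hu] at hnone
      simp at hnone
  · intro v c hc p j hpj
    by_cases hcv : c ∈ (ν v).ids
    · rw [hpar v c hcv] at hpj
      obtain ⟨hp, hj⟩ := hF.edge v c hcv p j hpj
      exact ⟨hp, hget _ _ _ hj⟩
    · obtain ⟨u, hadj, hu, hpu⟩ := hnew v c hc hcv
      rw [hpu] at hpj
      simp only [Option.some.injEq, Prod.mk.injEq] at hpj
      obtain ⟨rfl, rfl⟩ := hpj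
      refine ⟨portTo_lt P hadj, ?_⟩
      rw [nbr_portTo P hadj]
      exact hget _ _ _ (List.getElem?_idxOf hu)
  · obtain ⟨dep, hdep⟩ := hF.depth
    -- A new tree node hangs below a node that was in the tree before this step, hence of depth at
    -- most `D`. A node that returns to a tree it was in keeps its old parent, so no cycle can
    -- arise.
    refine ⟨fun v c => if c ∈ (ν v).ids then dep v c else D + 1, ?_⟩
    intro v c hc
    by_cases hcv : c ∈ (ν v).ids
    · simp only [hcv, if_true]
      refine ⟨by have := (hdep v c hcv).1; omega, ?_⟩
      intro u hu
      rw [parOf_congr hcv hc (hpar v c hcv)] at hu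
      rw [if_pos (hF.parOf_mem_parent hu)]
      exact (hdep v c hcv).2 u hu
    · simp only [hcv, if_false]
      refine ⟨le_rfl, ?_⟩
      intro u hu
      obtain ⟨u', hadj, hu', hpu⟩ := hnew v c hc hcv
      have : parOf P ν' c v = some u' := by
        have hlt := portTo_lt P hadj
        simp only [parOf, hc, if_true, hpu, hlt, dif_pos]
        rw [nbr_portTo P hadj]
      rw [this] at hu
      obtain rfl : u' = u := by simpa using hu
      rw [if_pos hu']
      have := (hdep u' c hu').1
      omega
  · intro v c hc
    rcases h v with h | h | ⟨u, d, -, -, -, h⟩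
    · rw [h] at hc ⊢; exact hF.member v c hc
    · rw [h] at hc; simp at hc
    · rw [h] at hc ⊢
      unfold joinNet at hc ⊢
      split_ifs at hc ⊢ with hd
      · simp only [Option.some.injEq] at hc
        exact hc ▸ hd
      · simp only [Option.some.injEq] at hc
        simp [hc]

variable [Fintype V] {R L w : ℕ}

open Classical in
/-- The number of nodes of a cluster. -/
noncomputable def clusterCard (cl : V → Option ℕ) (c : ℕ) : ℕ :=
  (Finset.univ.filter fun v => cl v = some c).card

open Classical in
/-- The number of proposals to a cluster. -/
noncomputable def proposals (cl : V → Option ℕ) (pr : V → Option V) (c : ℕ) : ℕ :=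
  (Finset.univ.filter fun v => ∃ u, pr v = some u ∧ cl u = some c).card

/-- `pr` lets every red node with a blue neighbor choose one. -/
structure Proposes (G : SimpleGraph V) (cl : V → Option ℕ) (κ : ℕ → Bool) (pr : V → Option V) :
    Prop where
  sound : ∀ v u, pr v = some u → G.Adj v u ∧ (∃ c, cl v = some c ∧ κ c = false) ∧
    ∃ d, cl u = some d ∧ κ d = true
  complete : ∀ v u c d, G.Adj v u → cl v = some c → κ c = false → cl u = some d → κ d = true →
    pr v ≠ none

/-- A step of growth, as far as clusters and trees are concerned. -/
structure Grows (P : PortNumbering G) (κ : ℕ → Bool) (K : ℕ) (ν ν' : V → Net)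
    (pr : V → Option V) : Prop where
  proposes : Proposes G (fun v => (ν v).cl) κ pr
  idle : ∀ v, pr v = none → ν' v = ν v
  join : ∀ v u d, pr v = some u → (ν u).cl = some d →
    clusterCard (fun v => (ν v).cl) d ≤ K * proposals (fun v => (ν v).cl) pr d →
    ν' v = joinNet (ν v) d (portTo P v u) ((ν u).ids.idxOf d)
  die : ∀ v u d, pr v = some u → (ν u).cl = some d →
    ¬ clusterCard (fun v => (ν v).cl) d ≤ K * proposals (fun v => (ν v).cl) pr d →
    ν' v = { ν v with cl := none }

/-- A red node marks only one neighbor, so counting the marks that arrive in a cluster counts its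
proposers. The position used for joining was sent at the beginning; it is still correct since no
list changes before the decision. -/
theorem run_grow (hb : 0 < b) (hid : Function.Injective idn) (hlt : ∀ v, idn v < 2 ^ b)
    (hw : Fintype.card V < 2 ^ w) (hw1 : 1 ≤ w) (hLw : L < 2 ^ w) {K : ℕ} {β : V → Loc}
    {κ : ℕ → Bool} (hF : Forest P idn R L fun v => (β v).net)
    (hκ : ∀ v c, (β v).net.cl = some c → (β v).work.blue = κ c) :
    ∃ β' pr, run P idn b (growProg b L w R K) (clearRegs β) = clearRegs β' ∧
      (∀ v, (β' v).out = (β v).out) ∧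
      (∀ v c, (β' v).net.cl = some c → (β' v).work.blue = κ c) ∧
      Grows P κ K (fun v => (β v).net) (fun v => (β' v).net) pr := by
  classical
  rw [growProg, run_cons, exchGrow, step_exch P idn b hb]
  set m : V → ℕ → ℕ → ℕ := fetch P idn 3 (b + w) (fun _ l _ j => growMessage l j) β with hm
  have hbw : 2 ^ w ≤ 2 ^ (b + w) := Nat.pow_le_pow_right (by norm_num) (by omega)
  have hcode : ∀ u, clCode (β u) < 2 ^ (b + w) := by
    intro u
    unfold clCode
    split
    · positivity
    · rename_i c hc
      have h1 := hF.cl_lt hlt hc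
      calc c + 1 ≤ 2 ^ b := h1
        _ < 2 ^ (b + w) := Nat.pow_lt_pow_right (by norm_num) (by omega)
  have hm0 : ∀ v u, G.Adj v u → m v (portTo P v u) 0 = clCode (β u) := by
    intro v u hadj
    rw [hm, fetch_of_atPort idn (atPort_portTo hadj) (by norm_num)]
    · simp [growMessage]
    · simpa [growMessage] using hcode u
  have h1w : 1 < 2 ^ (b + w) := Nat.one_lt_two_pow (by omega)
  have hm1 : ∀ v u, G.Adj v u → m v (portTo P v u) 1 = if (β u).work.blue then 1 else 0 := by
    intro v u hadj
    rw [hm, fetch_of_atPort idn (atPort_portTo hadj) (by norm_num)]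
    · simp [growMessage]
    · simp only [growMessage, one_ne_zero, if_false, if_true]
      split_ifs <;> omega
  have hm2 : ∀ v u d, G.Adj v u → (β u).net.cl = some d →
      m v (portTo P v u) 2 = (β u).net.ids.idxOf d := by
    intro v u d hadj hd
    rw [hm, fetch_of_atPort idn (atPort_portTo hadj) (by norm_num)]
    · simp [growMessage, hd]
    · simp only [growMessage, hd]
      have h1 : (β u).net.ids.idxOf d < (β u).net.ids.length :=
        List.idxOf_lt_length_of_mem (hF.member u d hd)
      have h2 := hF.length_le u
      simp
      omega
  obtain ⟨β₁, hβ₁⟩ : ∃ β₁ : V → Loc, β₁ = fun v => { β v with work := { (β v).work with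
      nbr := m v
      prop := if h : ((β v).net.cl ≠ none ∧ (β v).work.blue = false) ∧
        ∃ p, mayJoin (envOf P idn v) (m v) p then some (Nat.find h.2) else none } } := ⟨_, rfl⟩
  rw [← hβ₁]
  have hnet₁ : ∀ v, (β₁ v).net = (β v).net ∧ (β₁ v).out = (β v).out ∧
      (β₁ v).work.blue = (β v).work.blue ∧ (β₁ v).work.nbr = m v := by
    intro v; rw [hβ₁]; exact ⟨rfl, rfl, rfl, rfl⟩
  have hprop₁ : ∀ v, (β₁ v).work.prop =
      if h : ((β v).net.cl ≠ none ∧ (β v).work.blue = false) ∧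
        ∃ p, mayJoin (envOf P idn v) (m v) p then some (Nat.find h.2) else none := by
    intro v; rw [hβ₁]
  set mk : V → Option ℕ := fun v => (β₁ v).work.prop with hmk
  set pr : V → Option V := target P mk with hpr
  have hmay : ∀ v p, mayJoin (envOf P idn v) (m v) p ↔
      ∃ u d, atPort P v p = some u ∧ (β u).net.cl = some d ∧ κ d = true := by
    intro v p
    constructor
    · rintro ⟨h1, h2, h3⟩
      obtain ⟨u, hu⟩ := exists_atPort (P := P) h1
      have hadj := atPort_adj hu
      rw [atPort_eq hu] at h2 h3
      rw [hm0 v u hadj] at h2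
      rw [hm1 v u hadj] at h3
      cases hc : (β u).net.cl with
      | none => simp [clCode, hc] at h2
      | some d =>
        refine ⟨u, d, hu, hc, ?_⟩
        rw [← hκ u d hc]
        by_contra hne
        simp [hne] at h3
    · rintro ⟨u, d, hu, hd, hκd⟩
      have hadj := atPort_adj hu
      refine ⟨atPort_lt hu, ?_, ?_⟩
      · rw [atPort_eq hu, hm0 v u hadj]
        simp [clCode, hd]
      · rw [atPort_eq hu, hm1 v u hadj, hκ u d hd, hκd]
        simp
  have hP : Proposes G (fun v => (β v).net.cl) κ pr := by
    constructor
    · intro v u h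
      refine ⟨target_adj h, ?_⟩
      obtain ⟨p, hp, hpu⟩ := Option.bind_eq_some_iff.1 h
      rw [hmk] at hp
      simp only [hprop₁] at hp
      split_ifs at hp with hh
      simp only [Option.some.injEq] at hp
      constructor
      · obtain ⟨c, hc⟩ := Option.ne_none_iff_exists'.1 hh.1.1
        exact ⟨c, hc, by rw [← hκ v c hc]; exact hh.1.2⟩
      · obtain ⟨u', d, hu', hd, hκd⟩ := (hmay v _).1 (Nat.find_spec hh.2)
        rw [hp, hpu] at hu'
        obtain rfl : u = u' := by simpa using hu'
        exact ⟨d, hd, hκd⟩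
    · intro v u c d hadj hc hκc hd hκd hnone
      have hh : ((β v).net.cl ≠ none ∧ (β v).work.blue = false) ∧
          ∃ p, mayJoin (envOf P idn v) (m v) p :=
        ⟨⟨by rw [hc]; simp, by rw [hκ v c hc]; exact hκc⟩,
          portTo P v u, (hmay v _).2 ⟨u, d, atPort_portTo hadj, hd, hκd⟩⟩
      have h1 : mk v = some (Nat.find hh.2) := by rw [hmk]; simp only [hprop₁, dif_pos hh]
      obtain ⟨u', d', hu', -⟩ := (hmay v _).1 (Nat.find_spec hh.2)
      rw [hpr, target, h1, Option.bind_some, hu'] at hnone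
      simp at hnone
  rw [run_cons, exchProposal, step_exch P idn b hb]
  obtain ⟨β₂, hβ₂⟩ : ∃ β₂ : V → Loc, β₂ = fun v => { β₁ v with work := { (β₁ v).work with
      tok := fun p => decide (fetch P idn 1 1
        (fun _ l p _ => if l.work.prop = some p then 1 else 0) β₁ v p 0 = 1) } } := ⟨_, rfl⟩
  rw [← hβ₂]
  have htok : ∀ y p, (β₂ y).work.tok p = true ↔
      ∃ u, atPort P y p = some u ∧ target P mk u = some y := by
    intro y p
    rw [← marks_of_fetch (idn := idn) (β := β₁) (mk := mk)
      (send := fun _ l p _ => if l.work.prop = some p then 1 else 0) (fun u p => rfl) y p]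
    simp [hβ₂]
  have hnet₂ : ∀ v, (β₂ v).net = (β v).net ∧ (β₂ v).out = (β v).out ∧
      (β₂ v).work.blue = (β v).work.blue ∧ (β₂ v).work.nbr = m v ∧ (β₂ v).work.prop = mk v := by
    intro v
    obtain ⟨h1, h2, h3, h4⟩ := hnet₁ v
    rw [hβ₂]
    exact ⟨h1, h2, h3, h4, rfl⟩
  have hF₂ : Forest P idn R L fun v => (β₂ v).net := by
    have : (fun v => (β₂ v).net) = fun v => (β v).net := funext fun v => (hnet₂ v).1
    rwa [this]
  obtain ⟨β₃, -, r3, hd₃, ha₃, -, -⟩ := hF₂.run_scan b hb hid (w := w) (f := fun _ _ => 1)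
    (fun c => lt_of_le_of_lt (clusterSum_le_card (fun v => le_rfl) c) hw)
    (fun _ l tot _ => { l with work := { l.work with size := tot } })
  have hsize : ∀ c, clusterSum P idn (fun _ _ => 1) β₂ c =
      clusterCard (fun v => (β v).net.cl) c := by
    intro c
    rw [clusterSum, clusterCard, Finset.card_filter]
    refine Finset.sum_congr rfl fun v _ => ?_
    rw [own, (hnet₂ v).1]
  have hnet₃ : ∀ v, (β₃ v).net = (β v).net ∧ (β₃ v).out = (β v).out ∧
      (β₃ v).work.blue = (β v).work.blue ∧ (β₃ v).work.nbr = m v ∧ (β₃ v).work.prop = mk v ∧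
      (β₃ v).work.tok = (β₂ v).work.tok := by
    intro v
    obtain ⟨h1, h2, h3, h4, h5⟩ := hnet₂ v
    cases hc : (β₂ v).net.cl with
    | none => rw [hd₃ v hc]; exact ⟨h1, h2, h3, h4, h5, rfl⟩
    | some c => rw [ha₃ v c hc]; exact ⟨h1, h2, h3, h4, h5, rfl⟩
  have hF₃ : Forest P idn R L fun v => (β₃ v).net := by
    have : (fun v => (β₃ v).net) = fun v => (β v).net := funext fun v => (hnet₃ v).1
    rwa [this]
  have hprops : ∀ c, clusterSum P idn (fun e l => Nat.count (fun p => l.work.tok p = true) e.deg)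
      β₃ c = proposals (fun v => (β v).net.cl) pr c := by
    intro c
    rw [clusterSum_marks (mk := mk) idn _ (fun y => rfl)
      (fun y p => by rw [(hnet₃ y).2.2.2.2.2]; exact htok y p) c]
    unfold proposals
    congr 1
    ext u
    simp only [(hnet₃ _).1, hpr]
  obtain ⟨β₄, -, r4, hd₄, ha₄, -, -⟩ := hF₃.run_scan b hb hid (w := w)
    (f := fun e l => Nat.count (fun p => l.work.tok p = true) e.deg)
    (fun c => by
      rw [hprops c]
      exact lt_of_le_of_lt (Finset.card_le_univ _) hw)
    (fun _ l tot _ => { l with work := { l.work with accept := decide (l.work.size ≤ K * tot) } })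
  have hnet₄ : ∀ v, (β₄ v).net = (β v).net ∧ (β₄ v).out = (β v).out ∧
      (β₄ v).work.blue = (β v).work.blue ∧ (β₄ v).work.nbr = m v ∧ (β₄ v).work.prop = mk v := by
    intro v
    obtain ⟨h1, h2, h3, h4, h5, -⟩ := hnet₃ v
    cases hc : (β₃ v).net.cl with
    | none => rw [hd₄ v hc]; exact ⟨h1, h2, h3, h4, h5⟩
    | some c => rw [ha₄ v c hc]; exact ⟨h1, h2, h3, h4, h5⟩
  have hacc : ∀ u d, (β u).net.cl = some d → (β₄ u).work.accept =
      decide (clusterCard (fun v => (β v).net.cl) d ≤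
        K * proposals (fun v => (β v).net.cl) pr d) := by
    intro u d hd
    have h2 : (β₂ u).net.cl = some d := by rw [(hnet₂ u).1]; exact hd
    have h3 : (β₃ u).net.cl = some d := by rw [(hnet₃ u).1]; exact hd
    rw [ha₄ u d h3]
    have h5 : (β₃ u).work.size = clusterSum P idn (fun _ _ => 1) β₂ d := by rw [ha₃ u d h2]
    simp only [h5, hsize, hprops]
  rw [run_append, scanSize, r3, run_append, scanProposals, r4, run_cons, run_nil, exchDecision,
    step_exch P idn b hb]
  refine ⟨_, pr, rfl, ?_, ?_, ?_⟩
  · intro v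
    dsimp only
    split
    · exact (hnet₄ v).2.1
    · split_ifs <;> exact (hnet₄ v).2.1
  all_goals
    have hmsg : ∀ v u, G.Adj v u → fetch P idn 1 1 (fun _ l _ _ => if l.work.accept then 1 else 0)
        β₄ v (portTo P v u) 0 = if (β₄ u).work.accept then 1 else 0 := by
      intro v u hadj
      rw [fetch_of_atPort idn (atPort_portTo hadj) (by norm_num)]
      split_ifs <;> norm_num
    have hmkpr : ∀ v p, mk v = some p → ∃ u, pr v = some u ∧ p = portTo P v u := by
      intro v p hp
      have hp' := hp
      rw [hmk] at hp'
      simp only [hprop₁] at hp'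
      split_ifs at hp' with hh
      simp only [Option.some.injEq] at hp'
      obtain ⟨u, d, hu, -⟩ := (hmay v _).1 (Nat.find_spec hh.2)
      rw [hp'] at hu
      exact ⟨u, by rw [hpr, target, hp, Option.bind_some, hu], atPort_eq hu⟩
  · intro v c
    dsimp only
    cases hp : (β₄ v).work.prop with
    | none =>
      simp only
      rw [(hnet₄ v).1, (hnet₄ v).2.2.1]
      exact hκ v c
    | some p =>
      simp only
      split_ifs with hacc1
      · intro hc
        rw [(hnet₄ v).2.2.2.2] at hp
        obtain ⟨u, hu, rfl⟩ := hmkpr v p hp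
        obtain ⟨hadj, -, d, hd, hκd⟩ := hP.sound v u hu
        simp only
        have hd' : (β u).net.cl = some d := hd
        rw [(hnet₄ v).2.2.2.1, hm0 v u hadj] at hc
        have : clCode (β u) - 1 = d := by simp [clCode, hd']
        rw [this] at hc
        unfold joinNet at hc
        split_ifs at hc <;> simp only [Option.some.injEq] at hc <;> rw [← hc, hκd]
      · simp
  · refine ⟨hP, ?_, ?_, ?_⟩
    · intro v hv
      have hmkv : mk v = none := by
        cases h : mk v with
        | none => rfl
        | some p =>
          obtain ⟨u, hu, -⟩ := hmkpr v p h
          rw [hu] at hv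
          simp at hv
      have := (hnet₄ v).2.2.2.2
      rw [hmkv] at this
      simp only [this]
      exact (hnet₄ v).1
    · intro v u d hu hd hle
      have hadj := target_adj hu
      have hmkv := (target_eq_iff hadj).1 hu
      have := (hnet₄ v).2.2.2.2
      rw [hmkv] at this
      have hfe := hmsg v u hadj
      rw [hacc u d hd] at hfe
      simp only [hle, decide_true, if_true] at hfe
      simp only [this, hfe, if_true]
      rw [(hnet₄ v).1, (hnet₄ v).2.2.2.1, hm0 v u hadj, hm2 v u d hadj hd]
      simp [clCode, hd]
    · intro v u d hu hd hle
      have hadj := target_adj hu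
      have hmkv := (target_eq_iff hadj).1 hu
      have := (hnet₄ v).2.2.2.2
      rw [hmkv] at this
      have hfe := hmsg v u hadj
      rw [hacc u d hd] at hfe
      simp only [hle, decide_false, Bool.false_eq_true, if_false] at hfe
      simp only [this, hfe]
      rw [(hnet₄ v).1]
      simp

end Grow

end NetDecomp

namespace NetDecomp

/-! ### Analysis of the growth -/

section Growth

variable {V : Type*} {G : SimpleGraph V} {P : PortNumbering G} {κ : ℕ → Bool} {K : ℕ}

/-- The blue cluster `c` has no red neighbors. -/
def Stalled (G : SimpleGraph V) (κ : ℕ → Bool) (cl : V → Option ℕ) (c : ℕ) : Prop :=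
  κ c = true ∧ ∀ v u e, G.Adj v u → cl v = some c → cl u = some e → κ e = true

variable [Fintype V] {ν ν' : V → Net} {pr : V → Option V}

/-- The cluster `c` accepts the proposals. -/
def Accepts (K : ℕ) (cl : V → Option ℕ) (pr : V → Option V) (c : ℕ) : Prop :=
  clusterCard cl c ≤ K * proposals cl pr c

theorem joinNet_cl (ν : Net) (d p j : ℕ) : (joinNet ν d p j).cl = some d := by
  unfold joinNet
  split_ifs <;> rfl

theorem Grows.cl_join (h : Grows P κ K ν ν' pr) {v u : V} {d : ℕ} (hv : pr v = some u)
    (hd : (ν u).cl = some d) (ha : Accepts K (fun v => (ν v).cl) pr d) :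
    (ν' v).cl = some d := by
  rw [h.join v u d hv hd ha, joinNet_cl]

theorem Grows.cl_die (h : Grows P κ K ν ν' pr) {v u : V} {d : ℕ} (hv : pr v = some u)
    (hd : (ν u).cl = some d) (ha : ¬ Accepts K (fun v => (ν v).cl) pr d) :
    (ν' v).cl = none := by
  rw [h.die v u d hv hd ha]

/-- Proposals go to blue clusters only, so red clusters never gain nodes, and a node still red has
not proposed. -/
theorem Grows.red (h : Grows P κ K ν ν' pr) {v : V} {c : ℕ} (hc : (ν' v).cl = some c)
    (hκ : κ c = false) : (ν v).cl = some c ∧ pr v = none := by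
  cases hv : pr v with
  | none => rw [h.idle v hv] at hc; exact ⟨hc, rfl⟩
  | some u =>
    obtain ⟨-, -, d, hd, hκd⟩ := h.proposes.sound v u hv
    by_cases ha : Accepts K (fun v => (ν v).cl) pr d
    · rw [h.cl_join hv hd ha] at hc
      simp only [Option.some.injEq] at hc
      rw [hc, hκ] at hκd
      simp at hκd
    · rw [h.cl_die hv hd ha] at hc
      simp at hc

theorem Grows.blue (h : Grows P κ K ν ν' pr) {v : V} {c : ℕ} (hc : (ν v).cl = some c)
    (hκ : κ c = true) : (ν' v).cl = some c := by
  cases hv : pr v with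
  | none => rw [h.idle v hv]; exact hc
  | some u =>
    obtain ⟨-, ⟨c', hc', hκ'⟩, -⟩ := h.proposes.sound v u hv
    have : c = c' := by have := hc.symm.trans hc'; simpa using this
    rw [← this, hκ] at hκ'
    simp at hκ'

theorem Grows.blue_cases (h : Grows P κ K ν ν' pr) {v : V} {c : ℕ} (hc : (ν' v).cl = some c) :
    (ν v).cl = some c ∨
      ∃ u, pr v = some u ∧ (ν u).cl = some c ∧ Accepts K (fun v => (ν v).cl) pr c := by
  cases hv : pr v with
  | none => rw [h.idle v hv] at hc; exact Or.inl hc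
  | some u =>
    obtain ⟨-, -, d, hd, -⟩ := h.proposes.sound v u hv
    by_cases ha : Accepts K (fun v => (ν v).cl) pr d
    · rw [h.cl_join hv hd ha] at hc
      simp only [Option.some.injEq] at hc
      subst hc
      exact Or.inr ⟨u, rfl, hd, ha⟩
    · rw [h.cl_die hv hd ha] at hc
      simp at hc

theorem Grows.alive (h : Grows P κ K ν ν' pr) {v : V} (hv : (ν' v).cl ≠ none) :
    (ν v).cl ≠ none := by
  obtain ⟨c, hc⟩ := Option.ne_none_iff_exists'.1 hv
  rcases h.blue_cases hc with h' | ⟨u, hu, -⟩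
  · rw [h']; simp
  · obtain ⟨-, ⟨c', hc', -⟩, -⟩ := h.proposes.sound v u hu
    have hc'' : (ν v).cl = some c' := hc'
    rw [hc'']; simp

/-- A cluster that does not accept has no red neighbors afterwards. -/
theorem Grows.stalled_of_not_accepts (h : Grows P κ K ν ν' pr) {c : ℕ} (hκ : κ c = true)
    (ha : ¬ Accepts K (fun v => (ν v).cl) pr c) : Stalled G κ (fun v => (ν' v).cl) c := by
  refine ⟨hκ, fun v u e hadj hv hu => ?_⟩
  by_contra hne
  have hne' : κ e = false := by simpa using hne
  obtain ⟨h1, h2⟩ := h.red hu hne'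
  rcases h.blue_cases hv with h3 | ⟨-, -, -, h3⟩
  · exact h.proposes.complete u v e c hadj.symm h1 hne' h3 hκ h2
  · exact ha h3

theorem Grows.no_proposal (h : Grows P κ K ν ν' pr) {c : ℕ}
    (hs : Stalled G κ (fun v => (ν v).cl) c) {v u : V} (hv : pr v = some u) :
    (ν u).cl ≠ some c := by
  intro hu
  obtain ⟨hadj, ⟨c', hc', hκ'⟩, -⟩ := h.proposes.sound v u hv
  have := hs.2 u v c' hadj.symm hu hc'
  rw [this] at hκ'
  simp at hκ'

/-- A stalled cluster gets no proposals, hence no new nodes, and no node turns red. -/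
theorem Grows.stalled (h : Grows P κ K ν ν' pr) {c : ℕ}
    (hs : Stalled G κ (fun v => (ν v).cl) c) : Stalled G κ (fun v => (ν' v).cl) c := by
  refine ⟨hs.1, fun v u e hadj hv hu => ?_⟩
  by_contra hne
  have hne' : κ e = false := by simpa using hne
  obtain ⟨h1, h2⟩ := h.red hu hne'
  rcases h.blue_cases hv with h3 | ⟨x, hx, hx', -⟩
  · exact hne (hs.2 v u e hadj h3 h1)
  · exact h.no_proposal hs hx hx'

theorem Grows.card_accept (h : Grows P κ K ν ν' pr) {c : ℕ} (hκ : κ c = true)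
    (ha : Accepts K (fun v => (ν v).cl) pr c) :
    clusterCard (fun v => (ν' v).cl) c =
      clusterCard (fun v => (ν v).cl) c + proposals (fun v => (ν v).cl) pr c := by
  classical
  unfold clusterCard proposals
  rw [← Finset.card_union_of_disjoint]
  · congr 1
    ext v
    simp only [Finset.mem_filter, Finset.mem_univ, true_and, Finset.mem_union]
    constructor
    · intro hv
      rcases h.blue_cases hv with h1 | ⟨u, h1, h2, -⟩
      · exact Or.inl h1
      · exact Or.inr ⟨u, h1, h2⟩
    · rintro (h1 | ⟨u, h1, h2⟩)
      · exact h.blue h1 hκ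
      · exact h.cl_join h1 h2 ha
  · rw [Finset.disjoint_left]
    intro v hv hv'
    simp only [Finset.mem_filter, Finset.mem_univ, true_and] at hv hv'
    obtain ⟨u, h1, -⟩ := hv'
    obtain ⟨-, ⟨c', hc', hκ'⟩, -⟩ := h.proposes.sound v u h1
    have : c = c' := by have := hv.symm.trans hc'; simpa using this
    rw [← this, hκ] at hκ'
    simp at hκ'

/-- Compare fiber by fiber. It charges the nodes that die, grouped by the cluster that refused them,
to the nodes of that cluster. -/
theorem mul_card_le_of_fibers {A B : Finset V} (f g : V → ℕ) (K : ℕ)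
    (h : ∀ a ∈ A, K * (A.filter fun x => f x = f a).card ≤ (B.filter fun x => g x = f a).card) :
    K * A.card ≤ B.card := by
  classical
  rw [Finset.card_eq_sum_card_image f A, Finset.mul_sum]
  calc ∑ d ∈ A.image f, K * (A.filter fun x => f x = d).card
      ≤ ∑ d ∈ A.image f, (B.filter fun x => g x = d).card := by
        refine Finset.sum_le_sum fun d hd => ?_
        obtain ⟨a, ha, rfl⟩ := Finset.mem_image.1 hd
        exact h a ha
    _ = ((B.filter fun x => g x ∈ A.image f)).card := by
        rw [Finset.card_eq_sum_card_fiberwise (s := B.filter fun x => g x ∈ A.image f)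
          (t := A.image f) (f := g)]
        · refine Finset.sum_congr rfl fun d hd => ?_
          congr 1
          ext x
          simp only [Finset.mem_filter]
          constructor
          · rintro ⟨h1, rfl⟩; exact ⟨⟨h1, hd⟩, rfl⟩
          · rintro ⟨⟨h1, -⟩, h2⟩; exact ⟨h1, h2⟩
        · intro x hx
          simp only [Finset.coe_filter, Set.mem_ofPred_eq] at hx
          exact hx.2
    _ ≤ B.card := Finset.card_filter_le _ _

open Classical in
/-- The alive nodes. -/
noncomputable def aliveSet (cl : V → Option ℕ) : Finset V :=
  Finset.univ.filter fun v => cl v ≠ none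

open Classical in
/-- The nodes of stalled clusters. -/
noncomputable def stalledSet (G : SimpleGraph V) (κ : ℕ → Bool) (cl : V → Option ℕ) : Finset V :=
  Finset.univ.filter fun v => ∃ c, cl v = some c ∧ Stalled G κ cl c

theorem stalledSet_subset (cl : V → Option ℕ) : stalledSet G κ cl ⊆ aliveSet cl := by
  intro v hv
  simp only [stalledSet, aliveSet, Finset.mem_filter, Finset.mem_univ, true_and] at hv ⊢
  obtain ⟨c, hc, -⟩ := hv
  rw [hc]; simp

/-- Nodes die only at the expense of clusters that become stalled. -/
theorem Grows.deaths (h : Grows P κ K ν ν' pr) :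
    K * (aliveSet fun v => (ν v).cl).card + (stalledSet G κ fun v => (ν v).cl).card ≤
      K * (aliveSet fun v => (ν' v).cl).card + (stalledSet G κ fun v => (ν' v).cl).card := by
  classical
  set cl := fun v => (ν v).cl with hcl
  set cl' := fun v => (ν' v).cl with hcl'
  let A := aliveSet cl \ aliveSet cl'
  have hsub : aliveSet cl' ⊆ aliveSet cl := by
    intro v hv
    simp only [aliveSet, Finset.mem_filter, Finset.mem_univ, true_and] at hv ⊢
    exact h.alive hv
  have hA : A.card + (aliveSet cl').card = (aliveSet cl).card :=
    Finset.card_sdiff_add_card_eq_card hsub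
  -- The nodes of the clusters that become stalled in this step. A refusing cluster has at least `K`
  -- nodes per proposer, and it pays only once, because afterwards it receives no proposals.
  let B := Finset.univ.filter fun v => ∃ c, cl v = some c ∧ κ c = true ∧ ¬ Accepts K cl pr c ∧
    ¬ Stalled G κ cl c
  have hmemA : ∀ v ∈ A, ∃ u d, pr v = some u ∧ cl u = some d ∧ ¬ Accepts K cl pr d := by
    intro v hv
    simp only [A, aliveSet, Finset.mem_sdiff, Finset.mem_filter, Finset.mem_univ, true_and,
      not_not] at hv
    cases hp : pr v with
    | none =>
      have := h.idle v hp
      exfalso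
      apply hv.1
      rw [← hv.2, hcl, hcl']
      simp only [this]
    | some u =>
      obtain ⟨-, -, d, hd, -⟩ := h.proposes.sound v u hp
      refine ⟨u, d, rfl, hd, fun ha => ?_⟩
      have := h.cl_join hp hd ha
      rw [hcl'] at hv
      simp only [this] at hv
      simp at hv
  have hKA : K * A.card ≤ B.card := by
    refine mul_card_le_of_fibers
      (fun v => match pr v with | none => 0 | some u => (cl u).getD 0) (fun v => (cl v).getD 0) K ?_
    intro a ha
    obtain ⟨u, d, hu, hd, hna⟩ := hmemA a ha
    have hfa : (match pr a with | none => 0 | some u => (cl u).getD 0) = d := by simp [hu, hd]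
    simp only [hfa]
    have h1 : K * proposals cl pr d ≤ clusterCard cl d := by
      unfold Accepts at hna; omega
    have hκd : κ d = true := by
      obtain ⟨-, -, d', hd', hκ'⟩ := h.proposes.sound a u hu
      have : d = d' := by have := hd.symm.trans hd'; simpa using this
      rw [this]; exact hκ'
    have hns : ¬ Stalled G κ cl d := fun hs => h.no_proposal hs hu hd
    refine le_trans (Nat.mul_le_mul_left K ?_) (h1.trans ?_)
    · refine Finset.card_le_card ?_
      intro x hx
      simp only [Finset.mem_filter] at hx
      obtain ⟨u', d', hu', hd', -⟩ := hmemA x hx.1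
      have hx2 := hx.2
      simp only [hu', hd', Option.getD_some] at hx2
      simp only [Finset.mem_filter, Finset.mem_univ, true_and]
      exact ⟨u', hu', by rw [hd', hx2]⟩
    · refine Finset.card_le_card ?_
      intro x hx
      simp only [Finset.mem_filter, Finset.mem_univ, true_and] at hx
      simp only [B, Finset.mem_filter, Finset.mem_univ, true_and]
      exact ⟨⟨d, hx, hκd, hna, hns⟩, by rw [hx]; rfl⟩
  have hBS : B.card + (stalledSet G κ cl).card ≤ (stalledSet G κ cl').card := by
    rw [← Finset.card_union_of_disjoint]
    · refine Finset.card_le_card ?_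
      intro v hv
      simp only [B, stalledSet, Finset.mem_union, Finset.mem_filter, Finset.mem_univ,
        true_and] at hv ⊢
      rcases hv with ⟨c, hc, hκ, hna, -⟩ | ⟨c, hc, hs⟩
      · exact ⟨c, h.blue hc hκ, h.stalled_of_not_accepts hκ hna⟩
      · exact ⟨c, h.blue hc hs.1, h.stalled hs⟩
    · rw [Finset.disjoint_left]
      intro v hv hv'
      simp only [B, stalledSet, Finset.mem_filter, Finset.mem_univ, true_and] at hv hv'
      obtain ⟨c, hc, -, -, hns⟩ := hv
      obtain ⟨c', hc', hs⟩ := hv'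
      have : c = c' := by have := hc.symm.trans hc'; simpa using this
      exact hns (this ▸ hs)
  have : K * (aliveSet cl).card = K * A.card + K * (aliveSet cl').card := by
    rw [← hA, Nat.mul_add]
  omega

/-- A cluster that is not stalled has grown in every step. -/
theorem Grows.size (h : Grows P κ K ν ν' pr) {s c : ℕ} (hκ : κ c = true)
    (hs : ¬ Stalled G κ (fun v => (ν v).cl) c →
      (K + 1) ^ s ≤ K ^ s * clusterCard (fun v => (ν v).cl) c)
    (hs' : ¬ Stalled G κ (fun v => (ν' v).cl) c) :
    (K + 1) ^ (s + 1) ≤ K ^ (s + 1) * clusterCard (fun v => (ν' v).cl) c := by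
  have h1 : ¬ Stalled G κ (fun v => (ν v).cl) c := fun h1 => hs' (h.stalled h1)
  have h2 := hs h1
  have ha : Accepts K (fun v => (ν v).cl) pr c := by
    by_contra hna
    exact hs' (h.stalled_of_not_accepts hκ hna)
  rw [h.card_accept hκ ha]
  unfold Accepts at ha
  calc (K + 1) ^ (s + 1) = (K + 1) * (K + 1) ^ s := by ring
    _ ≤ (K + 1) * (K ^ s * clusterCard (fun v => (ν v).cl) c) := Nat.mul_le_mul_left _ h2
    _ = K ^ s * (K * clusterCard (fun v => (ν v).cl) c + clusterCard (fun v => (ν v).cl) c) := by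
        ring
    _ ≤ K ^ s * (K * clusterCard (fun v => (ν v).cl) c +
          K * proposals (fun v => (ν v).cl) pr c) := by gcongr
    _ = _ := by ring

end Growth

/-! ### Components of clusters -/

section Components

variable {V : Type*} {G : SimpleGraph V}

/-- The relation generated by adjacency of alive nodes and by being in the same cluster. -/
def Linked (G : SimpleGraph V) (cl : V → Option ℕ) : V → V → Prop :=
  Relation.EqvGen fun v w => ∃ c d, cl v = some c ∧ cl w = some d ∧ (G.Adj v w ∨ c = d)

theorem Linked.of_adj {cl : V → Option ℕ} {v w : V} (h : G.Adj v w) (hv : cl v ≠ none)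
    (hw : cl w ≠ none) : Linked G cl v w := by
  obtain ⟨c, hc⟩ := Option.ne_none_iff_exists'.1 hv
  obtain ⟨d, hd⟩ := Option.ne_none_iff_exists'.1 hw
  exact .rel _ _ ⟨c, d, hc, hd, Or.inl h⟩

theorem Linked.of_eq {cl : V → Option ℕ} {v w : V} {c : ℕ} (hv : cl v = some c)
    (hw : cl w = some c) : Linked G cl v w :=
  .rel _ _ ⟨c, c, hv, hw, Or.inr rfl⟩

variable [Fintype V]

open Classical in
/-- The clusters in the component of `v`. -/
noncomputable def compClusters (G : SimpleGraph V) (cl : V → Option ℕ) (v : V) : Finset ℕ :=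
  (Finset.univ.filter fun w => Linked G cl v w ∧ cl w ≠ none).image fun w => (cl w).getD 0

theorem mem_compClusters {cl : V → Option ℕ} {v : V} {c : ℕ} :
    c ∈ compClusters G cl v ↔ ∃ w, Linked G cl v w ∧ cl w = some c := by
  simp only [compClusters, Finset.mem_image, Finset.mem_filter, Finset.mem_univ, true_and]
  constructor
  · rintro ⟨w, ⟨h1, h2⟩, rfl⟩
    obtain ⟨d, hd⟩ := Option.ne_none_iff_exists'.1 h2
    exact ⟨w, h1, by rw [hd]; rfl⟩
  · rintro ⟨w, h1, h2⟩
    exact ⟨w, ⟨h1, by rw [h2]; simp⟩, by rw [h2]; rfl⟩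

/-- If `c` had no neighboring cluster, membership in `c` would be invariant under `Linked`, and `c`
would be its whole component. -/
theorem hasNeighbor_of_mem {cl : V → Option ℕ} {v : V} {c c' : ℕ}
    (hc : c ∈ compClusters G cl v) (hc' : c' ∈ compClusters G cl v) (hne : c ≠ c') :
    HasNeighbor G cl c := by
  by_contra hno
  obtain ⟨w, hw, hcw⟩ := mem_compClusters.1 hc
  obtain ⟨w', hw', hcw'⟩ := mem_compClusters.1 hc'
  have key : ∀ x y, Linked G cl x y → (cl x = some c ↔ cl y = some c) := by
    intro x y h
    induction h with
    | rel x y h =>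
      obtain ⟨a, d, ha, hd, h | h⟩ := h
      · constructor
        · intro hx
          by_contra hy
          exact hno ⟨x, y, d, h, hx, hd, fun h' => hy (h' ▸ hd)⟩
        · intro hy
          by_contra hx
          exact hno ⟨y, x, a, h.symm, hy, ha, fun h' => hx (h' ▸ ha)⟩
      · rw [ha, hd, h]
    | refl x => rfl
    | symm x y _ ih => exact ih.symm
    | trans x y z _ _ ih1 ih2 => exact ih1.trans ih2
  have h1 := (key w w' ((Relation.EqvGen.symm _ _ hw).trans _ _ _ hw')).1 hcw
  have := h1.symm.trans hcw'
  exact hne (by simpa using this)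

/-- If the colors are separated then every component has lost a constant fraction of its
clusters. -/
theorem Balanced.card_compClusters {cl cl' : V → Option ℕ} {κ : ℕ → Bool} {D φ rank : ℕ → ℕ}
    (hB : Balanced G cl κ D φ rank) (halive : ∀ v, cl' v ≠ none → cl v ≠ none)
    (hold : ∀ v c, cl' v = some c → ∃ w, Linked G cl v w ∧ cl w = some c)
    (hsep : ∀ v u c d, G.Adj v u → cl' v = some c → cl' u = some d → κ c = κ d) {v : V}
    (hv : cl' v ≠ none) :
    24 * (compClusters G cl' v).card ≤ 23 * (compClusters G cl v).card ∨
      (compClusters G cl' v).card ≤ 1 := by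
  classical
  obtain ⟨c₀, hc₀⟩ := Option.ne_none_iff_exists'.1 hv
  -- The extra hypothesis excludes the reflexive pairs of dead nodes, which have no cluster. If one
  -- end is alive, then so is every node along the chain of links.
  have key : ∀ x y, Linked G cl' x y → (cl' x ≠ none ∨ cl' y ≠ none) → Linked G cl x y ∧
      ∃ c d, cl' x = some c ∧ cl' y = some d ∧ κ c = κ d := by
    intro x y h
    induction h with
    | rel x y h =>
      intro _
      obtain ⟨a, d, ha, hd, h⟩ := h
      refine ⟨?_, a, d, ha, hd, ?_⟩
      · rcases h with h | rfl
        · exact Linked.of_adj h (halive x (by rw [ha]; simp)) (halive y (by rw [hd]; simp))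
        · obtain ⟨w, hw, hcw⟩ := hold x a ha
          obtain ⟨w', hw', hcw'⟩ := hold y a hd
          exact (hw.trans _ _ _ (Linked.of_eq hcw hcw')).trans _ _ _ (Relation.EqvGen.symm _ _ hw')
      · rcases h with h | rfl
        · exact hsep x y a d h ha hd
        · rfl
    | refl x =>
      intro h
      obtain ⟨c, hc⟩ := Option.ne_none_iff_exists'.1 (h.elim id id)
      exact ⟨.refl x, c, c, hc, hc, rfl⟩
    | symm x y _ ih =>
      intro h
      obtain ⟨h1, c, d, h2, h3, h4⟩ := ih h.symm
      exact ⟨.symm _ _ h1, d, c, h3, h2, h4.symm⟩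
    | trans x y z _ _ ih1 ih2 =>
      rintro (h | h)
      · obtain ⟨h1, c, d, h2, h3, h4⟩ := ih1 (Or.inl h)
        obtain ⟨h5, d', e, h6, h7, h8⟩ := ih2 (Or.inl (by rw [h3]; simp))
        have : d = d' := by have := h3.symm.trans h6; simpa using this
        exact ⟨h1.trans _ _ _ h5, c, e, h2, h7, by rw [h4, this, h8]⟩
      · obtain ⟨h5, d', e, h6, h7, h8⟩ := ih2 (Or.inr h)
        obtain ⟨h1, c, d, h2, h3, h4⟩ := ih1 (Or.inr (by rw [h6]; simp))
        have : d = d' := by have := h3.symm.trans h6; simpa using this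
        exact ⟨h1.trans _ _ _ h5, c, e, h2, h7, by rw [h4, this, h8]⟩
  set S := compClusters G cl v with hS
  -- The new component consists of old clusters of the same old component, all of the color of the
  -- cluster of `v`.
  have hsub : compClusters G cl' v ⊆ S.filter fun c => κ c = κ c₀ := by
    intro c hc
    obtain ⟨w, hw, hcw⟩ := mem_compClusters.1 hc
    obtain ⟨h1, a, d, h2, h3, h4⟩ := key v w hw (Or.inl hv)
    have e1 : c₀ = a := by have := hc₀.symm.trans h2; simpa using this
    have e2 : c = d := by have := hcw.symm.trans h3; simpa using this
    obtain ⟨w', hw', hcw'⟩ := hold w c hcw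
    rw [Finset.mem_filter]
    exact ⟨mem_compClusters.2 ⟨w', h1.trans _ _ _ hw', hcw'⟩, by rw [e2, ← h4, e1]⟩
  by_cases hone : S.card ≤ 1
  · right
    exact (Finset.card_le_card hsub).trans ((Finset.card_filter_le _ _).trans hone)
  · left
    have hnb : ∀ c ∈ S, HasNeighbor G cl c := by
      intro c hc
      obtain ⟨c', hc', hne⟩ := Finset.exists_mem_ne (by omega : 1 < S.card) c
      exact hasNeighbor_of_mem hc hc' hne.symm
    -- Clusters with the same choice are linked through it. Hence ranks and siblings can be computed
    -- inside a single component.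
    have hDS : ∀ c c', HasNeighbor G cl c → c ∈ S → D c' = D c → HasNeighbor G cl c' → c' ∈ S := by
      intro c c' hc hcS hD hc'
      obtain ⟨w, hw, hcw⟩ := mem_compClusters.1 hcS
      obtain ⟨x, y, hxy⟩ := hB.touch c hc
      obtain ⟨x', y', hxy'⟩ := hB.touch c' hc'
      refine mem_compClusters.2 ⟨x', ?_, hxy'.2.1⟩
      have h1 : Linked G cl w x := Linked.of_eq hcw hxy.2.1
      have h2 : Linked G cl x y := Linked.of_adj hxy.1 (by rw [hxy.2.1]; simp)
        (by rw [hxy.2.2.1]; simp)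
      have h3 : Linked G cl y y' := Linked.of_eq hxy.2.2.1 (hD ▸ hxy'.2.2.1)
      have h4 : Linked G cl y' x' := Linked.of_adj hxy'.1.symm (by rw [hxy'.2.2.1]; simp)
        (by rw [hxy'.2.1]; simp)
      exact (((hw.trans _ _ _ h1).trans _ _ _ h2).trans _ _ _ h3).trans _ _ _ h4
    have hcard : ∀ t, S.card ≤ 24 * (S.filter fun c => κ c = t).card := by
      refine card_le_mul_card_color (D := D) (φ := φ) (rank := rank) ?_ ?_ ?_ ?_ ?_ ?_ ?_
      · intro c hc
        obtain ⟨w, hw, hcw⟩ := mem_compClusters.1 hc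
        obtain ⟨x, y, hxy⟩ := hB.touch c (hnb c hc)
        refine mem_compClusters.2 ⟨y, ?_, hxy.2.2.1⟩
        have h1 : Linked G cl w x := Linked.of_eq hcw hxy.2.1
        have h2 : Linked G cl x y := Linked.of_adj hxy.1 (by rw [hxy.2.1]; simp)
          (by rw [hxy.2.2.1]; simp)
        exact (hw.trans _ _ _ h1).trans _ _ _ h2
      · exact fun c hc => hB.lt c (hnb c hc)
      · exact fun c hc => hB.ne c (hnb c hc)
      · exact fun c hc c' hc' => hB.inj c c' (hnb c hc) (hnb c' hc')
      · intro c hc r hr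
        obtain ⟨c', h1, h2, h3⟩ := hB.down c (hnb c hc) r hr
        exact ⟨c', hDS c c' (hnb c hc) hc h2 h1, h2, h3⟩
      · rintro c hc ⟨c', hc', hne, hD⟩
        exact hB.color_sibling c c' (hnb c hc) (hnb c' hc') hne hD
      · intro c hc hno
        refine hB.color_single c (hnb c hc) ?_
        intro c' hc' hD
        by_contra hne
        exact hno ⟨c', hDS c c' (hnb c hc) hc hD hc', hne, hD⟩
    -- The opposite color has at least 1/24 of the clusters, and all of these are lost to the
    -- component of `v`.
    have h1 := hcard (!κ c₀)
    have h2 : (S.filter fun c => κ c = κ c₀).card + (S.filter fun c => κ c = !κ c₀).card =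
        S.card := by
      rw [← Finset.card_filter_add_card_filter_not (s := S) (fun c => κ c = κ c₀)]
      congr 2
      ext c
      simp only [Finset.mem_filter, and_congr_right_iff]
      intro _
      cases κ c <;> cases κ c₀ <;> simp
    have h3 := Finset.card_le_card hsub
    omega

end Components

end NetDecomp

namespace NetDecomp

/-! ### Phases and repetitions -/

/-- A phase: the clusters are colored, then the blue ones grow `S` times. -/
noncomputable def phaseProg (b L w R T K S : ℕ) : List (Op (Loc × Regs)) :=
  splitProg b L w R T ++ (List.replicate S (growProg b L w R K)).flatten

section Phase

variable {V : Type*} [Fintype V] {G : SimpleGraph V} {P : PortNumbering G} {idn : V → ℕ}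

/-- The parameters of the algorithm are sufficiently large. -/
structure Valid (idn : V → ℕ) (b L w R T K S Ph : ℕ) : Prop where
  b_pos : 0 < b
  inj : Function.Injective idn
  id_lt : ∀ v, idn v < 2 ^ b
  card_lt : Fintype.card V < 2 ^ w
  bits_le : nextBits b ≤ w
  three_le : 3 ≤ w
  cv : nextBits^[T] (nextBits b) ≤ 3
  slots_lt : L < 2 ^ w
  steps : K ^ S * Fintype.card V < (K + 1) ^ S
  depth_le : Ph * S ≤ R
  slots_le : Ph + 1 ≤ L
  kill : 2 * Ph ≤ K
  phases : 23 ^ Ph * Fintype.card V < 24 ^ Ph * 2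

variable {b L w R T K S Ph : ℕ}

/-- The invariant of the growth loop. -/
structure GrowInv (P : PortNumbering G) (idn : V → ℕ) (κ : ℕ → Bool) (K D ℓ : ℕ) (β₀ : V → Loc)
    (s : ℕ) (β : V → Loc) : Prop where
  out : ∀ v, (β v).out = (β₀ v).out
  forest : Forest P idn (D + s) (ℓ + 1) fun v => (β v).net
  short : ∀ v c, (β v).net.cl = some c → κ c = false → (β v).net.ids.length ≤ ℓ
  blue : ∀ v c, (β v).net.cl = some c → (β v).work.blue = κ c
  alive : ∀ v, (β v).net.cl ≠ none → (β₀ v).net.cl ≠ none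
  old : ∀ v c, (β v).net.cl = some c →
    ∃ w, Linked G (fun v => (β₀ v).net.cl) v w ∧ (β₀ w).net.cl = some c
  deaths : K * (aliveSet fun v => (β₀ v).net.cl).card ≤
    K * (aliveSet fun v => (β v).net.cl).card + (stalledSet G κ fun v => (β v).net.cl).card
  size : ∀ v c, (β v).net.cl = some c → κ c = true → ¬ Stalled G κ (fun v => (β v).net.cl) c →
    (K + 1) ^ s ≤ K ^ s * clusterCard (fun v => (β v).net.cl) c

/-- The field `short` makes the number of trees grow by at most one per phase: only red nodes join,
their lists are still as short as at the start of the phase, and after joining they are blue and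
stay put. -/
theorem GrowInv.step {κ : ℕ → Bool} {D ℓ s : ℕ} {β₀ β β' : V → Loc} {pr : V → Option V}
    (h : GrowInv P idn κ K D ℓ β₀ s β) (hout : ∀ v, (β' v).out = (β v).out)
    (hblue : ∀ v c, (β' v).net.cl = some c → (β' v).work.blue = κ c)
    (hG : Grows P κ K (fun v => (β v).net) (fun v => (β' v).net) pr) :
    GrowInv P idn κ K D ℓ β₀ (s + 1) β' where
  out v := (hout v).trans (h.out v)
  forest := by
    refine h.forest.grow fun v => ?_
    cases hp : pr v with
    | none => exact Or.inl (hG.idle v hp)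
    | some u =>
      obtain ⟨hadj, ⟨c, hc, hκc⟩, d, hd, -⟩ := hG.proposes.sound v u hp
      by_cases ha : Accepts K (fun v => (β v).net.cl) pr d
      · exact Or.inr (Or.inr ⟨u, d, hadj, hd, Nat.lt_succ_of_le (h.short v c hc hκc),
          hG.join v u d hp hd ha⟩)
      · exact Or.inr (Or.inl (hG.die v u d hp hd ha))
  short v c hc hκ := by
    obtain ⟨h1, h2⟩ := hG.red hc hκ
    have h3 : (β' v).net = (β v).net := hG.idle v h2
    rw [h3]
    exact h.short v c h1 hκ
  blue := hblue
  alive v hv := h.alive v (hG.alive hv)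
  old v c hc := by
    rcases hG.blue_cases hc with h1 | ⟨u, h1, h2, -⟩
    · exact h.old v c h1
    · obtain ⟨w, hw, hcw⟩ := h.old u c h2
      obtain ⟨hadj, ⟨c', hc', -⟩, -⟩ := hG.proposes.sound v u h1
      refine ⟨w, Relation.EqvGen.trans _ _ _ (Linked.of_adj hadj ?_ ?_) hw, hcw⟩
      · exact h.alive v (Option.ne_none_iff_exists'.2 ⟨c', hc'⟩)
      · exact h.alive u (Option.ne_none_iff_exists'.2 ⟨c, h2⟩)
  deaths := h.deaths.trans hG.deaths
  size v c hc hκ hs := by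
    refine hG.size hκ (fun h1 => ?_) hs
    rcases hG.blue_cases hc with h2 | ⟨u, -, h2, -⟩
    · exact h.size v c h2 hκ h1
    · exact h.size u c h2 hκ h1

theorem GrowInv.run (hv : Valid idn b L w R T K S Ph) {κ : ℕ → Bool} {D ℓ : ℕ} {β₀ : V → Loc}
    (hD : D + S ≤ R) (hℓ : ℓ + 1 ≤ L) (r : ℕ) : ∀ (s : ℕ) (β : V → Loc), s + r ≤ S →
    GrowInv P idn κ K D ℓ β₀ s β →
    ∃ β', NetDecomp.run P idn b (List.replicate r (growProg b L w R K)).flatten (clearRegs β) =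
        clearRegs β' ∧ GrowInv P idn κ K D ℓ β₀ (s + r) β' := by
  induction r with
  | zero => intro s β _ h; exact ⟨β, rfl, h⟩
  | succ r ih =>
    intro s β hs h
    obtain ⟨β₁, pr, h1, h2, h3, h4⟩ := run_grow (w := w) (K := K) hv.b_pos hv.inj hv.id_lt
      hv.card_lt (by have := hv.three_le; omega) hv.slots_lt
      (h.forest.mono (show D + s ≤ R by omega) hℓ) h.blue
    obtain ⟨β₂, h5, h6⟩ := ih (s + 1) β₁ (by omega) (h.step h2 h3 h4)
    refine ⟨β₂, ?_, ?_⟩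
    · rw [List.replicate_succ, List.flatten_cons, run_append, h1, h5]
    · rwa [show s + (r + 1) = s + 1 + r by omega]

/-- Once all blue clusters are stalled, no edge joins the two colors, and the balance of the
coloring applies. Stalled nodes are alive, so the deaths are bounded by a fraction `1/K` of the
survivors. -/
theorem run_phase [Nonempty V] (hv : Valid idn b L w R T K S Ph) {D ℓ : ℕ} {β : V → Loc}
    (hF : Forest P idn D ℓ fun v => (β v).net) (hD : D + S ≤ R) (hℓ : ℓ + 1 ≤ L) :
    ∃ β', run P idn b (phaseProg b L w R T K S) (clearRegs β) = clearRegs β' ∧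
      (∀ v, (β' v).out = (β v).out) ∧ (Forest P idn (D + S) (ℓ + 1) fun v => (β' v).net) ∧
      (∀ v, (β' v).net.cl ≠ none → (β v).net.cl ≠ none) ∧
      K * (aliveSet (clusterOf β)).card ≤ K * (aliveSet (clusterOf β')).card +
        (aliveSet (clusterOf β')).card ∧
      ∀ v, clusterOf β' v ≠ none →
        24 * (compClusters G (clusterOf β') v).card ≤ 23 * (compClusters G (clusterOf β) v).card ∨
          (compClusters G (clusterOf β') v).card ≤ 1 := by
  obtain ⟨β₁, κ, r1, hs, hκ, Dn, φ, rank, hB⟩ := run_split (P := P) (w := w) (T := T) hv.b_pos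
    hv.inj hv.id_lt hv.card_lt hv.bits_le hv.three_le hv.cv
    (hF.mono (show D ≤ R by omega) (show ℓ ≤ L by omega))
  have hcl : clusterOf β₁ = clusterOf β := hs.clusterOf
  have hinit : GrowInv P idn κ K D ℓ β₁ 0 β₁ := by
    refine ⟨fun v => rfl, (hs.forest hF).mono le_rfl (by omega), ?_, ?_, fun v h => h, ?_, ?_, ?_⟩
    · intro v c _ _
      exact (hs.forest hF).length_le v
    · intro v c hc
      exact hκ v c (by rw [← hcl]; exact hc)
    · intro v c hc
      exact ⟨v, .refl v, hc⟩
    · exact Nat.le_add_right _ _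
    · intro v c hc _ _
      have : 0 < clusterCard (fun v => (β₁ v).net.cl) c :=
        Finset.card_pos.2 ⟨v, by simpa using hc⟩
      simpa [Nat.one_le_iff_ne_zero, Nat.pos_iff_ne_zero] using this
  obtain ⟨β₂, r2, hI⟩ := GrowInv.run (P := P) hv hD hℓ S 0 β₁ (by omega) hinit
  rw [zero_add] at hI
  -- A blue cluster that is not stalled would have at least `(1 + 1/K) ^ S` nodes, which exceeds the
  -- number of all nodes.
  have hstall : ∀ v c, clusterOf β₂ v = some c → κ c = true → Stalled G κ (clusterOf β₂) c := by
    intro v c hc hκc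
    by_contra hns
    have h1 := hI.size v c hc hκc hns
    have h2 : clusterCard (fun v => (β₂ v).net.cl) c ≤ Fintype.card V := Finset.card_le_univ _
    have h3 := hv.steps
    have h4 := Nat.mul_le_mul_left (K ^ S) h2
    omega
  have hβ : (fun v => (β₁ v).net.cl) = clusterOf β := hcl
  refine ⟨β₂, ?_, ?_, hI.forest, ?_, ?_, ?_⟩
  · rw [phaseProg, run_append, r1, r2]
  · intro v
    rw [hI.out v, (hs v).2]
  · intro v h
    have := hI.alive v h
    rwa [(hs v).1] at this
  · have h1 := hI.deaths
    rw [hβ] at h1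
    refine h1.trans (Nat.add_le_add_left (Finset.card_le_card (stalledSet_subset _)) _)
  · intro v hv'
    refine hB.card_compClusters ?_ ?_ ?_ hv'
    · intro v h
      have := hI.alive v h
      rwa [(hs v).1] at this
    · intro v c hc
      have := hI.old v c hc
      rw [hβ] at this
      obtain ⟨w, h1, h2⟩ := this
      exact ⟨w, h1, by rw [(hs w).1] at h2; exact h2⟩
    · intro v u c d hadj hc hd
      cases hκc : κ c with
      | true => exact ((hstall v c hc hκc).2 v u d hadj hc hd).symm
      | false =>
        cases hκd : κ d with
        | false => rfl
        | true =>
          have := (hstall u d hd hκd).2 u v c hadj.symm hd hc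
          rw [hκc] at this
          simp at this

theorem card_compClusters_le (cl : V → Option ℕ) (v : V) :
    (compClusters G cl v).card ≤ Fintype.card V :=
  Finset.card_image_le.trans (Finset.card_le_univ _)

theorem run_phases [Nonempty V] (hv : Valid idn b L w R T K S Ph) {β : V → Loc}
    (hF : Forest P idn 0 1 fun v => (β v).net) (i : ℕ) (hi : i ≤ Ph) :
    ∃ β', run P idn b (List.replicate i (phaseProg b L w R T K S)).flatten (clearRegs β) =
        clearRegs β' ∧
      (∀ v, (β' v).out = (β v).out) ∧ (Forest P idn (i * S) (i + 1) fun v => (β' v).net) ∧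
      (∀ v, (β' v).net.cl ≠ none → (β v).net.cl ≠ none) ∧
      K * (aliveSet (clusterOf β)).card ≤ K * (aliveSet (clusterOf β')).card +
        i * (aliveSet (clusterOf β)).card ∧
      ∀ v, clusterOf β' v ≠ none →
        24 ^ i * (compClusters G (clusterOf β') v).card ≤ 23 ^ i * Fintype.card V ∨
          (compClusters G (clusterOf β') v).card ≤ 1 := by
  induction i with
  | zero =>
    refine ⟨β, rfl, fun v => rfl, by simpa using hF, fun v h => h, by simp, fun v _ => Or.inl ?_⟩
    simpa using card_compClusters_le (clusterOf β) v
  | succ i ih =>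
    obtain ⟨β₁, r1, ho, hF₁, hal, hd, hc⟩ := ih (by omega)
    have hR : i * S + S ≤ R := by
      calc i * S + S = (i + 1) * S := by ring
        _ ≤ Ph * S := Nat.mul_le_mul_right _ hi
        _ ≤ R := hv.depth_le
    obtain ⟨β₂, r2, ho₂, hF₂, hal₂, hd₂, hc₂⟩ := run_phase hv hF₁ hR
      (by have := hv.slots_le; omega)
    refine ⟨β₂, ?_, fun v => (ho₂ v).trans (ho v), ?_, fun v h => hal v (hal₂ v h), ?_, ?_⟩
    · rw [List.replicate_succ', List.flatten_append, run_append, r1]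
      simpa using r2
    · rw [show (i + 1) * S = i * S + S by ring]; exact hF₂
    · have h1 : (aliveSet (clusterOf β₂)).card ≤ (aliveSet (clusterOf β)).card := by
        refine Finset.card_le_card ?_
        intro v h
        simp only [aliveSet, Finset.mem_filter, Finset.mem_univ, true_and] at h ⊢
        exact hal v (hal₂ v h)
      have h2 : (i + 1) * (aliveSet (clusterOf β)).card =
        i * (aliveSet (clusterOf β)).card + (aliveSet (clusterOf β)).card := by ring
      omega
    · intro v h
      rcases hc₂ v h with h1 | h1
      · rcases hc v (hal₂ v h) with h2 | h2
        · left
          calc 24 ^ (i + 1) * (compClusters G (clusterOf β₂) v).card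
              = 24 ^ i * (24 * (compClusters G (clusterOf β₂) v).card) := by ring
            _ ≤ 24 ^ i * (23 * (compClusters G (clusterOf β₁) v).card) :=
              Nat.mul_le_mul_left _ h1
            _ = 23 * (24 ^ i * (compClusters G (clusterOf β₁) v).card) := by ring
            _ ≤ 23 * (23 ^ i * Fintype.card V) := Nat.mul_le_mul_left _ h2
            _ = _ := by ring
        · right
          omega
      · exact Or.inr h1

/-- After all phases, adjacent alive nodes are in the same cluster, and at least half of the
nodes are alive. -/
theorem run_all_phases [Nonempty V] (hv : Valid idn b L w R T K S Ph) (hPh : 0 < Ph) {β : V → Loc}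
    (hF : Forest P idn 0 1 fun v => (β v).net) :
    ∃ β', run P idn b (List.replicate Ph (phaseProg b L w R T K S)).flatten (clearRegs β) =
        clearRegs β' ∧
      (∀ v, (β' v).out = (β v).out) ∧ (Forest P idn (Ph * S) (Ph + 1) fun v => (β' v).net) ∧
      (∀ v, (β' v).net.cl ≠ none → (β v).net.cl ≠ none) ∧
      (aliveSet (clusterOf β)).card ≤ 2 * (aliveSet (clusterOf β')).card ∧
      ∀ v u c d, G.Adj v u → (β' v).net.cl = some c → (β' u).net.cl = some d → c = d := by
  obtain ⟨β', r1, ho, hF', hal, hd, hc⟩ := run_phases (P := P) hv hF Ph le_rfl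
  refine ⟨β', r1, ho, hF', hal, ?_, ?_⟩
  · have h1 := hv.kill
    set a := (aliveSet (clusterOf β)).card
    set a' := (aliveSet (clusterOf β')).card
    have hle : a' ≤ a := by
      refine Finset.card_le_card ?_
      intro v h
      simp only [aliveSet, Finset.mem_filter, Finset.mem_univ, true_and] at h ⊢
      exact hal v h
    have h2 : 2 * (Ph * a) ≤ K * a := by
      calc 2 * (Ph * a) = 2 * Ph * a := by ring
        _ ≤ K * a := Nat.mul_le_mul_right _ h1
    have h3 : K * a ≤ K * (2 * a') := by
      -- From `K * a ≤ K * a' + Ph * a` and `2 * Ph ≤ K`: the phases together lose at most half of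
      -- `a`.
      calc K * a ≤ 2 * (K * a) - 2 * (Ph * a) := by omega
        _ ≤ 2 * (K * a') := by omega
        _ = K * (2 * a') := by ring
    exact Nat.le_of_mul_le_mul_left h3 (by omega)
  · intro v u c d hadj hvc hud
    have hone : (compClusters G (clusterOf β') v).card ≤ 1 := by
      rcases hc v (by rw [clusterOf, hvc]; simp) with h | h
      · by_contra hgt
        have h1 : 24 ^ Ph * 2 ≤ 24 ^ Ph * (compClusters G (clusterOf β') v).card :=
          Nat.mul_le_mul_left _ (by omega)
        have := hv.phases
        omega
      · exact h
    refine Finset.card_le_one.1 hone c ?_ d ?_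
    · exact mem_compClusters.2 ⟨v, .refl v, hvc⟩
    · exact mem_compClusters.2 ⟨u, Linked.of_adj hadj (by rw [clusterOf, hvc]; simp)
        (by rw [clusterOf, hud]; simp), hud⟩

end Phase

end NetDecomp

/-! ### Repetitions: one color class after the other. -/

namespace NetDecomp

/-- The initial cluster of a node. -/
def Net.single (i : ℕ) : Net := ⟨some i, [i], fun _ => none⟩

/-- A node without cluster. -/
def Net.empty : Net := ⟨none, [], fun _ => none⟩

/-- The output at the end of the repetition `q`. -/
def Out.finish (q : ℕ) (ν : Net) (o : Out) : Out :=
  let links := o.links ∪ ν.ids.toFinset.image fun c => (Nat.pair c q, (ν.par c).map Prod.fst)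
  match ν.cl with
  | none => { o with links := links }
  | some c => ⟨true, q, Nat.pair c q, links⟩

/-- At the end of the repetition `q`, the clusters of alive nodes get the color `q`, and the
remaining nodes start afresh. -/
def finish (b q : ℕ) : Op (Loc × Regs) :=
  exch b 0 0 (fun _ _ _ _ => 0) fun e l _ =>
    let o := l.out.finish q l.net
    ⟨if o.fin then Net.empty else Net.single e.id, o, l.work⟩

/-- A repetition, which computes the clusters of color `q`. -/
noncomputable def repProg (b L w R T K S Ph q : ℕ) : List (Op (Loc × Regs)) :=
  (List.replicate Ph (phaseProg b L w R T K S)).flatten ++ [finish b q]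

/-- The program that computes the decomposition. -/
noncomputable def decompProg (b L w R T K S Ph Q : ℕ) : List (Op (Loc × Regs)) :=
  (List.range Q).flatMap (repProg b L w R T K S Ph)

/-- The initial state of a node. -/
def initLoc (e : Env) : Loc := ⟨Net.single e.id, ⟨false, 0, 0, ∅⟩, Work.init⟩

section Repetition

variable {V : Type*} {G : SimpleGraph V} {P : PortNumbering G} {idn : V → ℕ}

/-- The outputs `o` are those of the clusters `ν i` of color `i < q`. -/
structure History (P : PortNumbering G) (idn : V → ℕ) (R L q : ℕ) (ν : ℕ → V → Net)
    (o : V → Out) : Prop where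
  forest : ∀ i < q, Forest P idn R L (ν i)
  separated : ∀ i < q, ∀ v u c d, G.Adj v u → (ν i v).cl = some c → (ν i u).cl = some d → c = d
  links : ∀ v x, x ∈ (o v).links ↔
    ∃ i < q, ∃ c ∈ (ν i v).ids, x = (Nat.pair c i, ((ν i v).par c).map Prod.fst)
  fin : ∀ v, (o v).fin = true →
    ∃ i < q, ∃ c, (ν i v).cl = some c ∧ (o v).color = i ∧ (o v).label = Nat.pair c i

/-- Links are recorded for dead nodes too, as they may be inner nodes of the trees of surviving
clusters. Pairing the label with `q` keeps clusters of different repetitions apart, although they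
may reuse a root. -/
theorem History.snoc {R L q : ℕ} {ν : ℕ → V → Net} {o : V → Out}
    (h : History P idn R L q ν o) {ν' : V → Net} (hF : Forest P idn R L ν')
    (hsep : ∀ v u c d, G.Adj v u → (ν' v).cl = some c → (ν' u).cl = some d → c = d) :
    History P idn R L (q + 1) (Function.update ν q ν') fun v => (o v).finish q (ν' v) := by
  have hlt : ∀ i < q, Function.update ν q ν' i = ν i := fun i hi =>
    Function.update_of_ne (by omega) _ _
  have heq : Function.update ν q ν' q = ν' := Function.update_self _ _ _
  refine ⟨fun i hi => ?_, fun i hi => ?_, fun v x => ?_, fun v hv => ?_⟩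
  · rcases Nat.lt_succ_iff_lt_or_eq.1 hi with hi | rfl
    · rw [hlt i hi]; exact h.forest i hi
    · rw [heq]; exact hF
  · rcases Nat.lt_succ_iff_lt_or_eq.1 hi with hi | rfl
    · rw [hlt i hi]; exact h.separated i hi
    · rw [heq]; exact hsep
  · have h1 : ((o v).finish q (ν' v)).links = (o v).links ∪ (ν' v).ids.toFinset.image
        fun c => (Nat.pair c q, ((ν' v).par c).map Prod.fst) := by
      cases hc : (ν' v).cl <;> simp [Out.finish, hc]
    rw [h1, Finset.mem_union, h.links, Finset.mem_image]
    constructor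
    · rintro (⟨i, hi, c, hc, rfl⟩ | ⟨c, hc, rfl⟩)
      · exact ⟨i, by omega, c, by rw [hlt i hi]; exact hc, by rw [hlt i hi]⟩
      · exact ⟨q, by omega, c, by rw [heq]; simpa using hc, by rw [heq]⟩
    · rintro ⟨i, hi, c, hc, rfl⟩
      rcases Nat.lt_succ_iff_lt_or_eq.1 hi with hi | rfl
      · rw [hlt i hi] at hc ⊢
        exact Or.inl ⟨i, hi, c, hc, rfl⟩
      · rw [heq] at hc ⊢
        exact Or.inr ⟨c, by simpa using hc, rfl⟩
  · cases hc : (ν' v).cl with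
    | none =>
      simp only [Out.finish, hc] at hv ⊢
      obtain ⟨i, hi, c, h1, h2⟩ := h.fin v hv
      exact ⟨i, by omega, c, by rw [hlt i hi]; exact h1, h2⟩
    | some c =>
      simp only [Out.finish, hc]
      exact ⟨q, by omega, c, by rw [heq]; exact hc, rfl, rfl⟩

theorem forest_reset {β : V → Loc}
    (h : ∀ v, (β v).net = if (β v).out.fin then Net.empty else Net.single (idn v)) :
    Forest P idn 0 1 fun v => (β v).net := by
  have hids : ∀ v, ∀ c ∈ (β v).net.ids, c = idn v := by
    intro v c hc
    rw [h v] at hc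
    split_ifs at hc
    · simp [Net.empty] at hc
    · simpa [Net.single] using hc
  have hpar : ∀ v c, (β v).net.par c = none := by
    intro v c
    rw [h v]
    split_ifs <;> rfl
  refine ⟨fun v => ?_, fun v => ?_, fun v c hc _ => hids v c hc, fun v c hc p j hp => ?_,
    ⟨fun _ _ => 0, fun v c hc => ⟨le_rfl, fun u hu => ?_⟩⟩, fun v c hc => ?_⟩
  · simp only [h v]
    split_ifs <;> simp [Net.empty, Net.single]
  · simp only [h v]
    split_ifs <;> simp [Net.empty, Net.single]
  · rw [hpar] at hp
    simp at hp
  · simp [parOf, hpar] at hu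
  · simp only [h v] at hc ⊢
    split_ifs at hc ⊢
    · simp [Net.empty] at hc
    · simpa [Net.single, eq_comm] using hc

variable [Fintype V] {b L w R T K S Ph : ℕ}

/-- The nodes without a final cluster. -/
def openSet (o : V → Out) : Finset V := {v | (o v).fin = false}

/-- The nodes alive at the start are exactly the unfinished ones, and the survivors, at least half
of them, become finished. -/
theorem run_rep [Nonempty V] (hv : Valid idn b L w R T K S Ph) (hPh : 0 < Ph) {q : ℕ}
    {ν : ℕ → V → Net} {β : V → Loc}
    (hH : History P idn (Ph * S) (Ph + 1) q ν fun v => (β v).out)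
    (hnet : ∀ v, (β v).net = if (β v).out.fin then Net.empty else Net.single (idn v)) :
    ∃ (ν' : ℕ → V → Net) (β' : V → Loc),
      run P idn b (repProg b L w R T K S Ph q) (clearRegs β) = clearRegs β' ∧
      (History P idn (Ph * S) (Ph + 1) (q + 1) ν' fun v => (β' v).out) ∧
      (∀ v, (β' v).net = if (β' v).out.fin then Net.empty else Net.single (idn v)) ∧
      2 * (openSet fun v => (β' v).out).card ≤ (openSet fun v => (β v).out).card := by
  classical
  obtain ⟨β₁, r1, hout, hF, hal, hcard, hsep⟩ := run_all_phases (P := P) hv hPh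
    (forest_reset hnet)
  have h2 := hH.snoc hF hsep
  refine ⟨_, fun v => ⟨if ((β v).out.finish q (β₁ v).net).fin then Net.empty
    else Net.single (idn v), (β v).out.finish q (β₁ v).net, (β₁ v).work⟩, ?_, h2,
    fun v => rfl, ?_⟩
  · rw [repProg, run_append, r1, run_cons, run_nil, finish, step_exch P idn b hv.b_pos]
    simp only [hout]
    rfl
  · have hopen : (openSet fun v => (β v).out) = aliveSet (clusterOf β) := by
      ext v
      rw [openSet, aliveSet, Finset.mem_filter, Finset.mem_filter, clusterOf, hnet v]
      cases (β v).out.fin <;> simp [Net.empty, Net.single]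
    have hsub : aliveSet (clusterOf β₁) ⊆ aliveSet (clusterOf β) := by
      intro v h
      simp only [aliveSet, Finset.mem_filter, Finset.mem_univ, true_and] at h ⊢
      exact hal v h
    have hopen' : (openSet fun v => (β v).out.finish q (β₁ v).net) ⊆
        aliveSet (clusterOf β) \ aliveSet (clusterOf β₁) := by
      intro v h
      rw [Finset.mem_sdiff, ← hopen, openSet, aliveSet, Finset.mem_filter, Finset.mem_filter,
        clusterOf]
      simp only [openSet, Finset.mem_filter, Finset.mem_univ, true_and] at h ⊢
      cases hc : (β₁ v).net.cl with
      | none => simpa [Out.finish, hc] using h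
      | some c => simp [Out.finish, hc] at h
    have h3 := Finset.card_le_card hopen'
    rw [Finset.card_sdiff_of_subset hsub] at h3
    rw [hopen]
    dsimp only
    omega

theorem run_reps [Nonempty V] (hv : Valid idn b L w R T K S Ph) (hPh : 0 < Ph) (Q : ℕ) :
    ∃ (ν : ℕ → V → Net) (β : V → Loc),
      run P idn b (decompProg b L w R T K S Ph Q) (clearRegs fun v => initLoc (envOf P idn v)) =
        clearRegs β ∧
      (History P idn (Ph * S) (Ph + 1) Q ν fun v => (β v).out) ∧
      (∀ v, (β v).net = if (β v).out.fin then Net.empty else Net.single (idn v)) ∧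
      2 ^ Q * (openSet fun v => (β v).out).card ≤ Fintype.card V := by
  induction Q with
  | zero =>
    refine ⟨fun _ _ => Net.empty, _, rfl, ⟨by simp, by simp, ?_, ?_⟩, fun v => rfl, ?_⟩
    · simp [initLoc]
    · simp [initLoc]
    · simpa using Finset.card_le_univ _
  | succ Q ih =>
    obtain ⟨ν, β, r1, h1, h2, h3⟩ := ih
    obtain ⟨ν', β', r2, h4, h5, h6⟩ := run_rep hv hPh h1 h2
    refine ⟨ν', β', ?_, h4, h5, ?_⟩
    · rw [decompProg, List.range_succ, List.flatMap_append, run_append]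
      rw [decompProg] at r1
      rw [r1]
      simpa using r2
    · calc 2 ^ (Q + 1) * (openSet fun v => (β' v).out).card
          = 2 ^ Q * (2 * (openSet fun v => (β' v).out).card) := by ring
        _ ≤ 2 ^ Q * (openSet fun v => (β v).out).card := Nat.mul_le_mul_left _ h6
        _ ≤ _ := h3

/-- If there are enough repetitions, every node gets a cluster. -/
theorem run_decomp [Nonempty V] (hv : Valid idn b L w R T K S Ph) (hPh : 0 < Ph) {Q : ℕ}
    (hQ : Fintype.card V < 2 ^ Q) :
    ∃ (ν : ℕ → V → Net) (β : V → Loc),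
      run P idn b (decompProg b L w R T K S Ph Q) (clearRegs fun v => initLoc (envOf P idn v)) =
        clearRegs β ∧
      (History P idn (Ph * S) (Ph + 1) Q ν fun v => (β v).out) ∧ ∀ v, (β v).out.fin = true := by
  obtain ⟨ν, β, r, h1, -, h3⟩ := run_reps (P := P) hv hPh Q
  refine ⟨ν, β, r, h1, fun v => ?_⟩
  by_contra hfin
  have : 0 < (openSet fun v => (β v).out).card :=
    Finset.card_pos.2 ⟨v, by simpa [openSet] using hfin⟩
  have := Nat.mul_le_mul_left (2 ^ Q) this
  omega

end Repetition

end NetDecomp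

namespace NetDecomp

/-! ### The output -/

section Tree

variable {W : Type*} {H : SimpleGraph W} {par : W → W → Prop} {dep : W → ℕ} {r : W}

/-- Follow the parents: each step lowers `dep`, which therefore bounds the distance to the root. -/
theorem exists_walk_root (hadj : ∀ u v, par u v → H.Adj u v)
    (hdep : ∀ u v, par u v → dep v < dep u) (hroot : ∀ u, u ≠ r → ∃ v, par u v) (u : W) :
    ∃ p : H.Walk r u, p.length ≤ dep u := by
  induction hn : dep u using Nat.strong_induction_on generalizing u with
  | _ n ih =>
    by_cases h : u = r
    · subst h
      exact ⟨.nil, by simp⟩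
    · obtain ⟨v, hv⟩ := hroot u h
      have hlt := hdep u v hv
      obtain ⟨p, hp⟩ := ih _ (hn ▸ hlt) v rfl
      exact ⟨p.concat (hadj u v hv).symm, by rw [SimpleGraph.Walk.length_concat]; omega⟩

/-- A graph given by parent pointers is a tree. -/
theorem isTree_of_parent [Finite W] (hadj : ∀ u v, H.Adj u v ↔ par u v ∨ par v u)
    (huniq : ∀ u v v', par u v → par u v' → v = v') (hdep : ∀ u v, par u v → dep v < dep u)
    (hroot : ∀ u, u ≠ r → ∃ v, par u v) (hr : ∀ v, ¬ par r v) : H.IsTree := by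
  classical
  have hconn : H.Connected := by
    have : Nonempty W := ⟨r⟩
    have key : ∀ u, H.Reachable r u := fun u =>
      (exists_walk_root (fun u v h => (hadj u v).2 (Or.inl h)) hdep hroot u).elim
        fun p _ => ⟨p⟩
    exact ⟨fun u v => (key u).symm.trans (key v)⟩
  rw [SimpleGraph.isTree_iff_connected_and_card]
  refine ⟨hconn, le_antisymm ?_ hconn.card_vert_le_card_edgeSet_add_one⟩
  -- Each edge joins a node other than the root to its parent, so there are at most `|W| - 1` edges;
  -- a connected graph with so few edges is a tree.
  let f : W → Sym2 W := fun u => if h : ∃ v, par u v then s(u, h.choose) else s(u, u)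
  have hf : ∀ u v, par u v → f u = s(u, v) := by
    intro u v h
    have h' : ∃ v, par u v := ⟨v, h⟩
    simp only [f, dif_pos h']
    rw [huniq u _ _ h'.choose_spec h]
  have hsub : H.edgeSet ⊆ f '' {r}ᶜ := by
    intro e he
    induction e with
    | _ u v =>
      rw [SimpleGraph.mem_edgeSet, hadj] at he
      rcases he with h | h
      · exact ⟨u, fun hu => hr v (by rw [← Set.mem_singleton_iff.1 hu]; exact h), hf u v h⟩
      · exact ⟨v, fun hu => hr u (by rw [← Set.mem_singleton_iff.1 hu]; exact h),
          (hf v u h).trans Sym2.eq_swap⟩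
  have h1 : H.edgeSet.ncard ≤ ({r}ᶜ : Set W).ncard :=
    (Set.ncard_le_ncard hsub (Set.toFinite _)).trans (Set.ncard_image_le (Set.toFinite _))
  have h2 := Set.ncard_add_ncard_compl ({r} : Set W)
  rw [Set.ncard_singleton] at h2
  rw [Nat.card_coe_set_eq]
  omega

end Tree

/-- The output of a node. -/
def Out.toNodeOutput (o : Out) : NodeOutput := ⟨o.color, o.label, o.links⟩

section Output

variable {V : Type*} {G : SimpleGraph V} {P : PortNumbering G} {idn : V → ℕ}
  {R L q : ℕ} {ν : ℕ → V → Net} {o : V → Out}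

theorem History.mem_links (h : History P idn R L q ν o) {i : ℕ} (hi : i < q) {c : ℕ} {v : V}
    {p : Option ℕ} : (Nat.pair c i, p) ∈ (o v).links ↔
      c ∈ (ν i v).ids ∧ p = ((ν i v).par c).map Prod.fst := by
  rw [h.links]
  constructor
  · rintro ⟨i', hi', c', hc', heq⟩
    rw [Prod.mk.injEq, Nat.pair_eq_pair] at heq
    obtain ⟨⟨rfl, rfl⟩, hp⟩ := heq
    exact ⟨hc', hp⟩
  · rintro ⟨hc, rfl⟩
    exact ⟨i, hi, c, hc, rfl⟩

theorem History.mem_verts (h : History P idn R L q ν o) {i : ℕ} (hi : i < q) {c : ℕ} {v : V} :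
    v ∈ (outputTree P (fun v => (o v).toNodeOutput) (Nat.pair c i)).verts ↔ c ∈ (ν i v).ids := by
  change (∃ p, (Nat.pair c i, p) ∈ (o v).links) ↔ _
  simp only [h.mem_links hi]
  exact ⟨fun ⟨_, h, _⟩ => h, fun h => ⟨_, h, rfl⟩⟩

theorem History.port_iff (h : History P idn R L q ν o) {i : ℕ} (hi : i < q) {c : ℕ} {u v : V} :
    (∃ p : Fin (P.deg u), (P.nbr u p : V) = v ∧
      (Nat.pair c i, some (p : ℕ)) ∈ ((o u).toNodeOutput).links) ↔ parOf P (ν i) c u = some v := by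
  change (∃ p : Fin (P.deg u), (P.nbr u p : V) = v ∧
      (Nat.pair c i, some (p : ℕ)) ∈ (o u).links) ↔ _
  simp only [h.mem_links hi]
  constructor
  · rintro ⟨p, rfl, hc, hp⟩
    obtain ⟨⟨p', j⟩, hp', hpp⟩ := Option.map_eq_some_iff.1 hp.symm
    dsimp only at hpp
    subst hpp
    simp [parOf, hc, hp']
  · intro hp
    have hadj := parOf_adj hp
    refine ⟨⟨portTo P u v, portTo_lt P hadj⟩, nbr_portTo P hadj _, parOf_mem hp, ?_⟩
    rw [(h.forest i hi).par_of_parOf hp]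
    rfl

theorem History.adj_iff (h : History P idn R L q ν o) {i : ℕ} (hi : i < q) {c : ℕ} {u v : V} :
    (outputTree P (fun v => (o v).toNodeOutput) (Nat.pair c i)).Adj u v ↔
      parOf P (ν i) c u = some v ∨ parOf P (ν i) c v = some u := by
  have h1 : (outputTree P (fun v => (o v).toNodeOutput) (Nat.pair c i)).Adj u v ↔
      u ∈ (outputTree P (fun v => (o v).toNodeOutput) (Nat.pair c i)).verts ∧
      v ∈ (outputTree P (fun v => (o v).toNodeOutput) (Nat.pair c i)).verts ∧
      (parOf P (ν i) c u = some v ∨ parOf P (ν i) c v = some u) := by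
    rw [← h.port_iff hi, ← h.port_iff hi]
    rfl
  rw [h1, h.mem_verts hi, h.mem_verts hi]
  refine ⟨fun h => h.2.2, fun h' => ?_⟩
  rcases h' with h' | h'
  · exact ⟨parOf_mem h', (h.forest i hi).parOf_mem_parent h', Or.inl h'⟩
  · exact ⟨(h.forest i hi).parOf_mem_parent h', parOf_mem h', Or.inr h'⟩

/-- A label of color `i` has the form `Nat.pair c i`, so the trees of that color through `v` inject
into the list of `v` at the end of repetition `i`. -/
theorem History.ncard_le (h : History P idn R L q ν o) (hfin : ∀ v, (o v).fin = true)
    (v : V) (i : ℕ) : {c : ℕ | (∃ w, (o w).label = c ∧ (o w).color = i) ∧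
      v ∈ (outputTree P (fun v => (o v).toNodeOutput) c).verts}.ncard ≤ L := by
  classical
  by_cases hi : i < q
  · refine le_trans (Set.ncard_le_ncard (t := ((ν i v).ids.toFinset.image
      fun c => Nat.pair c i : Finset ℕ)) ?_ (Finset.finite_toSet _)) ?_
    · rintro x ⟨⟨w, rfl, hcol⟩, hx⟩
      obtain ⟨i', hi', c, hc, hcol', hl⟩ := h.fin w (hfin w)
      rw [hcol] at hcol'
      subst hcol'
      rw [hl, h.mem_verts hi] at hx
      rw [hl]
      simpa using hx
    · rw [Set.ncard_coe_finset]
      exact Finset.card_image_le.trans ((List.toFinset_card_le _).trans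
        ((h.forest i hi).length_le v))
  · have : {c : ℕ | (∃ w, (o w).label = c ∧ (o w).color = i) ∧
      v ∈ (outputTree P (fun v => (o v).toNodeOutput) c).verts} = ∅ := by
      rw [Set.eq_empty_iff_forall_notMem]
      rintro x ⟨⟨w, rfl, hcol⟩, -⟩
      obtain ⟨i', hi', c, hc, hcol', hl⟩ := h.fin w (hfin w)
      omega
    rw [this]
    simp

variable [Fintype V]

/-- The output describes a tree of depth at most `R`. -/
theorem History.isTree (h : History P idn R L q ν o) (hid : Function.Injective idn) {i : ℕ}
    (hi : i < q) {c : ℕ} {w : V} (hw : c ∈ (ν i w).ids) :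
    (outputTree P (fun v => (o v).toNodeOutput) (Nat.pair c i)).coe.IsTree ∧
      ∃ r, ∀ v, ∃ p : (outputTree P (fun v => (o v).toNodeOutput) (Nat.pair c i)).coe.Walk r v,
        p.length ≤ R := by
  have hF := h.forest i hi
  obtain ⟨r, hr, hr'⟩ := hF.exists_root hw
  obtain ⟨dep, hdep⟩ := hF.depth
  set T := outputTree P (fun v => (o v).toNodeOutput) (Nat.pair c i) with hT
  have hmem : ∀ v : T.verts, c ∈ (ν i v).ids := fun v => (h.mem_verts hi).1 v.2
  let r' : T.verts := ⟨r, (h.mem_verts hi).2 hr⟩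
  have hadj : ∀ u v : T.verts, T.coe.Adj u v ↔
      parOf P (ν i) c u = some v.1 ∨ parOf P (ν i) c v = some u.1 := fun u v => h.adj_iff hi
  have hdep' : ∀ u v : T.verts, parOf P (ν i) c u = some v.1 → dep v c < dep u c :=
    fun u v huv => (hdep u c (hmem u)).2 v huv
  have hroot : ∀ u : T.verts, u ≠ r' → ∃ v : T.verts, parOf P (ν i) c u = some v.1 := by
    intro u hu
    cases hp : parOf P (ν i) c u with
    | none => exact absurd (Subtype.ext (hF.root_unique hid (hmem u) hr hp hr')) hu
    | some v => exact ⟨⟨v, (h.mem_verts hi).2 (hF.parOf_mem_parent hp)⟩, rfl⟩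
  refine ⟨isTree_of_parent (r := r') (dep := fun v => dep v c) hadj ?_ hdep' hroot ?_, r', ?_⟩
  · intro u v v' h1 h2
    rw [h1] at h2
    exact Subtype.ext (Option.some.inj h2)
  · intro v hv
    change parOf P (ν i) c r = _ at hv
    rw [hr'] at hv
    simp at hv
  · intro v
    obtain ⟨p, hp⟩ := exists_walk_root (r := r') (dep := fun v : T.verts => dep v c)
      (fun u v huv => (hadj u v).2 (Or.inl huv)) hdep' hroot v
    exact ⟨p, hp.trans (hdep v c (hmem v)).1⟩

theorem History.isSteinerTree (h : History P idn R L q ν o) (hid : Function.Injective idn)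
    (hfin : ∀ v, (o v).fin = true) (w : V) {D : ℝ} (hD : (R : ℝ) ≤ D) :
    IsSteinerTree (outputTree P (fun v => (o v).toNodeOutput) (o w).label)
      {v | (o v).label = (o w).label} D := by
  obtain ⟨i, hi, c, hc, -, hl⟩ := h.fin w (hfin w)
  rw [hl]
  obtain ⟨h1, r, h2⟩ := h.isTree hid hi ((h.forest i hi).member w c hc)
  refine ⟨h1, ?_, r, fun v => ?_⟩
  · intro v hv
    obtain ⟨i', hi', c', hc', -, hl'⟩ := h.fin v (hfin v)
    rw [Set.mem_ofPred_eq, hl', Nat.pair_eq_pair] at hv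
    obtain ⟨rfl, rfl⟩ := hv
    exact (h.mem_verts hi).2 ((h.forest i' hi).member v c' hc')
  · obtain ⟨p, hp⟩ := h2 v
    exact le_trans (by exact_mod_cast (SimpleGraph.dist_le p).trans hp) hD

theorem History.isWeakDecomposition (h : History P idn R L q ν o) (hid : Function.Injective idn)
    (hfin : ∀ v, (o v).fin = true) {C D : ℝ} (hC : (q : ℝ) ≤ C) (hD : (2 * R : ℝ) ≤ D) :
    IsWeakDecomposition G (fun v => (o v).label) (fun v => (o v).color) C D := by
  refine ⟨fun u v huv => ?_, fun u v hadj hne heq => hne ?_, fun v => ?_, fun u v huv => ?_⟩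
  · obtain ⟨i, hi, c, hc, hcol, hl⟩ := h.fin u (hfin u)
    obtain ⟨i', hi', c', hc', hcol', hl'⟩ := h.fin v (hfin v)
    rw [hl, hl', Nat.pair_eq_pair] at huv
    rw [hcol, hcol', huv.2]
  · obtain ⟨i, hi, c, hc, hcol, hl⟩ := h.fin u (hfin u)
    obtain ⟨i', hi', c', hc', hcol', hl'⟩ := h.fin v (hfin v)
    rw [hcol, hcol'] at heq
    subst heq
    rw [hl, hl', h.separated i hi u v c c' hadj hc hc']
  · obtain ⟨i, hi, c, hc, hcol, hl⟩ := h.fin v (hfin v)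
    rw [hcol]
    exact le_trans (by exact_mod_cast hi) hC
  · obtain ⟨i, hi, c, hc, -, hl⟩ := h.fin u (hfin u)
    obtain ⟨i', hi', c', hc', -, hl'⟩ := h.fin v (hfin v)
    rw [hl, hl', Nat.pair_eq_pair] at huv
    obtain ⟨rfl, rfl⟩ := huv
    obtain ⟨-, r, h2⟩ := h.isTree hid hi ((h.forest i hi).member u c hc)
    obtain ⟨p, hp⟩ := h2 ⟨u, (h.mem_verts hi).2 ((h.forest i hi).member u c hc)⟩
    obtain ⟨p', hp'⟩ := h2 ⟨v, (h.mem_verts hi).2 ((h.forest i hi).member v c hc')⟩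
    let w : G.Walk u v := (p.reverse.append p').map (SimpleGraph.Subgraph.hom _)
    have hw : w.length ≤ 2 * R := by
      have h3 : w.length = (p.reverse.append p').length := SimpleGraph.Walk.length_map _ _
      rw [h3, SimpleGraph.Walk.length_append, SimpleGraph.Walk.length_reverse]
      omega
    exact ⟨⟨w⟩, le_trans (by exact_mod_cast (SimpleGraph.dist_le w).trans hw) hD⟩

end Output

end NetDecomp

namespace NetDecomp

/-! ### The number of rounds -/

section Cost

variable {S : Type}

/-- The number of rounds of a program. -/
def cost (prog : List (Op S)) : ℕ := (schedule prog).length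

theorem cost_nil : cost ([] : List (Op S)) = 0 := rfl

theorem cost_append (p q : List (Op S)) : cost (p ++ q) = cost p + cost q := by
  simp [cost, schedule]

theorem cost_cons (op : Op S) (p : List (Op S)) : cost (op :: p) = op.extra + 1 + cost p := by
  simp [cost, schedule, Op.rounds]

theorem cost_replicate_flatten (r : ℕ) (p : List (Op S)) :
    cost (List.replicate r p).flatten = r * cost p := by
  induction r with
  | zero => simp [cost_nil]
  | succ r ih => rw [List.replicate_succ, List.flatten_cons, cost_append, ih]; ring

theorem cost_replicate (r : ℕ) (op : Op S) :
    cost (List.replicate r op) = r * (op.extra + 1) := by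
  induction r with
  | zero => simp [cost_nil]
  | succ r ih => rw [List.replicate_succ, cost_cons, ih]; ring

theorem cost_flatMap_range_le {F : ℕ → List (Op S)} {B : ℕ} (h : ∀ q, cost (F q) ≤ B) (Q : ℕ) :
    cost ((List.range Q).flatMap F) ≤ Q * B := by
  induction Q with
  | zero => simp [cost_nil]
  | succ Q ih =>
    rw [List.range_succ, List.flatMap_append, cost_append, List.flatMap_singleton]
    have := h Q
    rw [Nat.succ_mul]
    omega

end Cost

section Programs

variable {b L w R T K S Ph : ℕ}

/-- A bound for the number of rounds of a step towards or away from the roots. -/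
def stepCost (b L w : ℕ) : ℕ := 2 * L * w / b + 1

/-- A bound for the number of rounds of a call of the prefix sum primitive. -/
def scanCost (b L w R : ℕ) : ℕ := (2 * R + 4) * stepCost b L w

theorem cost_scan (f : Env → Loc → ℕ) (g : Env → Loc → ℕ → ℕ → Loc) :
    cost (scan b L w R f g) ≤ scanCost b L w R := by
  have h1 : (upOp b L w f).extra + 1 ≤ stepCost b L w := by
    change L * w / b + 1 ≤ 2 * L * w / b + 1
    gcongr
    omega
  have h2 : (downOp b L w f).extra + 1 = stepCost b L w := rfl
  have h3 : (useOp b g).extra + 1 ≤ stepCost b L w := by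
    change 0 * 0 / b + 1 ≤ 2 * L * w / b + 1
    simp
  rw [scan, cost_append, cost_append, cost_replicate, cost_replicate, cost_cons, cost_nil, h2,
    scanCost]
  have h4 := Nat.mul_le_mul_left (R + 2) h1
  calc _ ≤ (R + 2) * stepCost b L w + (R + 1) * stepCost b L w + stepCost b L w := by omega
    _ = (2 * R + 4) * stepCost b L w := by ring

theorem extra_exch (ℓ w : ℕ) (send : Env → Loc → ℕ → ℕ → ℕ)
    (recv : Env → Loc → (ℕ → ℕ → ℕ) → Loc) : (exch b ℓ w send recv).extra = ℓ * w / b := rfl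

theorem four_mul_stepCost_le : 4 * stepCost b L w ≤ scanCost b L w R :=
  Nat.mul_le_mul_right _ (by omega)

/-- The identifier part of at most three numbers costs three rounds, and the remaining `3 * w` bits
are fewer than those of a tree step. -/
theorem exch_wide_le (hb : 0 < b) (hL : 2 ≤ L) {ℓ : ℕ} (hℓ : ℓ ≤ 3) :
    ℓ * (b + w) / b ≤ 2 + stepCost b L w := by
  have h1 : ℓ * (b + w) / b ≤ 3 * (b + w) / b := by gcongr
  have h2 : 3 * (b + w) / b = 3 + 3 * w / b := by
    rw [mul_add, mul_comm 3 b, Nat.mul_add_div hb]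
  have h3 : 3 * w / b ≤ 2 * L * w / b := by gcongr; omega
  rw [stepCost]
  omega

theorem exch_word_le (hL : 1 ≤ L) : 1 * w / b + 1 ≤ stepCost b L w := by
  rw [stepCost]
  gcongr
  omega

theorem cost_cvIter {we B : ℕ} (h : 1 * we / b + 1 ≤ B) :
    cost (cvIter b L w R we) ≤ B + scanCost b L w R := by
  rw [cvIter, cost_cons, exchPhi, extra_exch]
  have := cost_scan (b := b) (L := L) (w := w) (R := R)
    (fun _ => contactValue fun l y => coleVishkin l.work.phi y)
    fun _ l tot _ => { l with work := { l.work with phi := tot } }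
  omega

theorem cost_splitProg (hb : 0 < b) (hL : 2 ≤ L) :
    cost (splitProg b L w R T) ≤ (8 + 2 * T) * scanCost b L w R := by
  have hU : 1 ≤ stepCost b L w := Nat.succ_pos _
  have hM := four_mul_stepCost_le (b := b) (L := L) (w := w) (R := R)
  have hwide := exch_wide_le (w := w) hb hL (show 1 ≤ 3 by norm_num)
  have hword := exch_word_le (b := b) (w := w) (show 1 ≤ L by omega)
  have h1 : 1 * 1 / b ≤ 2 := (Nat.div_le_self _ _).trans (by norm_num)
  have h2 : 1 * 2 / b ≤ 2 := (Nat.div_le_self _ _).trans (by norm_num)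
  have c1 := cost_cvIter (L := L) (w := w) (R := R) hword
  have c2 := cost_cvIter (b := b) (L := L) (w := w) (R := R) (we := b + w)
    (B := 4 * stepCost b L w) (by omega)
  have c3 : cost (scanContact b L w R) ≤ scanCost b L w R := cost_scan _ _
  have c4 : cost (scanToken b L w R) ≤ scanCost b L w R := cost_scan _ _
  have c5 : cost (finalColor b L w R) ≤ stepCost b L w + scanCost b L w R := by
    rw [finalColor, cost_cons, exchPhi, extra_exch]
    exact Nat.add_le_add hword (cost_scan _ _)
  have c6 : T * cost (cvIter b L w R w) ≤ 2 * T * scanCost b L w R := by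
    calc T * cost (cvIter b L w R w) ≤ T * (2 * scanCost b L w R) :=
          Nat.mul_le_mul_left _ (by omega)
      _ = 2 * T * scanCost b L w R := by ring
  simp only [splitProg, cost_append, cost_cons, cost_nil, cost_replicate_flatten, exchCluster,
    exchToken, exchSibling, extra_exch]
  rw [Nat.add_mul]
  omega

theorem cost_growProg (hb : 0 < b) (hL : 2 ≤ L) :
    cost (growProg b L w R K) ≤ 4 * scanCost b L w R := by
  have hU : 1 ≤ stepCost b L w := Nat.succ_pos _
  have hM := four_mul_stepCost_le (b := b) (L := L) (w := w) (R := R)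
  have hwide := exch_wide_le (w := w) hb hL (show 3 ≤ 3 by norm_num)
  have h1 : 1 * 1 / b ≤ 1 := (Nat.div_le_self _ _).trans (by norm_num)
  have c3 : cost (scanSize b L w R) ≤ scanCost b L w R := cost_scan _ _
  have c4 : cost (scanProposals b L w R K) ≤ scanCost b L w R := cost_scan _ _
  simp only [growProg, cost_append, cost_cons, cost_nil, exchGrow,
    exchProposal, exchDecision, extra_exch]
  omega

theorem cost_decompProg (hb : 0 < b) (hL : 2 ≤ L) (hPh : 0 < Ph) (Q : ℕ) :
    cost (decompProg b L w R T K S Ph Q) ≤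
      Q * (Ph * ((9 + 2 * T + 4 * S) * scanCost b L w R)) := by
  refine cost_flatMap_range_le (fun q => ?_) Q
  have h1 : cost (phaseProg b L w R T K S) ≤ (8 + 2 * T + 4 * S) * scanCost b L w R := by
    rw [phaseProg, cost_append, cost_replicate_flatten]
    calc _ ≤ (8 + 2 * T) * scanCost b L w R + S * (4 * scanCost b L w R) :=
          Nat.add_le_add (cost_splitProg hb hL) (Nat.mul_le_mul_left _ (cost_growProg hb hL))
      _ = _ := by ring
  -- The single round of `finish` is absorbed by raising the constant from 8 to 9.
  have h2 : 1 ≤ Ph * scanCost b L w R :=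
    Nat.mul_pos hPh (Nat.mul_pos (by omega) (Nat.succ_pos _))
  rw [repProg, cost_append, cost_replicate_flatten, cost_cons, cost_nil, finish, extra_exch]
  have h3 := Nat.mul_le_mul_left Ph h1
  calc _ ≤ Ph * ((8 + 2 * T + 4 * S) * scanCost b L w R) + Ph * scanCost b L w R := by
        simp only [Nat.zero_mul, Nat.zero_div]; omega
    _ = _ := by ring

end Programs

/-! ### The parameters -/

section Parameters

/-- The width of the numbers in a message. -/
def wordSize (x b : ℕ) : ℕ := x + Nat.size b + 8

/-- The program for graphs with fewer than `2 ^ x` nodes. -/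
noncomputable def mainProg (x b : ℕ) : List (Op (Loc × Regs)) :=
  decompProg b (24 * x + 1) (wordSize x b) (24 * x * (48 * x * x)) (cvSteps b) (48 * x)
    (48 * x * x) (24 * x) x

/-- Bernoulli's inequality for `(1 + 1/K) ^ K`. -/
theorem two_mul_pow_self_le {K : ℕ} (hK : 0 < K) : 2 * K ^ K ≤ (K + 1) ^ K := by
  have hK' : (0 : ℝ) < K := by exact_mod_cast hK
  have h := one_add_mul_le_pow (a := (1 / K : ℝ)) (by
    have : (0 : ℝ) ≤ 1 / K := by positivity
    linarith) K
  have h2 : (1 : ℝ) + K * (1 / K) = 2 := by field_simp; norm_num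
  rw [h2] at h
  have h3 : ((K : ℝ) + 1) ^ K = (1 + 1 / K) ^ K * K ^ K := by
    rw [← mul_pow]; congr 1; field_simp
  have h4 : (2 : ℝ) * K ^ K ≤ (K + 1) ^ K := by
    rw [h3]; gcongr
  exact_mod_cast h4

variable {V : Type*} [Fintype V]

/-- The constants: `2 * 23 ^ 24 ≤ 24 ^ 24`, so `24 * x` phases reduce a component by the factor `2 ^
x > n`; `K` is twice the number of phases, so at most half of the nodes die; and `S = K * x` growth
steps give `(1 + 1/K) ^ S ≥ 2 ^ x`. -/
theorem valid_params {idn : V → ℕ} {b x : ℕ} (hb : 0 < b) (hx : 0 < x)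
    (hinj : Function.Injective idn) (hid : ∀ v, idn v < 2 ^ b) (hcard : Fintype.card V < 2 ^ x) :
    Valid idn b (24 * x + 1) (wordSize x b) (24 * x * (48 * x * x)) (cvSteps b) (48 * x)
      (48 * x * x) (24 * x) where
  b_pos := hb
  inj := hinj
  id_lt := hid
  card_lt := hcard.trans_le (Nat.pow_le_pow_right (by norm_num) (by rw [wordSize]; omega))
  bits_le := by
    have : Nat.clog 2 b ≤ Nat.size b := Nat.clog_le_of_le_pow (Nat.lt_size_self b).le
    rw [nextBits, wordSize]
    omega
  three_le := by rw [wordSize]; omega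
  cv := by
    rw [← Function.iterate_succ_apply, Function.iterate_succ_apply']
    exact nextBits_le_three ((nextBits_iterate_cvSteps hb).trans (by norm_num))
  slots_lt := by
    have h1 : x < 2 ^ x := Nat.lt_two_pow_self
    calc 24 * x + 1 < 2 ^ 8 * 2 ^ x := by omega
      _ = 2 ^ (x + 8) := by ring
      _ ≤ 2 ^ wordSize x b := Nat.pow_le_pow_right (by norm_num) (by rw [wordSize]; omega)
  steps := by
    have hpos : 0 < (48 * x) ^ (48 * x * x) := by positivity
    calc (48 * x) ^ (48 * x * x) * Fintype.card V < (48 * x) ^ (48 * x * x) * 2 ^ x :=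
          Nat.mul_lt_mul_of_pos_left hcard hpos
      _ = (2 * (48 * x) ^ (48 * x)) ^ x := by rw [mul_pow 2, ← pow_mul, mul_comm]
      _ ≤ ((48 * x + 1) ^ (48 * x)) ^ x :=
          Nat.pow_le_pow_left (two_mul_pow_self_le (by omega)) _
      _ = _ := by rw [← pow_mul]
  depth_le := le_rfl
  slots_le := le_rfl
  kill := by omega
  phases := by
    calc 23 ^ (24 * x) * Fintype.card V < 23 ^ (24 * x) * 2 ^ x :=
          Nat.mul_lt_mul_of_pos_left hcard (by positivity)
      _ = (2 * 23 ^ 24) ^ x := by rw [mul_pow, ← pow_mul, mul_comm]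
      _ ≤ (24 ^ 24) ^ x := Nat.pow_le_pow_left (by norm_num) _
      _ = 24 ^ (24 * x) := by rw [← pow_mul]
      _ ≤ 24 ^ (24 * x) * 2 := Nat.le_mul_of_pos_right _ (by norm_num)

theorem size_le_self {b : ℕ} : Nat.size b ≤ b := Nat.size_le.2 Nat.lt_two_pow_self

/-- With `logStar_le_size` it shows that `log^* b` times the `log b` part of a word is `O(b)`, that
is, costs a constant number of messages. -/
theorem size_quadratic_le {b : ℕ} (hb : 0 < b) : (Nat.size b + 1) * (Nat.size b + 8) ≤ 18 * b := by
  have key : ∀ s, (s + 2) * (s + 9) ≤ 18 * 2 ^ s := by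
    intro s
    induction s with
    | zero => norm_num
    | succ s ih =>
      rw [pow_succ]
      have : 1 ≤ 2 ^ s := Nat.one_le_two_pow
      nlinarith
  obtain ⟨s, hs⟩ : ∃ s, Nat.size b = s + 1 := Nat.exists_eq_succ_of_ne_zero
    (Nat.pos_iff_ne_zero.1 (Nat.size_pos.2 hb))
  have h1 : 2 ^ s ≤ b := Nat.lt_size.1 (by omega)
  rw [hs]
  calc _ ≤ 18 * 2 ^ s := key s
    _ ≤ _ := by omega

/-- Let `U` be the rounds of a tree step, at most `50 * x * (w / b) + 1`. For the growth, `w / b ≤ k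
+ 10` suffices and gives `x ^ 8`. For the color reduction that would leave `log^* b` times `x ^ 6`;
instead `log^* b * (w / b) ≤ 20 * x` is used, so that `log^* b` keeps only the summand 1 of `U` and
the rest is of order `x ^ 7`. -/
theorem cost_mainProg_le {x b k : ℕ} (hx : 0 < x) (hb : 0 < b) (hxb : x ≤ (k + 1) * b) :
    (cost (mainProg x b) : ℝ) ≤
      200000 * (11000 * (k + 20) * x ^ 8 + (logStar b : ℝ) * x ^ 5) := by
  have h0 := cost_decompProg (b := b) (L := 24 * x + 1) (w := wordSize x b)
    (R := 24 * x * (48 * x * x)) (T := cvSteps b) (K := 48 * x) (S := 48 * x * x) (Ph := 24 * x)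
    hb (by omega) (by omega) x
  have h1 : (cost (mainProg x b) : ℝ) ≤ (x * (24 * x * ((9 + 2 * (logStar b + 2) + 4 * (48 * x * x)) *
      ((2 * (24 * x * (48 * x * x)) + 4) * (stepCost b (24 * x + 1) (wordSize x b) : ℝ)))) : ℝ) := by
    exact_mod_cast h0
  set U : ℝ := (stepCost b (24 * x + 1) (wordSize x b) : ℝ) with hU
  set ls : ℝ := (logStar b : ℝ) with hls
  have hX : (1 : ℝ) ≤ x := by exact_mod_cast hx
  have hB : (1 : ℝ) ≤ b := by exact_mod_cast hb
  have hb0 : (0 : ℝ) < b := by linarith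
  have hU1 : U ≤ 50 * x * ((wordSize x b : ℝ) / b) + 1 := by
    have h2 : ((2 * (24 * x + 1) * wordSize x b / b : ℕ) : ℝ) ≤
        ((2 * (24 * x + 1) * wordSize x b : ℕ) : ℝ) / b := Nat.cast_div_le
    have h3 : ((2 * (24 * x + 1) * wordSize x b : ℕ) : ℝ) / b =
      2 * (24 * x + 1) * ((wordSize x b : ℝ) / b) := by push_cast; ring
    have h4 : (2 * (24 * x + 1) : ℝ) ≤ 50 * x := by linarith
    have h5 : (0 : ℝ) ≤ (wordSize x b : ℝ) / b := by positivity
    have h6 := mul_le_mul_of_nonneg_right h4 h5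
    rw [hU, stepCost]
    push_cast at h2 ⊢
    push_cast at h3
    linarith
  have hls0 : (0 : ℝ) ≤ ls := by positivity
  have hw1 : (wordSize x b : ℝ) / b ≤ k + 10 := by
    rw [div_le_iff₀ hb0]
    have : wordSize x b ≤ (k + 10) * b := by
      have := size_le_self (b := b)
      rw [wordSize]
      nlinarith
    exact_mod_cast this
  have hw2 : ls * ((wordSize x b : ℝ) / b) ≤ 20 * x := by
    rw [← mul_div_assoc, div_le_iff₀ hb0]
    have h2 := logStar_le_size b
    have h3 := size_quadratic_le hb
    have h4 := size_le_self (b := b)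
    have : logStar b * wordSize x b ≤ 20 * x * b := by
      calc logStar b * wordSize x b ≤ (Nat.size b + 1) * wordSize x b := Nat.mul_le_mul_right _ h2
        _ = (Nat.size b + 1) * x + (Nat.size b + 1) * (Nat.size b + 8) := by
          rw [wordSize]; ring
        _ ≤ (b + b) * x + 18 * b :=
          Nat.add_le_add (Nat.mul_le_mul_right _ (by omega)) h3
        _ ≤ (b + b) * x + 18 * b * x := Nat.add_le_add_left (Nat.le_mul_of_pos_right _ hx) _
        _ = 20 * x * b := by ring
    rw [hls]
    exact_mod_cast this
  have hU0 : 0 ≤ U := by positivity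
  have hk : (0 : ℝ) ≤ k := by positivity
  have hx3 : (1 : ℝ) ≤ (x : ℝ) ^ 3 := one_le_pow₀ hX
  have hx2 : (1 : ℝ) ≤ (x : ℝ) ^ 2 := one_le_pow₀ hX
  have hUx : U ≤ 50 * (k + 11) * x := by nlinarith
  have hlsU : ls * U ≤ 1000 * x ^ 2 + ls := by
    calc ls * U ≤ ls * (50 * x * ((wordSize x b : ℝ) / b) + 1) :=
          mul_le_mul_of_nonneg_left hU1 hls0
      _ = 50 * x * (ls * ((wordSize x b : ℝ) / b)) + ls := by ring
      _ ≤ 50 * x * (20 * x) + ls := by gcongr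
      _ = _ := by ring
  have h7 : (2 * (24 * x * (48 * x * x)) + 4 : ℝ) ≤ 2308 * x ^ 3 := by nlinarith
  have h8 : (9 + 2 * (ls + 2) + 4 * (48 * x * x)) * U ≤
      205 * x ^ 2 * (50 * (k + 11) * x) + 2 * (1000 * x ^ 2 + ls) := by
    calc (9 + 2 * (ls + 2) + 4 * (48 * x * x)) * U
        = (13 + 192 * x ^ 2) * U + 2 * (ls * U) := by ring
      _ ≤ 205 * x ^ 2 * U + 2 * (ls * U) := by
        gcongr
        linarith
      _ ≤ _ := by gcongr
  have h8' : (9 + 2 * (ls + 2) + 4 * (48 * x * x)) * U ≤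
      11000 * (k + 20) * x ^ 3 + 2 * ls := by
    have : (x : ℝ) ^ 2 ≤ x ^ 3 := pow_le_pow_right₀ hX (by norm_num)
    nlinarith
  have h9 : 0 ≤ (9 + 2 * (ls + 2) + 4 * (48 * x * x)) * U := by positivity
  calc (cost (mainProg x b) : ℝ)
      ≤ 24 * x ^ 2 * (2 * (24 * x * (48 * x * x)) + 4) *
          ((9 + 2 * (ls + 2) + 4 * (48 * x * x)) * U) := by
        refine h1.trans (le_of_eq ?_); ring
    _ ≤ 24 * x ^ 2 * (2308 * x ^ 3) * (11000 * (k + 20) * x ^ 3 + 2 * ls) := by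
        gcongr
    _ = 55392 * (11000 * (k + 20) * x ^ 8 + 2 * ls * x ^ 5) := by ring
    _ ≤ 200000 * (11000 * (k + 20) * x ^ 8 + ls * x ^ 5) := by
        have h10 : 0 ≤ ls * (x : ℝ) ^ 5 := by positivity
        have h11 : 0 ≤ (k + 20 : ℝ) * (x : ℝ) ^ 8 := by positivity
        nlinarith

end Parameters

end NetDecomp

/-! ### The algorithm and the final bounds in terms of `log n`. -/

namespace NetDecomp

/-- The algorithm. -/
noncomputable def decompAlgorithm : CongestAlgorithm :=
  compile (fun N b => mainProg (Nat.size N) b) (fun e => (initLoc e, Regs.clear))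
    fun s => s.1.out.toNodeOutput

/-- The bit length exceeds `k * log n` by at most 1, and `1 ≤ log n` because `n ≥ 2`. -/
theorem size_le_mul_logb {n N k : ℕ} (hn : 2 ≤ n) (hN : 0 < N) (hk : N ≤ n ^ k) :
    (Nat.size N : ℝ) ≤ (k + 1) * Real.logb 2 n := by
  obtain ⟨s, hs⟩ : ∃ s, Nat.size N = s + 1 := Nat.exists_eq_succ_of_ne_zero
    (Nat.pos_iff_ne_zero.1 (Nat.size_pos.2 hN))
  have h1 : 2 ^ s ≤ n ^ k := (Nat.lt_size.1 (by omega)).trans hk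
  have hn' : (2 : ℝ) ≤ n := by exact_mod_cast hn
  have h2 : (1 : ℝ) ≤ Real.logb 2 n := by
    rw [Real.le_logb_iff_rpow_le (by norm_num) (by linarith)]
    simpa using hn'
  have h3 : (s : ℝ) ≤ k * Real.logb 2 n := by
    have h4 : ((2 : ℝ) ^ s) ≤ (n : ℝ) ^ k := by exact_mod_cast h1
    have h5 := Real.logb_le_logb_of_le (b := 2) (by norm_num) (by positivity) h4
    rwa [Real.logb_pow, Real.logb_pow, Real.logb_self_eq_one (by norm_num), mul_one] at h5
  rw [hs]
  push_cast
  linarith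

theorem ofBits_injective {b : ℕ} : Function.Injective fun f : Fin b → Bool => Nat.ofBits f := by
  intro f g h
  funext i
  have := congrArg (fun m => m.testBit i) h
  simpa [Nat.testBit_ofBits] using this

end NetDecomp

open NetDecomp in
theorem mainTheorem8 :
    ∃ A : CongestAlgorithm, ∀ k : ℕ, ∃ C : ℝ, 0 < C ∧
      ∀ (V : Type*) [Fintype V] (G : SimpleGraph V) (P : PortNumbering G)
        (b : ℕ) (ident : V → Fin b → Bool) (n N : ℕ),
        Function.Injective ident → Fintype.card V = n → 2 ≤ n → n ≤ N → N ≤ n ^ k →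
        (A.rounds N b : ℝ) ≤
            C * (Real.logb 2 n ^ 8 + (logStar b : ℝ) * Real.logb 2 n ^ 5) ∧
        A.MessagesAtMost P N ident (C * b) ∧
        IsWeakDecomposition G
          (fun v => (A.result P N ident v).cluster) (fun v => (A.result P N ident v).color)
          (C * Real.logb 2 n) (C * Real.logb 2 n ^ 3) ∧
        (∀ w : V,
          IsSteinerTree (outputTree P (A.result P N ident) (A.result P N ident w).cluster)
            {v | (A.result P N ident v).cluster = (A.result P N ident w).cluster}
            (C * Real.logb 2 n ^ 3)) ∧
        (∀ (v : V) (q : ℕ),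
          (({c : ℕ | (∃ w : V, (A.result P N ident w).cluster = c ∧
                (A.result P N ident w).color = q) ∧
              v ∈ (outputTree P (A.result P N ident) c).verts}.ncard : ℕ) : ℝ) ≤
            C * Real.logb 2 n) := by
  -- The first factors come from `cost_mainProg_le`; `(k + 1) ^ 8` pays for replacing `x` by `(k +
  -- 1) * log n` in powers up to the eighth. The algorithm does not depend on `k`.
  refine ⟨decompAlgorithm, fun k => ⟨200000 * (11000 * (k + 20)) * (k + 1) ^ 8, by positivity, ?_⟩⟩
  intro V _ G P b ident n N hident hn hn2 hnN hNk
  set C : ℝ := 200000 * (11000 * (k + 20)) * (k + 1) ^ 8 with hC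
  set x := Nat.size N with hx
  set l := Real.logb 2 (n : ℝ) with hl
  have hx0 : 0 < x := Nat.size_pos.2 (by omega)
  have hnx : n < 2 ^ x := hnN.trans_lt (Nat.lt_size_self N)
  have hn' : (2 : ℝ) ≤ n := by exact_mod_cast hn2
  have hcard : n ≤ 2 ^ b := by
    have := Fintype.card_le_of_injective ident hident
    simpa [hn] using this
  have hb : 0 < b := by
    rcases Nat.eq_zero_or_pos b with rfl | h
    · simp at hcard; omega
    · exact h
  have hl1 : 1 ≤ l := by
    rw [hl, Real.le_logb_iff_rpow_le (by norm_num) (by linarith)]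
    simpa using hn'
  have hlb : l ≤ b := by
    rw [hl, Real.logb_le_iff_le_rpow (by norm_num) (by linarith), Real.rpow_natCast]
    exact_mod_cast hcard
  have hxl : (x : ℝ) ≤ (k + 1) * l := size_le_mul_logb hn2 (by omega) hNk
  have hk1 : (1 : ℝ) ≤ k + 1 := by
    have : (0 : ℝ) ≤ k := by positivity
    linarith
  have hxb : x ≤ (k + 1) * b := by
    have : (x : ℝ) ≤ (k + 1) * b := hxl.trans (by gcongr)
    exact_mod_cast this
  have hx1 : (1 : ℝ) ≤ x := by exact_mod_cast hx0
  have hpow : ∀ m ≤ 8, (x : ℝ) ^ m ≤ (k + 1) ^ 8 * l ^ m := by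
    intro m hm
    calc (x : ℝ) ^ m ≤ ((k + 1) * l) ^ m := by gcongr
      _ = (k + 1) ^ m * l ^ m := by rw [mul_pow]
      _ ≤ (k + 1) ^ 8 * l ^ m := by gcongr
  have hCk : ∀ a : ℝ, 0 ≤ a → a ≤ 200000 → a * (k + 1) ^ 8 ≤ C := by
    intro a ha ha'
    rw [hC]
    have : (1 : ℝ) ≤ 11000 * (k + 20) := by linarith
    gcongr
    nlinarith
  have hscale : ∀ (a : ℝ) (m : ℕ), m ≤ 8 → 0 ≤ a → a ≤ 200000 → a * x ^ m ≤ C * l ^ m := by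
    intro a m hm ha ha'
    calc a * (x : ℝ) ^ m ≤ a * ((k + 1) ^ 8 * l ^ m) := by gcongr; exact hpow m hm
      _ = a * (k + 1) ^ 8 * l ^ m := by ring
      _ ≤ C * l ^ m := by gcongr; exact hCk a ha ha'
  have hinj : Function.Injective fun v => Nat.ofBits (ident v) := ofBits_injective.comp hident
  have : Nonempty V := Fintype.card_pos_iff.1 (by omega)
  obtain ⟨ν, β, hrun, hH, hfin⟩ := run_decomp (P := P) (valid_params hb hx0 hinj
    (fun v => Nat.ofBits_lt_two_pow _) (by rw [hn]; exact hnx)) (by omega)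
    (Q := x) (by rw [hn]; exact hnx)
  have hres : decompAlgorithm.result P N ident = fun v => (β v).out.toNodeOutput := by
    rw [decompAlgorithm, compile_result P _ _ _ N hb]
    funext v
    exact congrArg (fun σ : V → Loc × Regs => (σ v).1.out.toNodeOutput) hrun
  rw [hres]
  have hdepth : ((24 * x * (48 * x * x) : ℕ) : ℝ) = 1152 * (x : ℝ) ^ 3 := by
    push_cast; ring
  refine ⟨?_, ?_, ?_, ?_, ?_⟩
  · have h1 := cost_mainProg_le hx0 hb hxb
    have h2 : (decompAlgorithm.rounds N b : ℝ) = cost (mainProg x b) := rfl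
    rw [h2]
    refine h1.trans ?_
    have h3 := hpow 8 le_rfl
    have h4 : 200000 * (x : ℝ) ^ 5 ≤ C * l ^ 5 := hscale 200000 5 (by norm_num) (by norm_num) le_rfl
    calc 200000 * (11000 * (k + 20) * (x : ℝ) ^ 8 + (logStar b : ℝ) * x ^ 5)
        = 200000 * (11000 * (k + 20)) * (x : ℝ) ^ 8 + logStar b * (200000 * x ^ 5) := by ring
      _ ≤ 200000 * (11000 * (k + 20)) * ((k + 1) ^ 8 * l ^ 8) + logStar b * (C * l ^ 5) := by
          gcongr
      _ = C * (l ^ 8 + logStar b * l ^ 5) := by rw [hC]; ring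
  · refine compile_messagesAtMost P _ _ _ N ident _ ?_
    have h1 := hCk 1 (by norm_num) (by norm_num)
    have h2 : (1 : ℝ) ≤ (k + 1) ^ 8 := one_le_pow₀ hk1
    have h3 : (0 : ℝ) ≤ b := by positivity
    nlinarith
  · refine hH.isWeakDecomposition hinj hfin ?_ ?_
    · simpa using hscale 1 1 (by norm_num) (by norm_num) (by norm_num)
    · rw [hdepth, ← mul_assoc]
      exact hscale _ 3 (by norm_num) (by norm_num) (by norm_num)
  · intro w
    refine hH.isSteinerTree hinj hfin w ?_
    rw [hdepth]
    exact hscale _ 3 (by norm_num) (by norm_num) (by norm_num)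
  · intro v q
    refine le_trans (Nat.cast_le.2 (hH.ncard_le hfin v q)) ?_
    -- The number of trees `24 * x + 1` is at most `25 * x`.
    have h1 := hscale 25 1 (by norm_num) (by norm_num) (by norm_num)
    rw [pow_one, pow_one] at h1
    push_cast
    linarith
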